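/- **Setting.** A *level graph* $\mathcal G=(G,\gamma)$ is a finite simple directed graph $G=(V,E)$ with a function $\gamma:V\to\mathbb R$ such that $\gamma(u)<\gamma(v)$ for every edge $(u,v)$. Neighbourhoods, degrees and vertex covers refer to the underlying undirected graph. A *level planar drawing* $\Gamma$ of $\mathcal G$ is a crossing-free drawing in the plane in which every vertex $v$ has y-coordinate $\gamma(v)$ and every edge $(u,v)$ is a curve from $u$ to $v$ along which the y-coordinate strictly increases (a y-monotone curve). Let $C$ be a vertex cover of $G$. *Visibility extensions.* A *visibility edge* for $\Gamma$ is a y-monotone curve joining two vertices, or a horizontal segment joining two consecutive vertices of a common level, that can be inserted into $\Gamma$ without creating crossings (parallel edges are allowed). A *visibility extension* $\Lambda$ of $\Gamma$ with respect to $C$ is obtained by inserting an inclusion-maximal set of pairwise non-crossing visibility edges between vertices of $C$ such that for every two parallel edges of $\Lambda$ some vertex of $C$ lies in the interior of the simple closed curve formed by them. *Ears.* An *ear* is a vertex of $V\setminus C$ of degree $2$ that is a source or a sink. Let $v$ be an ear with neighbours $c_a,c_b$, $\gamma(c_a)\ge\gamma(c_b)$. It is a *top* ear if $\gamma(v)>\gamma(c_a)$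 and a *bottom* ear if $\gamma(v)<\gamma(c_b)$. If $\gamma(c_a)>\gamma(c_b)$, a top ear is *left* (*right*) if the edge $c_bv$ passes to the left (right) of $c_a$, and a bottom ear is *left* (*right*) if the edge $c_av$ passes to the left (right) of $c_b$. If $\gamma(c_a)=\gamma(c_b)$, top ears are left and bottom ears are right. For each pair $c_a,c_b$ and each side (left or right), the ears of this pair on this side are all top ears or all bottom ears. The *outermost* (*innermost*) one is the one with largest (smallest) y-coordinate if they are top ears and with smallest (largest) y-coordinate if they are bottom ears. Let $\Gamma'$ be the subdrawing formed by the edges incident to these ears; if a bounded face of $\Gamma'$ contains a vertex of $C$, then the two ears on its boundary are *bounding* ears. Ears that are outermost, innermost or bounding for some pair and side are *crucial*. The *core* consists of $C$, all vertices of $V\setminus C$ of degree at least $3$, and all crucial ears. *Refined visibility extensions.* A *refined visibility extension* of $\Gamma$ with respect to $C$ is a crossing-free drawing $\Lambda'$ that consists of a visibility extension $\Lambda$ of $\Gamma$ with respect to $C$ and of additional vertices with incident edges drawn as y-monotone curves, such that, not counting the visibility edges, it is a level planar drawing of a level graph $\mathcal G'$ on a vertex set $V'\supseteq V$ that has $\mathcal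 G$ as its induced subgraph on $V$; $C$ is a vertex cover of $\mathcal G'$; every vertex of $V'\setminus V$ is an ear of $\mathcal G'$; the crucial ears of $\Lambda'$ are exactly the vertices of $V'\setminus V$; and $|V'\setminus V|\le K|C|$ for some constant $K$. For $\Lambda'$, ears, crucial ears and the core are taken in $\mathcal G'$ and its drawing. **Lemma.** There is an absolute constant $c$ (independent also of $K$) such that the following holds. Let $\mathcal G$ be a level graph without isolated vertices, let $C$ be a vertex cover of $G$ with $k=|C|$, let $\Gamma$ be a level planar drawing of $\mathcal G$, let $\Lambda$ be a visibility extension or a refined visibility extension of $\Gamma$ with respect to $C$, and let $\Lambda_{\mathrm{core}}$ be the subdrawing of $\Lambda$ (including visibility edges) induced by the core of $\Lambda$ with respect to $C$. Then $\Lambda_{\mathrm{core}}$ is connected (provided that the graph is non-empty), and it has at most $ck$ vertices and at most $ck$ edges. In particular, $\Lambda$ has at most $ck$ outermost, at most $ck$ innermost and at most $ck$ bounding ears. -/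

import Mathlib

/-- A level graph `(G, γ)` on the vertex set `V`: a simple directed graph with a real level
assignment that strictly increases along every edge. -/
structure LevelGraph (V : Type*) where
  Adj : V → V → Prop
  level : V → ℝ
  level_lt : ∀ u v, Adj u v → level u < level v

/-- An edge drawn in the plane: its two endpoints and the set of points of the curve. -/
@[ext] structure Arc (V : Type*) where
  src : V
  tgt : V
  pts : Set (ℝ × ℝ)

/-- The same curve, with its endpoints renamed. -/
def Arc.map {V W : Type*} (f : V → W) (A : Arc V) : Arc W := ⟨f A.src, f A.tgt, A.pts⟩

/-- `v` is an endpoint of `A`. -/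
def Arc.Incident {V : Type*} (A : Arc V) (v : V) : Prop := v = A.src ∨ v = A.tgt

/-- `s` is a curve from `p` to `q` along which the y-coordinate strictly increases
(so that the x-coordinate is a continuous function of the y-coordinate). -/
def IsYMonotone (p q : ℝ × ℝ) (s : Set (ℝ × ℝ)) : Prop :=
  p.2 < q.2 ∧ ∃ f : ℝ → ℝ, ContinuousOn f (Set.Icc p.2 q.2) ∧ f p.2 = p.1 ∧ f q.2 = q.1 ∧
    s = {z | z.2 ∈ Set.Icc p.2 q.2 ∧ z.1 = f z.2}

/-- `s` is the horizontal segment from `p` to `q`, where `p` lies to the left of `q`. -/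
def IsHorizontalSegment (p q : ℝ × ℝ) (s : Set (ℝ × ℝ)) : Prop :=
  p.2 = q.2 ∧ p.1 < q.1 ∧ s = {z | z.2 = p.2 ∧ z.1 ∈ Set.Icc p.1 q.1}

/-- Some point of `s` lies horizontally to the left of `p`. -/
def PassesLeftOf (s : Set (ℝ × ℝ)) (p : ℝ × ℝ) : Prop := ∃ x, x < p.1 ∧ (x, p.2) ∈ s

/-- Some point of `s` lies horizontally to the right of `p`. -/
def PassesRightOf (s : Set (ℝ × ℝ)) (p : ℝ × ℝ) : Prop := ∃ x, p.1 < x ∧ (x, p.2) ∈ s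

namespace LevelGraph

variable {V : Type*} (G : LevelGraph V)

/-- Neighbours in the underlying undirected graph. -/
def nbrs (v : V) : Set V := {u | G.Adj u v ∨ G.Adj v u}

def NoIsolated : Prop := ∀ v, (G.nbrs v).Nonempty

def IsVertexCover (C : Finset V) : Prop := ∀ u v, G.Adj u v → u ∈ C ∨ v ∈ C

/-- An ear with respect to `C`: a vertex outside `C` of degree 2 that is a source or a sink. -/
def IsEar (C : Finset V) (v : V) : Prop :=
  v ∉ C ∧ (G.nbrs v).ncard = 2 ∧ ((∀ u, ¬ G.Adj u v) ∨ (∀ u, ¬ G.Adj v u))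

/-- `v` is an ear whose two neighbours are `a` and `b`, where `γ(a) ≥ γ(b)`. -/
def IsEarOf (C : Finset V) (a b v : V) : Prop :=
  G.IsEar C v ∧ G.nbrs v = {a, b} ∧ G.level b ≤ G.level a

/-- The vertices outside `C` of degree at least 3. -/
def highDegree (C : Finset V) : Set V := {v | v ∉ C ∧ 3 ≤ (G.nbrs v).ncard}

/-- The data of a drawing that respects the levels: the x-coordinates of the vertices, and a curve
`curve u v` for each edge `(u, v)`. The values `curve u v` at non-edges play no role. -/
structure Drawing (G : LevelGraph V) where
  x : V → ℝ
  curve : V → V → Set (ℝ × ℝ)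

namespace Drawing

variable {G} (Γ : G.Drawing)

/-- The point that represents the vertex `v`. -/
def pos (v : V) : ℝ × ℝ := (Γ.x v, G.level v)

/-- The drawn edges of the graph. -/
def edgeArcs : Set (Arc V) := {A | G.Adj A.src A.tgt ∧ A.pts = Γ.curve A.src A.tgt}

/-- The curve `A` contains no vertex other than its endpoints. -/
def AvoidsVertices (A : Arc V) : Prop := ∀ v, Γ.pos v ∈ A.pts → A.Incident v

/-- The curves `A` and `B` do not cross: they meet at most in common endpoints. -/
def NonCrossing (A B : Arc V) : Prop :=
  ∀ p ∈ A.pts ∩ B.pts, ∃ v, A.Incident v ∧ B.Incident v ∧ p = Γ.pos v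

/-- `Γ` is a level planar drawing: a crossing-free drawing in which each edge is a y-monotone curve
directed upwards and each vertex has the y-coordinate given by its level. -/
def IsLevelPlanar : Prop :=
  Function.Injective Γ.pos ∧
  (∀ A ∈ Γ.edgeArcs, IsYMonotone (Γ.pos A.src) (Γ.pos A.tgt) A.pts ∧ Γ.AvoidsVertices A) ∧
  (∀ A ∈ Γ.edgeArcs, ∀ B ∈ Γ.edgeArcs, A ≠ B → Γ.NonCrossing A B)

/-- `A` can be inserted into `Γ` without creating a crossing. -/
def CanInsert (A : Arc V) : Prop :=
  Γ.AvoidsVertices A ∧ ∀ B ∈ Γ.edgeArcs, Γ.NonCrossing A B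

/-- A visibility edge: a y-monotone curve joining two vertices, or a horizontal segment joining two
consecutive vertices of a level, that can be inserted without creating a crossing. (A segment that
contains no vertex besides its endpoints joins consecutive vertices of its level.) -/
def IsVisibilityEdge (A : Arc V) : Prop :=
  (IsYMonotone (Γ.pos A.src) (Γ.pos A.tgt) A.pts ∨
    IsHorizontalSegment (Γ.pos A.src) (Γ.pos A.tgt) A.pts) ∧ Γ.CanInsert A

/-- `p` lies in the interior of the closed curve formed by the finitely many y-monotone arcs in `K`,
by the even-odd rule: `p` is not on the curve, and the horizontal ray from `p` to the left meets an
odd number of the arcs. An arc counts if the height of `p` is at least that of its lower and less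
than that of its upper endpoint, so that rays through vertices are counted correctly. For a simple
closed curve this is the bounded component of the complement of the curve. -/
def Encloses (_Γ : G.Drawing) (K : Set (Arc V)) (p : ℝ × ℝ) : Prop :=
  (∀ A ∈ K, p ∉ A.pts) ∧
  Odd {A ∈ K | G.level A.src ≤ p.2 ∧ p.2 < G.level A.tgt ∧ PassesLeftOf A.pts p}.ncard

/-- `S` is a set of pairwise non-crossing visibility edges between vertices of `C` such that any two
parallel edges of the resulting drawing have a vertex of `C` in the interior of the closed curve
that they form. -/
def IsVisibilitySet (C : Finset V) (S : Set (Arc V)) : Prop :=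
  (∀ A ∈ S, Γ.IsVisibilityEdge A ∧ A.src ∈ C ∧ A.tgt ∈ C) ∧
  (∀ A ∈ S, ∀ B ∈ S, A ≠ B → Γ.NonCrossing A B) ∧
  (∀ A ∈ Γ.edgeArcs ∪ S, ∀ B ∈ Γ.edgeArcs ∪ S, A ≠ B → A.src = B.src → A.tgt = B.tgt →
    ∃ c ∈ C, Γ.Encloses {A, B} (Γ.pos c))

/-- The drawing obtained from `Γ` by inserting the arcs of `S` is a visibility extension of `Γ` with
respect to `C`: the set `S` is maximal with the required properties. -/
def IsVisibilityExtension (C : Finset V) (S : Set (Arc V)) : Prop :=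
  Maximal (Γ.IsVisibilitySet C) S

/-- The left (`left = true`) or right (`left = false`) ears of `a` and `b`, where `γ(a) ≥ γ(b)`.
If `γ(a) > γ(b)`, a top ear `v` is left (right) if the edge `bv` passes to the left (right) of `a`,
and a bottom ear `v` is left (right) if the edge `va` passes to the left (right) of `b`.
If `γ(a) = γ(b)`, the top ears are the left ears and the bottom ears are the right ears. -/
def sideEars (C : Finset V) (left : Bool) (a b : V) : Set V :=
  {v | G.IsEarOf C a b v ∧
    ((G.level b < G.level a ∧
        ((G.level a < G.level v ∧
            if left then PassesLeftOf (Γ.curve b v) (Γ.pos a)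
            else PassesRightOf (Γ.curve b v) (Γ.pos a)) ∨
          (G.level v < G.level b ∧
            if left then PassesLeftOf (Γ.curve v a) (Γ.pos b)
            else PassesRightOf (Γ.curve v a) (Γ.pos b)))) ∨
      (G.level b = G.level a ∧
        if left then G.level a < G.level v else G.level v < G.level b))}

/-- Outermost ears: the highest one if they are top ears, the lowest one if they are bottom ears. -/
def IsOutermost (C : Finset V) (v : V) : Prop :=
  ∃ left a b, v ∈ Γ.sideEars C left a b ∧
    (G.level a < G.level v → ∀ w ∈ Γ.sideEars C left a b, G.level w ≤ G.level v) ∧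
    (G.level v < G.level b → ∀ w ∈ Γ.sideEars C left a b, G.level v ≤ G.level w)

/-- Innermost ears: the lowest one if they are top ears, the highest one if they are bottom ears. -/
def IsInnermost (C : Finset V) (v : V) : Prop :=
  ∃ left a b, v ∈ Γ.sideEars C left a b ∧
    (G.level a < G.level v → ∀ w ∈ Γ.sideEars C left a b, G.level v ≤ G.level w) ∧
    (G.level v < G.level b → ∀ w ∈ Γ.sideEars C left a b, G.level w ≤ G.level v)

/-- The drawn edges of the graph that are incident to a vertex of `U`. -/
def arcsAt (U : Set V) : Set (Arc V) := {A ∈ Γ.edgeArcs | ∃ v ∈ U, A.Incident v}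

/-- `v` and `w` are matching bounding ears of `a` and `b`: in the subdrawing formed by the edges at
the left (or right) ears of `a` and `b`, the 4-cycle through `v` and `w` bounds an interior face
(its interior contains no point of that subdrawing), and this face contains a vertex of `C`. -/
def MatchingBoundingEars (C : Finset V) (left : Bool) (a b v w : V) : Prop :=
  v ∈ Γ.sideEars C left a b ∧ w ∈ Γ.sideEars C left a b ∧ v ≠ w ∧
  (∀ A ∈ Γ.arcsAt (Γ.sideEars C left a b), ∀ p ∈ A.pts, ¬ Γ.Encloses (Γ.arcsAt {v, w}) p) ∧
  ∃ c ∈ C, Γ.Encloses (Γ.arcsAt {v, w}) (Γ.pos c)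

def IsBounding (C : Finset V) (v : V) : Prop :=
  ∃ left a b w, Γ.MatchingBoundingEars C left a b v w

/-- The crucial ears with respect to `C`. -/
def crucial (C : Finset V) : Set V :=
  {v | Γ.IsOutermost C v ∨ Γ.IsInnermost C v ∨ Γ.IsBounding C v}

/-- The core with respect to `C`. -/
def core (C : Finset V) : Set V := ↑C ∪ G.highDegree C ∪ Γ.crucial C

/-- The edges of the core-induced subdrawing, where `S` is the set of inserted visibility edges. -/
def coreArcs (C : Finset V) (S : Set (Arc V)) : Set (Arc V) :=
  {A ∈ Γ.edgeArcs ∪ S | A.src ∈ Γ.core C ∧ A.tgt ∈ Γ.core C}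

/-- Adjacency in the core-induced subdrawing (forgetting multiplicities and directions). -/
def coreGraph (C : Finset V) (S : Set (Arc V)) : SimpleGraph (Γ.core C) where
  Adj u v := u ≠ v ∧ ∃ A ∈ Γ.coreArcs C S,
    (A.src = u.1 ∧ A.tgt = v.1) ∨ (A.src = v.1 ∧ A.tgt = u.1)
  symm := ⟨fun _ _ ⟨h, A, hA, h'⟩ => ⟨h.symm, A, hA, h'.symm⟩⟩
  loopless := ⟨fun _ h => h.1 rfl⟩

end Drawing

/-- The drawing `Γ'` of `G'` together with the visibility edges `S` is a refined visibility extension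
of `Γ` with respect to `C`. The vertex set of `G'` is `V ⊕ N`, where `N` is the set of new vertices.
The induced subdrawing on `V` consists of `Γ` and `S` and is a visibility extension of `Γ`; the
whole drawing is crossing-free; all new vertices are ears, and they are exactly the crucial ears;
and their number is at most `K * |C|`. -/
structure IsRefinedVisibilityExtension {N : Type*} {G : LevelGraph V} (Γ : G.Drawing)
    (C : Finset V) (S : Set (Arc V)) {G' : LevelGraph (V ⊕ N)} (Γ' : G'.Drawing) (K : ℕ) :
    Prop where
  level_eq : ∀ v, G'.level (Sum.inl v) = G.level v
  adj_iff : ∀ u v, G'.Adj (Sum.inl u) (Sum.inl v) ↔ G.Adj u v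
  x_eq : ∀ v, Γ'.x (Sum.inl v) = Γ.x v
  curve_eq : ∀ u v, G.Adj u v → Γ'.curve (Sum.inl u) (Sum.inl v) = Γ.curve u v
  extension : Γ.IsVisibilityExtension C S
  levelPlanar : Γ'.IsLevelPlanar
  canInsert : ∀ A ∈ S, Γ'.CanInsert (A.map Sum.inl)
  vertexCover : G'.IsVertexCover (C.map Function.Embedding.inl)
  ear : ∀ n, G'.IsEar (C.map Function.Embedding.inl) (Sum.inr n)
  crucial_eq : Γ'.crucial (C.map Function.Embedding.inl) = Set.range Sum.inr
  card_le : Nat.card N ≤ K * C.card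

/-- The core-induced subdrawing is connected (unless the graph has no vertices at all) and has at
most `c * |C|` vertices and at most `c * |C|` edges; in particular there are at most `c * |C|`
outermost, at most `c * |C|` innermost and at most `c * |C|` bounding ears. -/
structure CoreIsSmallAndConnected {G : LevelGraph V} (Γ : G.Drawing) (C : Finset V)
    (S : Set (Arc V)) (c : ℕ) : Prop where
  connected : Nonempty V → (Γ.coreGraph C S).Connected
  vertices : (Γ.core C).ncard ≤ c * C.card
  edges_finite : (Γ.coreArcs C S).Finite
  edges : (Γ.coreArcs C S).ncard ≤ c * C.card
  outermost : {v | Γ.IsOutermost C v}.ncard ≤ c * C.card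
  innermost : {v | Γ.IsInnermost C v}.ncard ≤ c * C.card
  bounding : {v | Γ.IsBounding C v}.ncard ≤ c * C.card

end LevelGraph

/-! Two y-monotone curves of a crossing-free drawing keep their left-right order at all common
heights, by the intermediate value theorem. This order replaces faces and Euler's formula: every
count is an injective charging of curves to vertices.

Edges. A monotone arc of the core is the rightmost one into its upper end, or the rightmost one out
of its lower end, or some core vertex lies immediately to its right. Otherwise the gap between the
arc and the next arc into the same upper end contains no core vertex and no further arc, so the two
form an empty lens, which the condition on parallel edges forbids. Each of the three kinds has at
most as many arcs as there are core vertices (`ArcSystem.card_le_three_mul`). A horizontal segment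
is determined by its left end.

Vertices. Every core vertex outside `C` is the apex of a fork, that is, of two monotone legs to
distinct vertices of `C`, both going up or both going down; a reflection reduces to the first case.
Suppose that nested forks with the same ends always have a vertex of `C` between them. With at most
`2|C|` exceptions, the leg to the right of a fork's left leg at their common end is the left leg of
a higher fork, the left child; right children are symmetric. Both child maps are injective. A fork
that is a left and a right child has one and the same parent on both sides, with no vertex of `C` in
between, which is impossible. So the images are disjoint, and `n` forks satisfy `2(n - 2|C|) ≤ n`
(`ArcSystem.IsForkSystem.card_le`). For vertices of degree at least 3 the third edge supplies the
vertex of `C` in between. Outermost ears of one pair and side are never properly nested, and neither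
are innermost ones. For bounding ears the vertex lies in the face that they bound.

Connectivity. Every core vertex outside `C` has a neighbour in `C`, so it suffices to connect the
vertices of `C`. By maximality, two vertices of `C` that can be joined by a free curve are joined by
an edge already. If free curves climb from two vertices of `C` to a common point, the two are
connected in the core: pull the point down to the next vertex level, walk along that level, and use
induction (`Scene.IsSaturated.related_of_climb`). From a highest vertex of each component a curve
leads above the whole drawing, because any obstacle that it hits would attach a higher vertex to the
component (`Scene.IsSaturated.exists_climb`). All components thus climb to one common point.

For refined extensions maximality is known for the small drawing only, while the core is that of the
large one. The connectivity argument is therefore carried out in the small drawing for an arbitrary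
equivalence relation, to be instantiated by connectedness in either core. -/

/-! ### Left-right order of monotone arcs, and the count of arcs without empty lenses -/

/-- Points in the plane together with finitely many y-monotone curves between them, given as graphs
of functions of the height, that are pairwise crossing-free. -/
structure ArcSystem (V ι : Type*) where
  px : V → ℝ
  py : V → ℝ
  src : ι → V
  tgt : ι → V
  fn : ι → ℝ → ℝ
  inj : ∀ v w, px v = px w → py v = py w → v = w
  lt : ∀ i, py (src i) < py (tgt i)
  cont : ∀ i, Continuous (fn i)
  fn_src : ∀ i, fn i (py (src i)) = px (src i)
  fn_tgt : ∀ i, fn i (py (tgt i)) = px (tgt i)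
  avoid : ∀ i v, py (src i) ≤ py v → py v ≤ py (tgt i) → fn i (py v) = px v →
    v = src i ∨ v = tgt i
  cross : ∀ i j t, i ≠ j → py (src i) ≤ t → t ≤ py (tgt i) → py (src j) ≤ t → t ≤ py (tgt j) →
    fn i t = fn j t → ∃ v, (v = src i ∨ v = tgt i) ∧ (v = src j ∨ v = tgt j) ∧ py v = t

namespace ArcSystem

variable {V ι κ : Type*} (M : ArcSystem V ι)

/-- Reflection in the vertical axis. -/
def flipX : ArcSystem V ι where
  px v := -M.px v
  py := M.py
  src := M.src
  tgt := M.tgt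
  fn i t := -M.fn i t
  inj v w h h' := M.inj v w (neg_injective h) h'
  lt := M.lt
  cont i := (M.cont i).neg
  fn_src i := by rw [M.fn_src]
  fn_tgt i := by rw [M.fn_tgt]
  avoid i v h1 h2 h3 := M.avoid i v h1 h2 (neg_injective h3)
  cross i j t h h1 h2 h3 h4 h5 := M.cross i j t h h1 h2 h3 h4 (neg_injective h5)

/-- Reflection in the horizontal axis. -/
def flipY : ArcSystem V ι where
  px := M.px
  py v := -M.py v
  src := M.tgt
  tgt := M.src
  fn i t := M.fn i (-t)
  inj v w h h' := M.inj v w h (neg_injective h')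
  lt i := neg_lt_neg (M.lt i)
  cont i := (M.cont i).comp continuous_neg
  fn_src i := by simp only [neg_neg, M.fn_tgt]
  fn_tgt i := by simp only [neg_neg, M.fn_src]
  avoid i v h1 h2 h3 := by
    rw [neg_neg] at h3
    exact (M.avoid i v (by linarith) (by linarith) h3).symm
  cross i j t h h1 h2 h3 h4 h5 := by
    obtain ⟨v, hi, hj, hv⟩ := M.cross i j (-t) h (by linarith) (by linarith) (by linarith)
      (by linarith) h5
    exact ⟨v, hi.symm, hj.symm, by rw [hv, neg_neg]⟩

/-- The subsystem given by an injection into the index type. -/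
def comap (e : κ → ι) (he : Function.Injective e) : ArcSystem V κ where
  px := M.px
  py := M.py
  src i := M.src (e i)
  tgt i := M.tgt (e i)
  fn i := M.fn (e i)
  inj := M.inj
  lt _ := M.lt _
  cont _ := M.cont _
  fn_src _ := M.fn_src _
  fn_tgt _ := M.fn_tgt _
  avoid _ := M.avoid _
  cross _ _ t h := M.cross _ _ t (he.ne h)

variable {M}

theorem fn_ne_of_interior {i j : ι} {t : ℝ} (h : i ≠ j) (hi : M.py (M.src i) ≤ t)
    (hi' : t ≤ M.py (M.tgt i)) (hj : M.py (M.src j) ≤ t) (hj' : t ≤ M.py (M.tgt j))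
    (ho : (M.py (M.src i) < t ∧ t < M.py (M.tgt i)) ∨ (M.py (M.src j) < t ∧ t < M.py (M.tgt j))) :
    M.fn i t ≠ M.fn j t := by
  intro he
  obtain ⟨v, h1, h2, rfl⟩ := M.cross i j t h hi hi' hj hj' he
  rcases ho with ho | ho
  · rcases h1 with rfl | rfl <;> linarith
  · rcases h2 with rfl | rfl <;> linarith

theorem fn_ne_px {i : ι} {v : V} (hi : M.py (M.src i) ≤ M.py v) (hi' : M.py v ≤ M.py (M.tgt i))
    (h1 : v ≠ M.src i) (h2 : v ≠ M.tgt i) : M.fn i (M.py v) ≠ M.px v :=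
  fun h => (M.avoid i v hi hi' h).elim h1 h2

/-- A change of order forces a meeting point by the intermediate value theorem. Since `t'` is
interior to one of the arcs, every meeting point after `t` is interior to it too, so it is not a
common endpoint. -/
theorem fn_lt_of_fn_lt {i j : ι} {t t' : ℝ} (h : M.fn i t < M.fn j t)
    (hi : M.py (M.src i) ≤ t) (hi' : t ≤ M.py (M.tgt i))
    (hj : M.py (M.src j) ≤ t) (hj' : t ≤ M.py (M.tgt j))
    (ki : M.py (M.src i) ≤ t') (ki' : t' ≤ M.py (M.tgt i))
    (kj : M.py (M.src j) ≤ t') (kj' : t' ≤ M.py (M.tgt j))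
    (ho : (M.py (M.src i) < t' ∧ t' < M.py (M.tgt i)) ∨
      (M.py (M.src j) < t' ∧ t' < M.py (M.tgt j))) :
    M.fn i t' < M.fn j t' := by
  have hij : i ≠ j := by rintro rfl; exact lt_irrefl _ h
  by_contra hc
  push Not at hc
  have hcont : ContinuousOn (fun s => M.fn j s - M.fn i s) (Set.uIcc t t') :=
    ((M.cont j).sub (M.cont i)).continuousOn
  obtain ⟨s, hs, hs0⟩ := intermediate_value_uIcc hcont
    (Set.mem_uIcc.2 (Or.inr ⟨by linarith, by linarith⟩) :
      (0 : ℝ) ∈ Set.uIcc (M.fn j t - M.fn i t) (M.fn j t' - M.fn i t'))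
  have hst : s ≠ t := by rintro rfl; simp only at hs0; linarith
  have he : M.fn i s = M.fn j s := by simp only at hs0; linarith
  rcases Set.mem_uIcc.1 hs with ⟨h1, h2⟩ | ⟨h1, h2⟩
  · have h1' := lt_of_le_of_ne h1 hst.symm
    refine fn_ne_of_interior hij (by linarith) (by linarith) (by linarith) (by linarith) ?_ he
    exact ho.imp (fun h => ⟨by linarith, by linarith⟩) (fun h => ⟨by linarith, by linarith⟩)
  · have h2' := lt_of_le_of_ne h2 hst
    refine fn_ne_of_interior hij (by linarith) (by linarith) (by linarith) (by linarith) ?_ he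
    exact ho.imp (fun h => ⟨by linarith, by linarith⟩) (fun h => ⟨by linarith, by linarith⟩)

theorem fn_le_of_fn_lt {i j : ι} {t t' : ℝ} (h : M.fn i t < M.fn j t)
    (hi : M.py (M.src i) ≤ t) (hi' : t ≤ M.py (M.tgt i))
    (hj : M.py (M.src j) ≤ t) (hj' : t ≤ M.py (M.tgt j))
    (ki : M.py (M.src i) ≤ t') (ki' : t' ≤ M.py (M.tgt i))
    (kj : M.py (M.src j) ≤ t') (kj' : t' ≤ M.py (M.tgt j)) :
    M.fn i t' ≤ M.fn j t' := by
  have hij : i ≠ j := by rintro rfl; exact lt_irrefl _ h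
  by_contra hc
  push Not at hc
  have hcont : ContinuousOn (fun s => M.fn j s - M.fn i s) (Set.uIcc t t') :=
    ((M.cont j).sub (M.cont i)).continuousOn
  obtain ⟨s, hs, hs0⟩ := intermediate_value_uIcc hcont
    (Set.mem_uIcc.2 (Or.inr ⟨by linarith, by linarith⟩) :
      (0 : ℝ) ∈ Set.uIcc (M.fn j t - M.fn i t) (M.fn j t' - M.fn i t'))
  have hst : s ≠ t := by rintro rfl; simp only at hs0; linarith
  have hst' : s ≠ t' := by rintro rfl; simp only at hs0; linarith
  have he : M.fn i s = M.fn j s := by simp only at hs0; linarith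
  rcases Set.mem_uIcc.1 hs with ⟨h1, h2⟩ | ⟨h1, h2⟩
  · have h1' := lt_of_le_of_ne h1 hst.symm
    have h2' := lt_of_le_of_ne h2 hst'
    exact fn_ne_of_interior hij (by linarith) (by linarith) (by linarith) (by linarith)
      (Or.inl ⟨by linarith, by linarith⟩) he
  · have h2' := lt_of_le_of_ne h2 hst
    have h1' := lt_of_le_of_ne h1 hst'.symm
    exact fn_ne_of_interior hij (by linarith) (by linarith) (by linarith) (by linarith)
      (Or.inl ⟨by linarith, by linarith⟩) he

variable (M)

/-- `j` runs to the right of `i` at some common height. -/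
def RightOf (i j : ι) : Prop :=
  ∃ t, M.py (M.src i) ≤ t ∧ t ≤ M.py (M.tgt i) ∧ M.py (M.src j) ≤ t ∧ t ≤ M.py (M.tgt j) ∧
    M.fn i t < M.fn j t

/-- `i` is the rightmost of the arcs that enter its target. -/
def LastIn (i : ι) : Prop := ∀ j, M.tgt j = M.tgt i → ¬ M.RightOf i j

/-- `i` is the rightmost of the arcs that leave its source. -/
def LastOut (i : ι) : Prop := ∀ j, M.src j = M.src i → ¬ M.RightOf i j

/-- `j` is the next arc to the right of `i` that enters the target of `i`. -/
def NextIn (i j : ι) : Prop :=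
  M.tgt j = M.tgt i ∧ M.RightOf i j ∧ ∀ s, M.tgt s = M.tgt i → M.RightOf i s → ¬ M.RightOf s j

/-- `c` lies to the right of `i`, with no other arc in between at its height. -/
def Sees (T : Set V) (c : V) (i : ι) : Prop :=
  c ∈ T ∧ M.py (M.src i) < M.py c ∧ M.py c < M.py (M.tgt i) ∧ M.fn i (M.py c) < M.px c ∧
    ∀ s, M.py (M.src s) ≤ M.py c → M.py c ≤ M.py (M.tgt s) →
      M.fn i (M.py c) < M.fn s (M.py c) → M.px c ≤ M.fn s (M.py c)

variable {M}

theorem RightOf.fn_lt {i j : ι} (h : M.RightOf i j) {t : ℝ}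
    (ki : M.py (M.src i) ≤ t) (ki' : t ≤ M.py (M.tgt i))
    (kj : M.py (M.src j) ≤ t) (kj' : t ≤ M.py (M.tgt j))
    (ho : (M.py (M.src i) < t ∧ t < M.py (M.tgt i)) ∨ (M.py (M.src j) < t ∧ t < M.py (M.tgt j))) :
    M.fn i t < M.fn j t := by
  obtain ⟨s, h1, h2, h3, h4, h5⟩ := h
  exact fn_lt_of_fn_lt h5 h1 h2 h3 h4 ki ki' kj kj' ho

theorem RightOf.fn_le {i j : ι} (h : M.RightOf i j) {t : ℝ}
    (ki : M.py (M.src i) ≤ t) (ki' : t ≤ M.py (M.tgt i))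
    (kj : M.py (M.src j) ≤ t) (kj' : t ≤ M.py (M.tgt j)) :
    M.fn i t ≤ M.fn j t := by
  obtain ⟨s, h1, h2, h3, h4, h5⟩ := h
  exact fn_le_of_fn_lt h5 h1 h2 h3 h4 ki ki' kj kj'

/-- Every arc that ends at height `y` contains the height `t` in its interior, so all arcs into one
point can be compared at this single height. -/
theorem exists_between_height [Finite V] (M : ArcSystem V ι) (y : ℝ) :
    ∃ t, t < y ∧ ∀ v, M.py v < y → M.py v < t := by
  have hf : (M.py '' {v | M.py v < y} ∪ {y - 1}).Finite := (Set.toFinite _).union (Set.toFinite _)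
  obtain ⟨m, hm, hmax⟩ := hf.exists_maximal (Set.Nonempty.inr (Set.singleton_nonempty _))
  have hmy : m < y := by
    rcases hm with ⟨v, hv, rfl⟩ | hm
    · exact hv
    · rw [Set.mem_singleton_iff.1 hm]; linarith
  refine ⟨(m + y) / 2, by linarith, fun v hv => ?_⟩
  have : M.py v ≤ m := by
    by_contra hc
    push Not at hc
    exact absurd (hmax (Or.inl ⟨v, hv, rfl⟩) hc.le) (not_le.2 hc)
  linarith

theorem rightOf_or_of_tgt_eq [Finite V] {i j : ι} (h : i ≠ j) (ht : M.tgt i = M.tgt j) :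
    M.RightOf i j ∨ M.RightOf j i := by
  obtain ⟨t, h1, h2⟩ := M.exists_between_height (M.py (M.tgt i))
  have hi := h2 _ (M.lt i)
  have hj := h2 (M.src j) (by rw [ht]; exact M.lt j)
  have hj' : t < M.py (M.tgt j) := ht ▸ h1
  rcases lt_trichotomy (M.fn i t) (M.fn j t) with h3 | h3 | h3
  · exact Or.inl ⟨t, hi.le, h1.le, hj.le, hj'.le, h3⟩
  · exact absurd h3 (fn_ne_of_interior h hi.le h1.le hj.le hj'.le (Or.inl ⟨hi, h1⟩))
  · exact Or.inr ⟨t, hj.le, hj'.le, hi.le, h1.le, h3⟩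

theorem LastIn.eq [Finite V] {i j : ι} (hi : M.LastIn i) (hj : M.LastIn j)
    (h : M.tgt i = M.tgt j) : i = j := by
  by_contra hne
  rcases rightOf_or_of_tgt_eq hne h with h' | h'
  · exact hi j h.symm h'
  · exact hj i h h'

theorem LastOut.flipY {i : ι} (hi : M.LastOut i) : M.flipY.LastIn i := by
  rintro j hj ⟨t, h1, h2, h3, h4, h5⟩
  simp only [ArcSystem.flipY] at *
  exact hi j hj ⟨-t, by linarith, by linarith, by linarith, by linarith, h5⟩

theorem LastOut.eq [Finite V] {i j : ι} (hi : M.LastOut i) (hj : M.LastOut j)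
    (h : M.src i = M.src j) : i = j :=
  LastIn.eq hi.flipY hj.flipY h

theorem exists_nextIn [Finite V] [Finite ι] {i : ι} (hi : ¬ M.LastIn i) : ∃ j, M.NextIn i j := by
  obtain ⟨t, h1, h2⟩ := M.exists_between_height (M.py (M.tgt i))
  have key : ∀ j, M.tgt j = M.tgt i → M.py (M.src j) < t ∧ t < M.py (M.tgt j) := fun j hj =>
    ⟨h2 _ (by rw [← hj]; exact M.lt j), by rw [hj]; exact h1⟩
  have hne : {j | M.tgt j = M.tgt i ∧ M.RightOf i j}.Nonempty := by
    by_contra hc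
    exact hi fun j hj hr => hc ⟨j, hj, hr⟩
  obtain ⟨j, ⟨hj, hr⟩, hmin⟩ := Set.exists_min_image _ (fun j => M.fn j t) (Set.toFinite _) hne
  refine ⟨j, hj, hr, fun s hs hrs hc => ?_⟩
  have h3 := hc.fn_lt (key s hs).1.le (key s hs).2.le (key j hj).1.le (key j hj).2.le
    (Or.inl (key s hs))
  exact absurd (hmin s ⟨hs, hrs⟩) (not_le.2 h3)

theorem NextIn.eq_left [Finite V] {i i' j : ι} (h : M.NextIn i j) (h' : M.NextIn i' j) :
    i = i' := by
  by_contra hne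
  have ht : M.tgt i = M.tgt i' := h.1.symm.trans h'.1
  rcases rightOf_or_of_tgt_eq hne ht with h1 | h1
  · exact h.2.2 i' ht.symm h1 h'.2.1
  · exact h'.2.2 i ht h1 h.2.1

theorem Sees.eq {T : Set V} {c : V} {i i' : ι} (h : M.Sees T c i) (h' : M.Sees T c i') :
    i = i' := by
  obtain ⟨-, h1, h2, h3, h4⟩ := h
  obtain ⟨-, h1', h2', h3', h4'⟩ := h'
  by_contra hne
  rcases lt_trichotomy (M.fn i (M.py c)) (M.fn i' (M.py c)) with h5 | h5 | h5
  · have := h4 i' h1'.le h2'.le h5; linarith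
  · exact fn_ne_of_interior hne h1.le h2.le h1'.le h2'.le (Or.inl ⟨h1, h2⟩) h5
  · have := h4' i h1.le h2.le h5; linarith

/-- An arc between `i` and the next arc `j` ends between them. -/
theorem NextIn.tgt_between {i j s : ι} (h : M.NextIn i j) {t : ℝ}
    (hi : M.py (M.src i) ≤ t) (hj : M.py (M.src j) ≤ t) (ht : t < M.py (M.tgt i))
    (hs : M.py (M.src s) ≤ t) (hs' : t ≤ M.py (M.tgt s))
    (h1 : M.fn i t < M.fn s t) (h2 : M.fn s t < M.fn j t) :
    M.py (M.tgt s) < M.py (M.tgt i) ∧ M.fn i (M.py (M.tgt s)) < M.px (M.tgt s) ∧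
      M.px (M.tgt s) < M.fn j (M.py (M.tgt s)) := by
  obtain ⟨hT, hR, hN⟩ := h
  have hij : M.RightOf i s := ⟨t, hi, ht.le, hs, hs', h1⟩
  have hsj : M.RightOf s j := ⟨t, hs, hs', hj, by rw [hT]; exact ht.le, h2⟩
  -- If `s` reached the height of the common end, it would be squeezed into that end and be an arc
  -- into it between `i` and the next one.
  have hlt : M.py (M.tgt s) < M.py (M.tgt i) := by
    by_contra hc
    push Not at hc
    have e1 := hij.fn_le (t := M.py (M.tgt i)) (M.lt i).le le_rfl (by linarith) hc
    have e2 := hsj.fn_le (t := M.py (M.tgt i)) (by linarith) hc (by linarith) (by rw [hT])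
    rw [M.fn_tgt] at e1
    rw [← hT, M.fn_tgt, hT] at e2
    have := M.avoid s (M.tgt i) (by linarith) hc (le_antisymm e2 e1)
    rcases this with h3 | h3
    · rw [h3] at ht; linarith
    · exact hN s h3.symm hij hsj
  refine ⟨hlt, ?_, ?_⟩
  · rcases eq_or_lt_of_le hs' with h3 | h3
    · rw [← M.fn_tgt s, ← h3]; exact h1
    · rw [← M.fn_tgt s]
      exact hij.fn_lt (by linarith) (by linarith) (by linarith) le_rfl
        (Or.inl ⟨by linarith, by linarith⟩)
  · rcases eq_or_lt_of_le hs' with h3 | h3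
    · rw [← M.fn_tgt s, ← h3]; exact h2
    · rw [← M.fn_tgt s]
      exact hsj.fn_lt (by linarith) le_rfl (by linarith) (by rw [hT]; linarith)
        (Or.inr ⟨by linarith, by rw [hT]; linarith⟩)

/-- A finite nonempty set of points contains a leftmost one among the highest ones. -/
theorem exists_highest_leftmost [Finite V] (M : ArcSystem V ι) {Z : Set V} (hZ : Z.Nonempty) :
    ∃ c ∈ Z, ∀ d ∈ Z, M.py d ≤ M.py c ∧ (M.py d = M.py c → M.px c ≤ M.px d) := by
  obtain ⟨c₀, hc₀, hmax⟩ := Set.exists_max_image Z M.py (Set.toFinite _) hZ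
  obtain ⟨c, ⟨hc, hc'⟩, hmin⟩ := Set.exists_min_image {c ∈ Z | M.py c = M.py c₀} M.px
    (Set.toFinite _) ⟨c₀, hc₀, rfl⟩
  exact ⟨c, hc, fun d hd => ⟨hc' ▸ hmax d hd, fun h => hmin d ⟨hd, h.trans hc'⟩⟩⟩

/-- Take a highest and then leftmost point of `T` in the gap. It does not see `i`, so an arc runs in
between. By `tgt_between` that arc ends in the gap, higher up or at the same height further left,
contradicting the choice. -/
theorem NextIn.gap [Finite V] {T : Set V} (hT : ∀ i, M.tgt i ∈ T) {i j : ι} (h : M.NextIn i j)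
    (hS : ∀ c, ¬ M.Sees T c i) {c : V} (hc : c ∈ T) (h1 : M.py (M.src i) < M.py c)
    (h2 : M.py (M.src j) ≤ M.py c) (h3 : M.py c < M.py (M.tgt i))
    (h4 : M.fn i (M.py c) < M.px c) : M.fn j (M.py c) < M.px c := by
  by_contra h5
  push Not at h5
  obtain ⟨c, ⟨hc, h1, h2, h3, h4, h5⟩, hmax⟩ := M.exists_highest_leftmost
    (Z := {c | c ∈ T ∧ M.py (M.src i) < M.py c ∧ M.py (M.src j) ≤ M.py c ∧
      M.py c < M.py (M.tgt i) ∧ M.fn i (M.py c) < M.px c ∧ M.px c ≤ M.fn j (M.py c)})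
    ⟨c, hc, h1, h2, h3, h4, h5⟩
  refine hS c ⟨hc, h1, h3, h4, fun s hs hs' h6 => ?_⟩
  by_contra h7
  push Not at h7
  obtain ⟨k1, k2, k3⟩ := h.tgt_between h1.le h2 h3 hs hs' h6 (by linarith)
  obtain ⟨k4, k5⟩ := hmax (M.tgt s) ⟨hT s, by linarith, by linarith, k1, k2, k3.le⟩
  have he := le_antisymm k4 hs'
  have := k5 he
  rw [← M.fn_tgt s, he] at this
  linarith

/-- The upper end of such an arc would be a point of `T` in the gap. -/
theorem NextIn.no_arc_between [Finite V] {T : Set V} (hT : ∀ i, M.tgt i ∈ T) {i j s : ι}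
    (h : M.NextIn i j) (hS : ∀ c, ¬ M.Sees T c i) {t : ℝ}
    (hi : M.py (M.src i) < t) (hj : M.py (M.src j) ≤ t) (ht : t < M.py (M.tgt i))
    (hs : M.py (M.src s) ≤ t) (hs' : t ≤ M.py (M.tgt s))
    (h1 : M.fn i t < M.fn s t) : M.fn j t ≤ M.fn s t := by
  by_contra h2
  push Not at h2
  obtain ⟨k1, k2, k3⟩ := h.tgt_between hi.le hj ht hs hs' h1 h2
  have := h.gap hT hS (hT s) (by linarith) (by linarith) k1 k2
  linarith

/-- By `Sees.eq` a point sees at most one arc. -/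
theorem ncard_seen_le [Finite V] (M : ArcSystem V ι) (T : Set V) :
    {i | ∃ c, M.Sees T c i}.ncard ≤ T.ncard := by
  rcases isEmpty_or_nonempty V with hV | hV
  · have : {i | ∃ c, M.Sees T c i} = ∅ := Set.eq_empty_of_forall_notMem fun i ⟨c, _⟩ => hV.elim c
    rw [this, Set.ncard_empty]
    exact Nat.zero_le _
  choose! f hf using fun i (hi : i ∈ {i | ∃ c, M.Sees T c i}) => hi
  exact Set.ncard_le_ncard_of_injOn f (fun i hi => (hf i hi).1)
    (fun i hi j hj h => (hf i hi).eq (h ▸ hf j hj)) (Set.toFinite _)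

/-- Finitely many arcs between points of `T`, no two of which bound an empty lens, are at most
three times as many as the points of `T`. -/
theorem card_le_three_mul [Finite V] [Finite ι] {T : Set V} (hs : ∀ i, M.src i ∈ T)
    (hT : ∀ i, M.tgt i ∈ T)
    (hlens : ∀ i j, M.src i = M.src j → M.tgt i = M.tgt j → M.RightOf i j →
      ∃ c ∈ T, M.py (M.src i) < M.py c ∧ M.py c < M.py (M.tgt i) ∧
        M.fn i (M.py c) < M.px c ∧ M.px c < M.fn j (M.py c)) :
    Nat.card ι ≤ 3 * T.ncard := by
  have hcover : (Set.univ : Set ι) ⊆ {i | M.LastIn i} ∪ {i | M.LastOut i} ∪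
      {i | ∃ c, M.Sees T c i} := by
    intro i _
    by_contra hc
    simp only [Set.mem_union, Set.mem_ofPred_eq, not_or, not_exists] at hc
    obtain ⟨⟨hin, hout⟩, hsee⟩ := hc
    obtain ⟨j, hj⟩ := exists_nextIn hin
    have hjt : M.py (M.tgt j) = M.py (M.tgt i) := by rw [hj.1]
    -- If `j` started above the start of `i`, that start would be a point of `T` in the gap.
    have hsj : M.py (M.src j) ≤ M.py (M.src i) := by
      by_contra hc
      push Not at hc
      have hlt := M.lt j
      have e := hj.gap hT hsee (hs j) hc le_rfl (by linarith)
        (by rw [← M.fn_src j]; exact hj.2.1.fn_lt hc.le (by linarith) le_rfl hlt.le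
              (Or.inl ⟨hc, by linarith⟩))
      rw [M.fn_src] at e
      exact lt_irrefl _ e
    have hlti := M.lt i
    have hle := hj.2.1.fn_le le_rfl hlti.le hsj (by linarith)
    -- Either `i` starts on `j`, so that both have the same ends and the point in their lens
    -- contradicts `gap`, or the gap is open at the bottom and another arc `s` out of the start of
    -- `i` enters it.
    rcases eq_or_lt_of_le hle with he | hlt
    · rw [M.fn_src] at he
      have : M.src i = M.src j := by
        rcases M.avoid j (M.src i) hsj (by linarith) he.symm with h | h
        · exact h
        · rw [h] at hlti; linarith
      obtain ⟨c, hc, h1, h2, h3, h4⟩ := hlens i j this hj.1.symm hj.2.1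
      have := hj.gap hT hsee hc h1 (by linarith) h2 h3
      linarith
    · have : ∃ s, M.src s = M.src i ∧ M.RightOf i s := by
        by_contra hc
        exact hout fun s h1 h2 => hc ⟨s, h1, h2⟩
      obtain ⟨s, hsi, hr⟩ := this
      have hls := M.lt s
      rw [hsi] at hls
      have hrs : M.RightOf s j := ⟨M.py (M.src i), by rw [hsi], hls.le, hsj, by linarith, by
        rw [← hsi, M.fn_src, hsi, ← M.fn_src i]; exact hlt⟩
      -- A height in the interior of both `s` and `i`, where `s` is strictly between `i` and `j`.
      set t := (M.py (M.src i) + min (M.py (M.tgt s)) (M.py (M.tgt i))) / 2 with ht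
      have hm1 := min_le_left (M.py (M.tgt s)) (M.py (M.tgt i))
      have hm2 := min_le_right (M.py (M.tgt s)) (M.py (M.tgt i))
      have hm3 := lt_min hls hlti
      have e1 := hr.fn_lt (t := t) (by linarith) (by linarith) (by rw [hsi]; linarith)
        (by linarith) (Or.inl ⟨by linarith, by linarith⟩)
      have e2 := hrs.fn_lt (t := t) (by rw [hsi]; linarith) (by linarith) (by linarith)
        (by linarith) (Or.inr ⟨by linarith, by linarith⟩)
      have := hj.no_arc_between hT hsee (s := s) (t := t) (by linarith) (by linarith)
        (by linarith) (by rw [hsi]; linarith) (by linarith) e1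
      linarith
  have c1 : {i | M.LastIn i}.ncard ≤ T.ncard :=
    Set.ncard_le_ncard_of_injOn M.tgt (fun i _ => hT i) (fun i hi j hj h => LastIn.eq hi hj h)
      (Set.toFinite _)
  have c2 : {i | M.LastOut i}.ncard ≤ T.ncard :=
    Set.ncard_le_ncard_of_injOn M.src (fun i _ => hs i) (fun i hi j hj h => LastOut.eq hi hj h)
      (Set.toFinite _)
  have c3 := ncard_seen_le M T
  have := Set.ncard_le_ncard hcover (Set.toFinite _)
  rw [Set.ncard_univ] at this
  have e1 := Set.ncard_union_le ({i | M.LastIn i} ∪ {i | M.LastOut i}) {i | ∃ c, M.Sees T c i}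
  have e2 := Set.ncard_union_le {i | M.LastIn i} {i | M.LastOut i}
  omega

end ArcSystem

/-! ### Counting forks by left and right children -/

namespace ArcSystem

variable {V ι κ H : Type*} {M : ArcSystem V ι}

/-- The extremal choice of `NextIn.gap` again, with a clear stretch at height `y` in place of a
common end as the upper boundary. An arc that blocks the view to the highest leftmost point ends in
the region or crosses the clear stretch. -/
theorem region_empty [Finite V] {T : Set V} (hT : ∀ i, M.tgt i ∈ T) {i r : ι} {y : ℝ}
    (hi : M.py (M.src i) < y) (hi' : y < M.py (M.tgt i))
    (hr : M.py (M.src r) < y) (hr' : y < M.py (M.tgt r))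
    (hclear : ∀ s, M.py (M.src s) < y → y ≤ M.py (M.tgt s) → M.fn i y < M.fn s y →
      ¬ M.fn s y < M.fn r y)
    (hS : ∀ c, ¬ M.Sees T c i) {c : V} (hc : c ∈ T) (h1 : M.py (M.src i) < M.py c)
    (h2 : M.py (M.src r) < M.py c) (h3 : M.py c < y) (h4 : M.fn i (M.py c) < M.px c) :
    M.fn r (M.py c) ≤ M.px c := by
  by_contra h5
  push Not at h5
  obtain ⟨c, ⟨hc, h1, h2, h3, h4, h5⟩, hmax⟩ := M.exists_highest_leftmost
    (Z := {c | c ∈ T ∧ M.py (M.src i) < M.py c ∧ M.py (M.src r) < M.py c ∧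
      M.py c < y ∧ M.fn i (M.py c) < M.px c ∧ M.px c < M.fn r (M.py c)})
    ⟨c, hc, h1, h2, h3, h4, h5⟩
  refine hS c ⟨hc, h1, by linarith, h4, fun s hs hs' h6 => ?_⟩
  by_contra h7
  push Not at h7
  have his : M.RightOf i s := ⟨M.py c, h1.le, by linarith, hs, hs', h6⟩
  have hsr : M.RightOf s r := ⟨M.py c, hs, hs', h2.le, by linarith, by linarith⟩
  rcases lt_or_ge (M.py (M.tgt s)) y with h8 | h8
  · have e1 := his.fn_lt (t := M.py (M.tgt s)) (by linarith) (by linarith) (by linarith) le_rfl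
      (Or.inl ⟨by linarith, by linarith⟩)
    have e2 := hsr.fn_lt (t := M.py (M.tgt s)) (by linarith) le_rfl (by linarith) (by linarith)
      (Or.inr ⟨by linarith, by linarith⟩)
    rw [M.fn_tgt] at e1 e2
    obtain ⟨k4, k5⟩ := hmax (M.tgt s) ⟨hT s, by linarith, by linarith, h8, e1, e2⟩
    have he := le_antisymm k4 hs'
    have := k5 he
    rw [← M.fn_tgt s, he] at this
    linarith
  · exact hclear s (by linarith) h8
      (his.fn_lt hi.le hi'.le (by linarith) h8 (Or.inl ⟨hi, hi'⟩))
      (hsr.fn_lt (by linarith) h8 hr.le hr'.le (Or.inr ⟨hr, hr'⟩))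

/-- `c` lies between the outer fork with legs `l'`, `r'` and the inner fork with legs `l`, `r`. -/
def InLens (M : ArcSystem V ι) (l' r' l r : ι) (c : V) : Prop :=
  M.py (M.src l') < M.py c ∧
    ((M.py c < M.py (M.src l) ∧ M.fn l' (M.py c) < M.px c ∧ M.px c < M.fn r' (M.py c)) ∨
     (M.py (M.src l) ≤ M.py c ∧ M.py c < M.py (M.tgt l) ∧ M.fn l' (M.py c) < M.px c ∧
        M.px c < M.fn l (M.py c)) ∨
     (M.py (M.src l) ≤ M.py c ∧ M.py c < M.py (M.tgt r) ∧ M.fn r (M.py c) < M.px c ∧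
        M.px c < M.fn r' (M.py c)))

/-- The arcs are the left legs `(h, false)` and the right legs `(h, true)` of forks that start at
points `σ h` outside `C` and end at two distinct points of `C`. -/
structure IsForkSystem (M : ArcSystem V (H × Bool)) (σ : H → V) (C : Set V) : Prop where
  src_eq : ∀ h b, M.src (h, b) = σ h
  inj : Function.Injective σ
  notMem : ∀ h, σ h ∉ C
  tgt_mem : ∀ i, M.tgt i ∈ C
  tgt_ne : ∀ h, M.tgt (h, false) ≠ M.tgt (h, true)
  left_lt : ∀ h t, M.py (σ h) < t → t ≤ M.py (M.tgt (h, false)) → t ≤ M.py (M.tgt (h, true)) →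
    M.fn (h, false) t < M.fn (h, true) t

/-- Reflection of a system of forks in the vertical axis. -/
def flipFork (M : ArcSystem V (H × Bool)) : ArcSystem V (H × Bool) :=
  M.flipX.comap (fun i => (i.1, !i.2)) (by
    rintro ⟨a, b⟩ ⟨c, d⟩ h
    simp only [Prod.mk.injEq, Bool.not_inj_iff] at h
    exact Prod.ext h.1 h.2)

namespace IsForkSystem

variable {M : ArcSystem V (H × Bool)} {σ : H → V} {C : Set V}

theorem flip (F : M.IsForkSystem σ C) : M.flipFork.IsForkSystem σ C where
  src_eq h _ := F.src_eq h _
  inj := F.inj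
  notMem := F.notMem
  tgt_mem _ := F.tgt_mem _
  tgt_ne h := (F.tgt_ne h).symm
  left_lt h t h1 h2 h3 := neg_lt_neg (F.left_lt h t h1 h3 h2)

/-- Unless the left leg of `h'` is the last one into its target or is seen from the right by a
point of `C`, the next leg into its target is the left leg of a higher fork. -/
theorem exists_child [Finite V] [Finite H] (F : M.IsForkSystem σ C) {h' : H}
    (hl : ¬ M.LastIn (h', false)) (hS : ∀ c, ¬ M.Sees C c (h', false)) :
    ∃ h, M.NextIn (h', false) (h, false) ∧ M.py (σ h') < M.py (σ h) := by
  obtain ⟨⟨h, b⟩, hj⟩ := exists_nextIn hl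
  have hjt : M.py (M.tgt (h, b)) = M.py (M.tgt (h', false)) := by rw [hj.1]
  have hlt : ∀ h b, M.py (σ h) < M.py (M.tgt (h, b)) := fun h b => F.src_eq h b ▸ M.lt (h, b)
  have l1 := hlt h' false
  have l2 := hlt h b
  have l3 := hlt h' true
  -- a leg that starts between the two arcs leads to a contradiction
  have key : ∀ s, M.tgt s ≠ M.tgt (h', false) → M.RightOf (h', false) s → M.RightOf s (h, b) →
      M.py (M.src s) < M.py (M.tgt (h', false)) → M.py (σ h') ≤ M.py (M.src s) →
      M.py (σ h) ≤ M.py (M.src s) → False := by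
    intro s hst hr1 hr2 h1 h2 h3
    have hs := M.lt s
    set t := (M.py (M.src s) + min (M.py (M.tgt s)) (M.py (M.tgt (h', false)))) / 2 with ht
    have hm1 := min_le_left (M.py (M.tgt s)) (M.py (M.tgt (h', false)))
    have hm2 := min_le_right (M.py (M.tgt s)) (M.py (M.tgt (h', false)))
    have hm3 := lt_min hs h1
    have e1 := hr1.fn_lt (t := t) (by rw [F.src_eq]; linarith) (by linarith) (by linarith)
      (by linarith) (Or.inr ⟨by linarith, by linarith⟩)
    have e2 := hr2.fn_lt (t := t) (by linarith) (by linarith) (by rw [F.src_eq]; linarith)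
      (by linarith) (Or.inl ⟨by linarith, by linarith⟩)
    have := hj.no_arc_between F.tgt_mem hS (s := s) (t := t) (by rw [F.src_eq]; linarith)
      (by rw [F.src_eq]; linarith) (by linarith) (by linarith) (by linarith) e1
    linarith
  -- If `h` did not start higher, the right leg of `h'` would start into the gap, or both forks
  -- would be the same and send two legs to one end.
  have hlow : M.py (σ h') < M.py (σ h) := by
    by_contra hc
    push Not at hc
    have hle := hj.2.1.fn_le (t := M.py (σ h')) (by rw [F.src_eq]) l1.le
      (by rw [F.src_eq]; exact hc) (by linarith)
    have e0 : ∀ b, M.fn (h', b) (M.py (σ h')) = M.px (σ h') := fun b => by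
      have := M.fn_src (h', b); rwa [F.src_eq] at this
    rcases eq_or_lt_of_le hle with he | hlt'
    · rw [e0] at he
      rcases M.avoid (h, b) (σ h') (by rw [F.src_eq]; exact hc) (by linarith) he.symm with h1 | h1
      · rw [F.src_eq] at h1
        obtain rfl := F.inj h1
        cases b
        · obtain ⟨t, -, -, -, -, ht⟩ := hj.2.1
          exact lt_irrefl _ ht
        · exact F.tgt_ne h' hj.1.symm
      · exact F.notMem h' (h1 ▸ F.tgt_mem _)
    · rw [e0 false, ← e0 true] at hlt'
      have hm := lt_min l1 l3
      refine key (h', true) (F.tgt_ne h').symm ⟨min (M.py (M.tgt (h', false)))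
        (M.py (M.tgt (h', true))), ?_, min_le_left _ _, ?_, min_le_right _ _,
        F.left_lt h' _ hm (min_le_left _ _) (min_le_right _ _)⟩
        ⟨M.py (σ h'), by rw [F.src_eq], l3.le, by rw [F.src_eq]; exact hc, by linarith, hlt'⟩
        (by rw [F.src_eq]; exact l1) (by rw [F.src_eq]) (by rw [F.src_eq]; exact hc)
      all_goals rw [F.src_eq]; exact hm.le
  cases b
  · exact ⟨h, hj, hlow⟩
  -- If the next leg were a right leg, the left leg of its fork would start into the gap.
  · exfalso
    have l4 := hlt h false
    have e0 : ∀ b, M.fn (h, b) (M.py (σ h)) = M.px (σ h) := fun b => by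
      have := M.fn_src (h, b); rwa [F.src_eq] at this
    have e1 := hj.2.1.fn_lt (t := M.py (σ h)) (by rw [F.src_eq]; exact hlow.le) (by linarith)
      (by rw [F.src_eq]) l2.le (Or.inl ⟨by rw [F.src_eq]; exact hlow, by linarith⟩)
    rw [e0 true, ← e0 false] at e1
    have hm := lt_min l2 l4
    refine key (h, false) (fun e => F.tgt_ne h (e.trans hj.1.symm))
      ⟨M.py (σ h), by rw [F.src_eq]; exact hlow.le, by linarith, by rw [F.src_eq], l4.le, e1⟩
      ⟨min (M.py (M.tgt (h, true))) (M.py (M.tgt (h, false))), ?_, min_le_right _ _, ?_,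
        min_le_left _ _, F.left_lt h _ hm (min_le_right _ _) (min_le_left _ _)⟩
      (by rw [F.src_eq]; linarith) (by rw [F.src_eq]; exact hlow.le) (by rw [F.src_eq])
    all_goals rw [F.src_eq]; exact hm.le

/-- The left leg of `h'` and its left child `h`. -/
structure Child (M : ArcSystem V (H × Bool)) (σ : H → V) (C : Set V) (h' h : H) : Prop where
  next : M.NextIn (h', false) (h, false)
  low : M.py (σ h') < M.py (σ h)
  unseen : ∀ c, ¬ M.Sees C c (h', false)

/-- At the height of its start, the child is the first thing to the right of the parent's left leg.
This yields the clear stretch for `region_empty`. -/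
theorem Child.facts [Finite V] (F : M.IsForkSystem σ C) {h' h : H} (hC : Child M σ C h' h) :
    M.py (σ h) < M.py (M.tgt (h', false)) ∧ M.fn (h', false) (M.py (σ h)) < M.px (σ h) ∧
    ∀ s, M.py (M.src s) < M.py (σ h) → M.py (σ h) ≤ M.py (M.tgt s) →
      M.fn (h', false) (M.py (σ h)) < M.fn s (M.py (σ h)) →
      M.px (σ h) < M.fn s (M.py (σ h)) := by
  have h1 : M.py (σ h) < M.py (M.tgt (h', false)) := by
    rw [← hC.next.1, ← F.src_eq h false]; exact M.lt _
  have h0 : M.fn (h, false) (M.py (σ h)) = M.px (σ h) := by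
    have := M.fn_src (h, false); rwa [F.src_eq] at this
  have hlow := hC.low
  refine ⟨h1, ?_, fun s hs hs' hlt => ?_⟩
  · rw [← h0]
    exact hC.next.2.1.fn_lt (by rw [F.src_eq]; exact hlow.le) h1.le (by rw [F.src_eq])
      (by rw [hC.next.1]; exact h1.le) (Or.inl ⟨by rw [F.src_eq]; exact hlow, h1⟩)
  · have := hC.next.no_arc_between F.tgt_mem hC.unseen (s := s) (t := M.py (σ h))
      (by rw [F.src_eq]; exact hlow) (by rw [F.src_eq]) h1 hs.le hs' hlt
    rw [h0] at this
    refine lt_of_le_of_ne this fun e => ?_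
    rcases M.avoid s (σ h) hs.le hs' e.symm with h2 | h2
    · rw [← h2] at hs; exact lt_irrefl _ hs
    · exact F.notMem h (h2 ▸ F.tgt_mem _)

/-- At the height of `h` only the start of `h` separates the left leg of its left parent from the
right leg of its right parent, so the region between the two legs below that height is empty. Were
the parents different, the remaining leg of the higher one would be caught in this region. -/
theorem parents_eq_aux [Finite V] (F : M.IsForkSystem σ C) {h' h'' h : H}
    (hC : Child M σ C h' h) (hD : Child M.flipFork σ C h'' h)
    (hle : M.py (σ h') ≤ M.py (σ h'')) :
    h' = h'' ∧ ∀ c ∈ C, M.py (σ h') < M.py c → M.py c < M.py (σ h) →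
      M.fn (h', false) (M.py c) < M.px c → M.fn (h', true) (M.py c) ≤ M.px c := by
  obtain ⟨a1, a2, a3⟩ := hC.facts F
  obtain ⟨b1, b2, b3⟩ := hD.facts F.flip
  have hl2 : M.py (σ h'') < M.py (σ h) := hD.low
  have b1' : M.py (σ h) < M.py (M.tgt (h'', true)) := b1
  have b2' : M.px (σ h) < M.fn (h'', true) (M.py (σ h)) := neg_lt_neg_iff.1 b2
  have b3' : ∀ s, M.py (M.src s) < M.py (σ h) → M.py (σ h) ≤ M.py (M.tgt s) →
      M.fn s (M.py (σ h)) < M.fn (h'', true) (M.py (σ h)) →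
      M.fn s (M.py (σ h)) < M.px (σ h) := by
    rintro ⟨s, b⟩ h1 h2 h3
    have := b3 (s, !b) (by simpa [flipFork, comap, flipX] using h1)
      (by simpa [flipFork, comap, flipX] using h2) (by simpa [flipFork, comap, flipX] using h3)
    simpa [flipFork, comap, flipX] using this
  have hclear : ∀ s, M.py (M.src s) < M.py (σ h) → M.py (σ h) ≤ M.py (M.tgt s) →
      M.fn (h', false) (M.py (σ h)) < M.fn s (M.py (σ h)) →
      ¬ M.fn s (M.py (σ h)) < M.fn (h'', true) (M.py (σ h)) := fun s h1 h2 h3 h4 =>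
    lt_asymm (a3 s h1 h2 h3) (b3' s h1 h2 h4)
  have hreg : ∀ c ∈ C, M.py (σ h'') < M.py c → M.py c < M.py (σ h) →
      M.fn (h', false) (M.py c) < M.px c → M.fn (h'', true) (M.py c) ≤ M.px c :=
    fun c hc h1 h2 h3 => region_empty F.tgt_mem (i := (h', false)) (r := (h'', true))
      (y := M.py (σ h)) (by rw [F.src_eq]; linarith) a1 (by rw [F.src_eq]; linarith) b1' hclear
      hC.unseen hc (by rw [F.src_eq]; linarith) (by rw [F.src_eq]; linarith) h2 h3
  have heq : h' = h'' := by
    by_contra hne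
    have s0 : ∀ g b, M.fn (g, b) (M.py (σ g)) = M.px (σ g) := fun g b => by
      have := M.fn_src (g, b); rwa [F.src_eq] at this
    have hx : M.fn (h', false) (M.py (σ h'')) < M.px (σ h'') := by
      rcases lt_trichotomy (M.fn (h', false) (M.py (σ h''))) (M.px (σ h'')) with e | e | e
      · exact e
      · rcases M.avoid (h', false) (σ h'') (by rw [F.src_eq]; exact hle) (by linarith) e with e | e
        · rw [F.src_eq] at e
          exact absurd (F.inj e).symm hne
        · exact absurd (e ▸ F.tgt_mem _) (F.notMem h'')
      · have hr : M.RightOf (h'', true) (h', false) := ⟨M.py (σ h''), by rw [F.src_eq],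
          by linarith, by rw [F.src_eq]; exact hle, by linarith, by rw [s0]; exact e⟩
        have := hr.fn_le (t := M.py (σ h)) (by rw [F.src_eq]; exact hl2.le) b1'.le
          (by rw [F.src_eq]; linarith) a1.le
        linarith
    have hl := M.lt (h'', false)
    rw [F.src_eq] at hl
    have hr : M.RightOf (h', false) (h'', false) := ⟨M.py (σ h''), by rw [F.src_eq]; exact hle,
      by linarith, by rw [F.src_eq], hl.le, by rw [s0]; exact hx⟩
    -- The left leg of `h''` runs between the two legs: it ends in the empty region or crosses the
    -- clear stretch at the height of `h`.
    rcases lt_or_ge (M.py (M.tgt (h'', false))) (M.py (σ h)) with e | e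
    · have e1 := hr.fn_lt (t := M.py (M.tgt (h'', false))) (by rw [F.src_eq]; linarith)
        (by linarith) (by rw [F.src_eq]; exact hl.le) le_rfl
        (Or.inl ⟨by rw [F.src_eq]; linarith, by linarith⟩)
      have e2 := F.left_lt h'' (M.py (M.tgt (h'', false))) hl le_rfl (by linarith)
      rw [M.fn_tgt] at e1 e2
      have := hreg _ (F.tgt_mem _) hl e e1
      linarith
    · have e1 := hr.fn_lt (t := M.py (σ h)) (by rw [F.src_eq]; linarith)
        a1.le (by rw [F.src_eq]; exact hl2.le) e
        (Or.inl ⟨by rw [F.src_eq]; linarith, a1⟩)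
      exact hclear (h'', false) (by rw [F.src_eq]; exact hl2) e e1
        (F.left_lt h'' _ hl2 e b1'.le)
  refine ⟨heq, fun c hc h1 h2 h3 => ?_⟩
  subst heq
  exact hreg c hc h1 h2 h3

theorem flipFork_flipFork (M : ArcSystem V (H × Bool)) : M.flipFork.flipFork = M := by
  obtain ⟨px, py, src, tgt, fn, _, _, _, _, _, _, _⟩ := M
  simp [flipFork, comap, flipX]

/-- By symmetry the lower of the two parents may be taken as the left one. The parents then
coincide, so parent and child are nested with the same ends. The part of their lens below the child
is empty by `parents_eq_aux`, the parts beside its legs by `gap`. -/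
theorem no_common_child [Finite V] (F : M.IsForkSystem σ C)
    (hlens : ∀ h' h, M.tgt (h', false) = M.tgt (h, false) → M.tgt (h', true) = M.tgt (h, true) →
      M.py (σ h') < M.py (σ h) → ∃ c ∈ C, M.InLens (h', false) (h', true) (h, false) (h, true) c)
    {h' h'' h : H} (hC : Child M σ C h' h) (hD : Child M.flipFork σ C h'' h) : False := by
  have main : h' = h'' ∧ ∀ c ∈ C, M.py (σ h') < M.py c → M.py c < M.py (σ h) →
      M.fn (h', false) (M.py c) < M.px c → M.fn (h', true) (M.py c) ≤ M.px c := by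
    rcases le_total (M.py (σ h')) (M.py (σ h'')) with hle | hle
    · exact parents_eq_aux F hC hD hle
    · obtain ⟨rfl, -⟩ := parents_eq_aux F.flip hD ((flipFork_flipFork M).symm ▸ hC) hle
      exact parents_eq_aux F hC hD le_rfl
  obtain ⟨rfl, hreg⟩ := main
  have ht2 : M.tgt (h', true) = M.tgt (h, true) := hD.next.1.symm
  obtain ⟨c, hc, h1, h2⟩ := hlens h' h hC.next.1.symm ht2 hC.low
  rw [F.src_eq] at h1
  simp only [F.src_eq] at h2
  rcases h2 with ⟨e1, e2, e3⟩ | ⟨e1, e2, e3, e4⟩ | ⟨e1, e2, e3, e4⟩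
  · have := hreg c hc h1 e1 e2
    linarith
  · rw [hC.next.1] at e2
    have := hC.next.gap F.tgt_mem hC.unseen hc (by rw [F.src_eq]; exact h1)
      (by rw [F.src_eq]; exact e1) e2 e3
    linarith
  · have := hD.next.gap F.flip.tgt_mem hD.unseen hc (by rw [F.flip.src_eq]; exact h1)
      (by rw [F.flip.src_eq]; exact e1) (by rw [← ht2] at e2; exact e2) (neg_lt_neg e4)
    exact lt_asymm e3 (neg_lt_neg_iff.1 this)

/-- Childless left legs are last into their end or seen from the right by a point of `C`. There are
at most `|C|` of each kind. -/
theorem card_no_child_le [Finite V] [Finite H] (F : M.IsForkSystem σ C) :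
    {h' | ¬ ∃ h, Child M σ C h' h}.ncard ≤ 2 * C.ncard := by
  have hsub : {h' | ¬ ∃ h, Child M σ C h' h} ⊆
      {h' | M.LastIn (h', false)} ∪ {h' | ∃ c, M.Sees C c (h', false)} := by
    intro h' hh
    by_contra hc
    simp only [Set.mem_union, Set.mem_ofPred_eq, not_or, not_exists] at hc
    obtain ⟨h, h1, h2⟩ := F.exists_child hc.1 hc.2
    exact hh ⟨h, h1, h2, hc.2⟩
  have hinj : Function.Injective fun h : H => (h, false) := fun a b e => (Prod.ext_iff.1 e).1
  have c1 : {h' | M.LastIn (h', false)}.ncard ≤ C.ncard :=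
    Set.ncard_le_ncard_of_injOn (fun h => M.tgt (h, false)) (fun _ _ => F.tgt_mem _)
      (fun i hi j hj e => hinj (LastIn.eq hi hj e)) (Set.toFinite _)
  have c2 : {h' | ∃ c, M.Sees C c (h', false)}.ncard ≤ C.ncard :=
    (Set.ncard_le_ncard_of_injOn (t := {i | ∃ c, M.Sees C c i}) (fun h => (h, false))
      (fun _ h => h) (fun i _ j _ e => hinj e) (Set.toFinite _)).trans (ncard_seen_le M C)
  have := Set.ncard_le_ncard hsub (Set.toFinite _)
  have := Set.ncard_union_le {h' | M.LastIn (h', false)} {h' | ∃ c, M.Sees C c (h', false)}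
  omega

/-- If nested forks with the same ends always have a point of `C` between them, then the number of
forks is linear in the number of points of `C`. -/
theorem card_le [Finite V] [Finite H] (F : M.IsForkSystem σ C)
    (hlens : ∀ h' h, M.tgt (h', false) = M.tgt (h, false) → M.tgt (h', true) = M.tgt (h, true) →
      M.py (σ h') < M.py (σ h) →
      ∃ c ∈ C, M.InLens (h', false) (h', true) (h, false) (h, true) c) :
    Nat.card H ≤ 8 * C.ncard := by
  set P := {h' | ∃ h, Child M σ C h' h} with hP
  set Q := {h' | ∃ h, Child M.flipFork σ C h' h} with hQ
  rcases isEmpty_or_nonempty H with hH | hH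
  · simp
  choose! p hp using fun h' (hh : h' ∈ P) => hh
  choose! q hq using fun h' (hh : h' ∈ Q) => hh
  have hinj : Function.Injective fun h : H => (h, false) := fun a b e => (Prod.ext_iff.1 e).1
  have pinj : Set.InjOn p P := fun a ha b hb e =>
    hinj ((hp a ha).next.eq_left (e ▸ (hp b hb).next))
  have qinj : Set.InjOn q Q := fun a ha b hb e =>
    hinj ((hq a ha).next.eq_left (e ▸ (hq b hb).next))
  -- With `n` forks, `P` and `Q` have at least `n - 2|C|` elements each and disjoint injective
  -- images, so `n ≤ 4|C|`. The stated constant is not tight.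
  have hdisj : Disjoint (p '' P) (q '' Q) := by
    rw [Set.disjoint_left]
    rintro _ ⟨a, ha, rfl⟩ ⟨b, hb, e⟩
    exact no_common_child F hlens (hp a ha) (e ▸ hq b hb)
  have hPc : Pᶜ.ncard ≤ 2 * C.ncard := F.card_no_child_le
  have hQc : Qᶜ.ncard ≤ 2 * C.ncard := F.flip.card_no_child_le
  have e1 := Set.ncard_add_ncard_compl P (Set.toFinite _) (Set.toFinite _)
  have e2 := Set.ncard_add_ncard_compl Q (Set.toFinite _) (Set.toFinite _)
  have e3 := Set.ncard_union_eq hdisj (Set.toFinite _) (Set.toFinite _)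
  rw [pinj.ncard_image, qinj.ncard_image] at e3
  have e4 := Set.ncard_le_ncard (Set.subset_univ (p '' P ∪ q '' Q)) (Set.toFinite _)
  rw [Set.ncard_univ] at e4
  omega

end IsForkSystem

end ArcSystem

/-! ### Nested forks, and vertices of degree at least three -/

namespace ArcSystem

variable {V ι κ H : Type*} (M : ArcSystem V ι)

/-- Two arcs from `h ∉ C` to distinct points of `C`, the arc `l` to the left of `r`. -/
structure IsFork (C : Set V) (h : V) (l r : ι) : Prop where
  src_left : M.src l = h
  src_right : M.src r = h
  notMem : h ∉ C
  left_mem : M.tgt l ∈ C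
  right_mem : M.tgt r ∈ C
  tgt_ne : M.tgt l ≠ M.tgt r
  rightOf : M.RightOf l r

variable {M}

theorem RightOf.flipX {i j : ι} (h : M.RightOf i j) : M.flipX.RightOf j i := by
  obtain ⟨t, h1, h2, h3, h4, h5⟩ := h
  exact ⟨t, h3, h4, h1, h2, neg_lt_neg h5⟩

namespace IsFork

variable {C : Set V} {h h' : V} {l r l' r' : ι}

theorem flipX (F : M.IsFork C h l r) : M.flipX.IsFork C h r l :=
  ⟨F.src_right, F.src_left, F.notMem, F.right_mem, F.left_mem, F.tgt_ne.symm, F.rightOf.flipX⟩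

theorem lt_left (F : M.IsFork C h l r) : M.py h < M.py (M.tgt l) := F.src_left ▸ M.lt l

theorem lt_right (F : M.IsFork C h l r) : M.py h < M.py (M.tgt r) := F.src_right ▸ M.lt r

theorem fn_left (F : M.IsFork C h l r) : M.fn l (M.py h) = M.px h := by
  have := M.fn_src l; rwa [F.src_left] at this

theorem fn_right (F : M.IsFork C h l r) : M.fn r (M.py h) = M.px h := by
  have := M.fn_src r; rwa [F.src_right] at this

theorem fn_lt (F : M.IsFork C h l r) {t : ℝ} (h1 : M.py h < t) (h2 : t ≤ M.py (M.tgt l))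
    (h3 : t ≤ M.py (M.tgt r)) : M.fn l t < M.fn r t := by
  have k1 : M.py (M.src l) ≤ t := by rw [F.src_left]; exact h1.le
  have k2 : M.py (M.src r) ≤ t := by rw [F.src_right]; exact h1.le
  refine lt_of_le_of_ne (F.rightOf.fn_le k1 h2 k2 h3) fun e => ?_
  obtain ⟨v, e1, e2, rfl⟩ := M.cross l r t (fun e => F.tgt_ne (by rw [e])) k1 h2 k2 h3 e
  rw [F.src_left] at e1
  rw [F.src_right] at e2
  rcases e1 with rfl | rfl
  · exact lt_irrefl _ h1
  · rcases e2 with e2 | e2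
    · exact F.notMem (e2 ▸ F.left_mem)
    · exact F.tgt_ne e2

/-- Otherwise the inner right leg would start, and hence stay, to the right of nothing but the
outside of `l'`, that is, to the left of `l'`. At the lower of the two common ends this reverses the
order of the legs of one of the forks. -/
theorem lt_of_nested_left (F' : M.IsFork C h' l' r') (F : M.IsFork C h l r)
    (hl : M.tgt l' = M.tgt l) (hr : M.tgt r' = M.tgt r) (hne : h ≠ h')
    (hle : M.py h' ≤ M.py h) : M.fn l' (M.py h) < M.px h := by
  have k1 : M.py (M.src l') ≤ M.py h := by rw [F'.src_left]; exact hle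
  have k2 : M.py h ≤ M.py (M.tgt l') := by rw [hl]; exact F.lt_left.le
  by_contra hc
  push Not at hc
  have hlt : M.px h < M.fn l' (M.py h) := by
    refine lt_of_le_of_ne hc (fn_ne_px k1 k2 (by rwa [F'.src_left]) ?_).symm
    exact fun e => F.notMem (e ▸ F'.left_mem)
  have hR : M.RightOf r l' := ⟨M.py h, by rw [F.src_right], F.lt_right.le, k1, k2, by
    rwa [F.fn_right]⟩
  rcases le_or_gt (M.py (M.tgt r)) (M.py (M.tgt l)) with h1 | h1
  · have e1 := hR.fn_le (t := M.py (M.tgt r)) (M.lt r).le le_rfl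
      (by linarith [F.lt_right]) (by rw [hl]; exact h1)
    have e2 := F'.fn_lt (t := M.py (M.tgt r)) (by linarith [F.lt_right]) (by rw [hl]; exact h1)
      (by rw [hr])
    rw [M.fn_tgt] at e1
    rw [← hr, M.fn_tgt, hr] at e2
    linarith
  · have e1 := hR.fn_le (t := M.py (M.tgt l)) (by rw [F.src_right]; exact F.lt_left.le) h1.le
      (by linarith [F.lt_left]) (by rw [hl])
    have e2 := F.fn_lt (t := M.py (M.tgt l)) F.lt_left le_rfl h1.le
    rw [← hl, M.fn_tgt, hl] at e1
    rw [M.fn_tgt] at e2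
    linarith

theorem lt_of_nested_right (F' : M.IsFork C h' l' r') (F : M.IsFork C h l r)
    (hl : M.tgt l' = M.tgt l) (hr : M.tgt r' = M.tgt r) (hne : h ≠ h')
    (hle : M.py h' ≤ M.py h) : M.px h < M.fn r' (M.py h) :=
  neg_lt_neg_iff.1 (F'.flipX.lt_of_nested_left F.flipX hr hl hne hle)

/-- At equal heights the second apex would lie strictly between the two legs of the first fork at
their common start. -/
theorem py_ne (F' : M.IsFork C h' l' r') (F : M.IsFork C h l r)
    (hl : M.tgt l' = M.tgt l) (hr : M.tgt r' = M.tgt r) (hne : h ≠ h') : M.py h' ≠ M.py h := by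
  intro he
  have := F'.lt_of_nested_left F hl hr hne he.le
  have := F'.lt_of_nested_right F hl hr hne he.le
  rw [← he, F'.fn_left] at *
  rw [F'.fn_right] at *
  linarith

/-- Forks are few if nested forks with the same ends have a point of `C` between them. -/
theorem ncard_le [Finite V] {l r : V → ι} {H : Set V} (hF : ∀ h ∈ H, M.IsFork C h (l h) (r h))
    (hlens : ∀ h' ∈ H, ∀ h ∈ H, M.tgt (l h') = M.tgt (l h) → M.tgt (r h') = M.tgt (r h) →
      M.py h' < M.py h → ∃ c ∈ C, M.InLens (l h') (r h') (l h) (r h) c) :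
    H.ncard ≤ 8 * C.ncard := by
  let e : H × Bool → ι := fun i => if i.2 then r i.1 else l i.1
  have hsrc : ∀ i, M.src (e i) = i.1 := by
    rintro ⟨h, b⟩
    cases b
    · exact (hF h h.2).src_left
    · exact (hF h h.2).src_right
  have he : Function.Injective e := by
    rintro ⟨h, b⟩ ⟨g, d⟩ hh
    have h1 : h = g := Subtype.ext (by rw [← hsrc (h, b), hh, hsrc])
    subst h1
    have := (hF h h.2).tgt_ne
    cases b <;> cases d <;> first | rfl | skip
    · exact absurd (congrArg M.tgt hh) this
    · exact absurd (congrArg M.tgt hh).symm this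
  have F : (M.comap e he).IsForkSystem (Subtype.val : H → V) C :=
    { src_eq := fun h b => hsrc (h, b)
      inj := Subtype.val_injective
      notMem := fun h => (hF h h.2).notMem
      tgt_mem := by
        rintro ⟨h, b⟩
        cases b
        · exact (hF h h.2).left_mem
        · exact (hF h h.2).right_mem
      tgt_ne := fun h => (hF h h.2).tgt_ne
      left_lt := fun h t h1 h2 h3 => (hF h h.2).fn_lt h1 h2 h3 }
  exact F.card_le fun h' h h1 h2 h3 => hlens h' h'.2 h h.2 h1 h2 h3

/-- A middle arc of the outer fork that passes to the left of the inner one ends in the lens. -/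
theorem middle_left (F' : M.IsFork C h' l' r') (F : M.IsFork C h l r)
    (hl : M.tgt l' = M.tgt l) {m : ι} (hle : M.py h' ≤ M.py h)
    (hm : M.src m = h') (hml : M.tgt m ≠ M.tgt l') (h1 : M.RightOf l' m)
    (h3 : M.py h ≤ M.py (M.tgt m)) (h4 : M.fn m (M.py h) < M.px h) :
    M.py (M.tgt m) < M.py (M.tgt l) ∧ M.fn l' (M.py (M.tgt m)) < M.px (M.tgt m) ∧
      M.px (M.tgt m) < M.fn l (M.py (M.tgt m)) := by
  have hR : M.RightOf m l := ⟨M.py h, by rw [hm]; exact hle, h3, by rw [F.src_left],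
    F.lt_left.le, by rw [F.fn_left]; exact h4⟩
  have k0 := F'.lt_left
  have k1 := F.lt_left
  have k2 := M.lt m
  rw [hm] at k2
  have hlt : M.py (M.tgt m) < M.py (M.tgt l) := by
    by_contra hc
    push Not at hc
    have e1 := hR.fn_le (t := M.py (M.tgt l)) (by rw [hm]; linarith) hc
      (by rw [F.src_left]; exact k1.le) le_rfl
    have e2 := h1.fn_le (t := M.py (M.tgt l)) (by rw [F'.src_left]; linarith) (by rw [hl])
      (by rw [hm]; linarith) hc
    rw [M.fn_tgt] at e1
    rw [← hl, M.fn_tgt, hl] at e2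
    rcases M.avoid m (M.tgt l) (by rw [hm]; linarith) hc (le_antisymm e1 e2) with e | e
    · rw [hm] at e
      exact F'.notMem (e ▸ F.left_mem)
    · exact hml (e ▸ hl.symm)
  refine ⟨hlt, ?_, ?_⟩
  · rw [← M.fn_tgt m]
    exact h1.fn_lt (by rw [F'.src_left]; exact k2.le) (by rw [hl]; exact hlt.le)
      (by rw [hm]; exact k2.le) le_rfl (Or.inl ⟨by rw [F'.src_left]; exact k2, by rw [hl]; exact hlt⟩)
  · rw [← M.fn_tgt m]
    rcases eq_or_lt_of_le h3 with h5 | h5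
    · rw [← h5, F.fn_left]; exact h4
    · exact hR.fn_lt (by rw [hm]; exact k2.le) le_rfl (by rw [F.src_left]; exact h5.le) hlt.le
        (Or.inr ⟨by rw [F.src_left]; exact h5, hlt⟩)

/-- A middle arc of the outer fork ends below the inner apex, or it passes that apex on one side and
is then confined between the inner and the outer leg of this side. -/
theorem middle_inLens (F' : M.IsFork C h' l' r') (F : M.IsFork C h l r)
    (hl : M.tgt l' = M.tgt l) (hr : M.tgt r' = M.tgt r) (hlt : M.py h' < M.py h) {m : ι}
    (hm : M.src m = h') (hml : M.tgt m ≠ M.tgt l') (hmr : M.tgt m ≠ M.tgt r')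
    (h1 : M.RightOf l' m) (h2 : M.RightOf m r') (hC : M.tgt m ∈ C) :
    M.InLens l' r' l r (M.tgt m) := by
  have k2 := M.lt m
  rw [hm] at k2
  have k0 := F.lt_left
  have k1 := F.lt_right
  refine ⟨by rw [F'.src_left]; exact k2, ?_⟩
  rw [F.src_left]
  rcases lt_or_ge (M.py (M.tgt m)) (M.py h) with h3 | h3
  · refine Or.inl ⟨h3, ?_, ?_⟩
    · rw [← M.fn_tgt m]
      exact h1.fn_lt (by rw [F'.src_left]; exact k2.le) (by rw [hl]; linarith)
        (by rw [hm]; exact k2.le) le_rfl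
        (Or.inl ⟨by rw [F'.src_left]; exact k2, by rw [hl]; linarith⟩)
    · rw [← M.fn_tgt m]
      exact h2.fn_lt (by rw [hm]; exact k2.le) le_rfl (by rw [F'.src_right]; exact k2.le)
        (by rw [hr]; linarith) (Or.inr ⟨by rw [F'.src_right]; exact k2, by rw [hr]; linarith⟩)
  · rcases lt_trichotomy (M.fn m (M.py h)) (M.px h) with h4 | h4 | h4
    · exact Or.inr (Or.inl ⟨h3, F'.middle_left F hl hlt.le hm hml h1 h3 h4⟩)
    · rcases M.avoid m h (by rw [hm]; exact hlt.le) h3 h4 with e | e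
      · rw [e, hm] at hlt
        exact absurd hlt (lt_irrefl _)
      · exact absurd (e ▸ hC) F.notMem
    · obtain ⟨e1, e2, e3⟩ := F'.flipX.middle_left F.flipX hr hlt.le hm hmr h2.flipX h3
        (neg_lt_neg h4)
      exact Or.inr (Or.inr ⟨h3, e1, neg_lt_neg_iff.1 e3, neg_lt_neg_iff.1 e2⟩)

/-- An arc into the inner apex arrives between the legs of the outer fork. If it started no higher
than the outer apex, it would be squeezed through that apex. -/
theorem lower_inLens (F' : M.IsFork C h' l' r') (F : M.IsFork C h l r)
    (hl : M.tgt l' = M.tgt l) (hr : M.tgt r' = M.tgt r) (hlt : M.py h' < M.py h) {g : ι}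
    (hg : M.tgt g = h) (hC : M.src g ∈ C) : M.InLens l' r' l r (M.src g) := by
  have hne : h ≠ h' := by rintro rfl; exact lt_irrefl _ hlt
  have k2 := M.lt g
  rw [hg] at k2
  have k0 := F.lt_left
  have k1 := F.lt_right
  have hgh : M.fn g (M.py h) = M.px h := by rw [← hg, M.fn_tgt]
  have h1 : M.RightOf l' g := ⟨M.py h, by rw [F'.src_left]; exact hlt.le, by rw [hl]; exact k0.le,
    k2.le, by rw [hg], by rw [hgh]; exact F'.lt_of_nested_left F hl hr hne hlt.le⟩
  have h2 : M.RightOf g r' := ⟨M.py h, k2.le, by rw [hg], by rw [F'.src_right]; exact hlt.le,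
    by rw [hr]; exact k1.le, by rw [hgh]; exact F'.lt_of_nested_right F hl hr hne hlt.le⟩
  have hlow : M.py h' < M.py (M.src g) := by
    by_contra hc
    push Not at hc
    have e1 := h1.fn_le (t := M.py h') (by rw [F'.src_left]) F'.lt_left.le hc
      (by rw [hg]; exact hlt.le)
    have e2 := h2.fn_le (t := M.py h') hc (by rw [hg]; exact hlt.le) (by rw [F'.src_right])
      F'.lt_right.le
    rw [F'.fn_left] at e1
    rw [F'.fn_right] at e2
    rcases M.avoid g h' hc (by rw [hg]; exact hlt.le) (le_antisymm e2 e1) with e | e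
    · exact F'.notMem (e ▸ hC)
    · exact hne (hg ▸ e.symm)
  refine ⟨by rw [F'.src_left]; exact hlow, Or.inl ⟨by rw [F.src_left]; exact k2, ?_, ?_⟩⟩
  · rw [← M.fn_src g]
    exact h1.fn_lt (by rw [F'.src_left]; exact hlow.le) (by rw [hl]; linarith) le_rfl (M.lt g).le
      (Or.inl ⟨by rw [F'.src_left]; exact hlow, by rw [hl]; linarith⟩)
  · rw [← M.fn_src g]
    exact h2.fn_lt le_rfl (M.lt g).le (by rw [F'.src_right]; exact hlow.le) (by rw [hr]; linarith)
      (Or.inr ⟨by rw [F'.src_right]; exact hlow, by rw [hr]; linarith⟩)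

end IsFork

theorem exists_height_above [Finite V] (M : ArcSystem V ι) (h : V) :
    ∃ t, ∀ i, M.src i = h → M.py (M.src i) < t ∧ t < M.py (M.tgt i) := by
  obtain ⟨t, h1, h2⟩ := M.flipY.exists_between_height (M.flipY.py h)
  simp only [flipY] at h1 h2
  refine ⟨-t, ?_⟩
  rintro i rfl
  have := h2 (M.tgt i) (neg_lt_neg (M.lt i))
  exact ⟨by linarith, by linarith⟩

theorem exists_sorted_three {α : Type*} (f : α → ℝ) (P : α → Prop) {a b c : α} (ha : P a) (hb : P b)
    (hc : P c) (h1 : f a ≠ f b) (h2 : f a ≠ f c) (h3 : f b ≠ f c) :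
    ∃ x y z, P x ∧ P y ∧ P z ∧ f x < f y ∧ f y < f z := by
  rcases lt_or_gt_of_ne h1 with k1 | k1 <;> rcases lt_or_gt_of_ne h2 with k2 | k2 <;>
    rcases lt_or_gt_of_ne h3 with k3 | k3
  · exact ⟨a, b, c, ha, hb, hc, k1, k3⟩
  · exact ⟨a, c, b, ha, hc, hb, k2, k3⟩
  · linarith
  · exact ⟨c, a, b, hc, ha, hb, k2, k1⟩
  · exact ⟨b, a, c, hb, ha, hc, k1, k2⟩
  · linarith
  · exact ⟨b, c, a, hb, hc, ha, k3, k2⟩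
  · exact ⟨c, b, a, hc, hb, ha, k3, k1⟩

theorem rightOf_or_of_src_eq [Finite V] {i j : ι} (h : i ≠ j) (hs : M.src i = M.src j) :
    M.RightOf i j ∨ M.RightOf j i := by
  obtain ⟨t, ht⟩ := M.exists_height_above (M.src i)
  obtain ⟨a1, a2⟩ := ht i rfl
  obtain ⟨b1, b2⟩ := ht j hs.symm
  rcases lt_or_gt_of_ne (fn_ne_of_interior h a1.le a2.le b1.le b2.le (Or.inl ⟨a1, a2⟩)) with e | e
  · exact Or.inl ⟨t, a1.le, a2.le, b1.le, b2.le, e⟩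
  · exact Or.inr ⟨t, b1.le, b2.le, a1.le, a2.le, e⟩

/-- The points outside `C` where at least three arcs start are few. -/
theorem ncard_three_out_le [Finite V] {C : Set V} (hcov : ∀ i, M.src i ∈ C ∨ M.tgt i ∈ C)
    (hsimple : ∀ i j, M.src i = M.src j → M.tgt i = M.tgt j → i = j) :
    {h | h ∉ C ∧ ∃ i j k, M.src i = h ∧ M.src j = h ∧ M.src k = h ∧ i ≠ j ∧ i ≠ k ∧ j ≠ k}.ncard
      ≤ 8 * C.ncard := by
  set H := {h | h ∉ C ∧ ∃ i j k, M.src i = h ∧ M.src j = h ∧ M.src k = h ∧ i ≠ j ∧ i ≠ k ∧ j ≠ k}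
    with hH
  rcases isEmpty_or_nonempty ι with hι | hι
  · have : H = ∅ := Set.eq_empty_of_forall_notMem fun h ⟨_, i, _⟩ => hι.elim i
    simp [this]
  have key : ∀ h ∈ H, ∃ l m r, M.IsFork C h l r ∧ M.src m = h ∧ M.tgt m ∈ C ∧
      M.tgt m ≠ M.tgt l ∧ M.tgt m ≠ M.tgt r ∧ M.RightOf l m ∧ M.RightOf m r := by
    rintro h ⟨hh, i, j, k, hi, hj, hk, hij, hik, hjk⟩
    obtain ⟨t, ht⟩ := M.exists_height_above h
    have hne : ∀ i j, M.src i = h → M.src j = h → i ≠ j → M.fn i t ≠ M.fn j t :=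
      fun i j hi hj hij => fn_ne_of_interior hij (ht i hi).1.le (ht i hi).2.le (ht j hj).1.le
        (ht j hj).2.le (Or.inl (ht i hi))
    obtain ⟨l, m, r, hl, hm, hr, h1, h2⟩ := exists_sorted_three (fun i => M.fn i t)
      (fun i => M.src i = h) hi hj hk (hne i j hi hj hij) (hne i k hi hk hik) (hne j k hj hk hjk)
    have hR : ∀ i j, M.src i = h → M.src j = h → M.fn i t < M.fn j t → M.RightOf i j :=
      fun i j hi hj hlt => ⟨t, (ht i hi).1.le, (ht i hi).2.le, (ht j hj).1.le, (ht j hj).2.le, hlt⟩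
    have hT : ∀ i, M.src i = h → M.tgt i ∈ C := fun i hi =>
      (hcov i).resolve_left (by rw [hi]; exact hh)
    have hD : ∀ i j, M.src i = h → M.src j = h → M.fn i t < M.fn j t → M.tgt i ≠ M.tgt j := by
      intro i j hi hj hlt e
      rw [hsimple i j (hi.trans hj.symm) e] at hlt
      exact lt_irrefl _ hlt
    have h3 := lt_trans h1 h2
    exact ⟨l, m, r, ⟨hl, hr, hh, hT l hl, hT r hr, hD l r hl hr h3, hR l r hl hr h3⟩, hm, hT m hm,
      (hD l m hl hm h1).symm, hD m r hm hr h2, hR l m hl hm h1, hR m r hm hr h2⟩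
  choose! l m r hF hm hmC hml hmr hlm hmr' using key
  exact IsFork.ncard_le hF fun h' hh' h hh e1 e2 e3 => ⟨_, hmC h' hh',
    (hF h' hh').middle_inLens (hF h hh) e1 e2 e3 (hm h' hh') (hml h' hh') (hmr h' hh')
      (hlm h' hh') (hmr' h' hh') (hmC h' hh')⟩

/-- The points outside `C` where at least two arcs start and at least one arc ends are few. -/
theorem ncard_two_out_one_in_le [Finite V] {C : Set V} (hcov : ∀ i, M.src i ∈ C ∨ M.tgt i ∈ C)
    (hsimple : ∀ i j, M.src i = M.src j → M.tgt i = M.tgt j → i = j) :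
    {h | h ∉ C ∧ ∃ i j g, M.src i = h ∧ M.src j = h ∧ M.tgt g = h ∧ i ≠ j}.ncard
      ≤ 8 * C.ncard := by
  set H := {h | h ∉ C ∧ ∃ i j g, M.src i = h ∧ M.src j = h ∧ M.tgt g = h ∧ i ≠ j} with hH
  rcases isEmpty_or_nonempty ι with hι | hι
  · have : H = ∅ := Set.eq_empty_of_forall_notMem fun h ⟨_, i, _⟩ => hι.elim i
    simp [this]
  have key : ∀ h ∈ H, ∃ l r g, M.IsFork C h l r ∧ M.tgt g = h ∧ M.src g ∈ C := by
    rintro h ⟨hh, i, j, g, hi, hj, hg, hij⟩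
    have hT : ∀ i, M.src i = h → M.tgt i ∈ C := fun i hi =>
      (hcov i).resolve_left (by rw [hi]; exact hh)
    have hgC : M.src g ∈ C := (hcov g).resolve_right (by rw [hg]; exact hh)
    have hD : M.tgt i ≠ M.tgt j := fun e => hij (hsimple i j (hi.trans hj.symm) e)
    rcases rightOf_or_of_src_eq hij (hi.trans hj.symm) with h1 | h1
    · exact ⟨i, j, g, ⟨hi, hj, hh, hT i hi, hT j hj, hD, h1⟩, hg, hgC⟩
    · exact ⟨j, i, g, ⟨hj, hi, hh, hT j hj, hT i hi, hD.symm, h1⟩, hg, hgC⟩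
  choose! l r g hF hg hgC using key
  exact IsFork.ncard_le hF fun h' hh' h hh e1 e2 e3 => ⟨_, hgC h hh,
    (hF h' hh').lower_inLens (hF h hh) e1 e2 e3 (hg h hh) (hgC h hh)⟩

end ArcSystem

/-! ### From drawings to arc systems -/

/-- The curve is extended by constants beyond its ends, so that it becomes a function continuous on
all of `ℝ`, as an `ArcSystem` requires. -/
theorem IsYMonotone.exists_continuous {p q : ℝ × ℝ} {s : Set (ℝ × ℝ)} (h : IsYMonotone p q s) :
    ∃ g : ℝ → ℝ, Continuous g ∧ g p.2 = p.1 ∧ g q.2 = q.1 ∧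
      ∀ x t, (x, t) ∈ s ↔ p.2 ≤ t ∧ t ≤ q.2 ∧ x = g t := by
  obtain ⟨hlt, f, hf, h1, h2, rfl⟩ := h
  have hg : ∀ t, p.2 ≤ t → t ≤ q.2 →
      Set.IccExtend hlt.le ((Set.Icc p.2 q.2).domRestrict f) t = f t := fun t h1 h2 => by
    rw [Set.IccExtend_of_mem _ _ ⟨h1, h2⟩]; rfl
  refine ⟨Set.IccExtend hlt.le ((Set.Icc p.2 q.2).domRestrict f),
    (continuousOn_iff_continuous_domRestrict.1 hf).Icc_extend', ?_, ?_, fun x t => ?_⟩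
  · rw [hg _ le_rfl hlt.le, h1]
  · rw [hg _ hlt.le le_rfl, h2]
  · constructor
    · rintro ⟨⟨h3, h4⟩, h5⟩
      exact ⟨h3, h4, by rw [hg _ h3 h4]; exact h5⟩
    · rintro ⟨h3, h4, h5⟩
      exact ⟨⟨h3, h4⟩, by rw [hg _ h3 h4] at h5; exact h5⟩

namespace LevelGraph.Drawing

variable {V : Type*} {G : LevelGraph V} (Γ : G.Drawing)

/-- A crossing-free family of y-monotone curves between points of the drawing. -/
structure IsMonotoneFamily (𝒜 : Set (Arc V)) : Prop where
  inj : Function.Injective Γ.pos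
  mono : ∀ A ∈ 𝒜, IsYMonotone (Γ.pos A.src) (Γ.pos A.tgt) A.pts
  avoids : ∀ A ∈ 𝒜, Γ.AvoidsVertices A
  nonCrossing : ∀ A ∈ 𝒜, ∀ B ∈ 𝒜, A ≠ B → Γ.NonCrossing A B

variable {Γ}

namespace IsMonotoneFamily

variable {𝒜 : Set (Arc V)}

/-- The x-coordinate of a curve as a function of the height. -/
noncomputable def fn (h : Γ.IsMonotoneFamily 𝒜) (A : 𝒜) : ℝ → ℝ :=
  (h.mono A A.2).exists_continuous.choose

theorem fn_spec (h : Γ.IsMonotoneFamily 𝒜) (A : 𝒜) :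
    Continuous (h.fn A) ∧ h.fn A (G.level A.1.src) = Γ.x A.1.src ∧
      h.fn A (G.level A.1.tgt) = Γ.x A.1.tgt ∧ ∀ x t, (x, t) ∈ A.1.pts ↔
        G.level A.1.src ≤ t ∧ t ≤ G.level A.1.tgt ∧ x = h.fn A t :=
  (h.mono A A.2).exists_continuous.choose_spec

/-- The system of arcs given by a family of curves. -/
noncomputable def sys (h : Γ.IsMonotoneFamily 𝒜) : ArcSystem V 𝒜 where
  px := Γ.x
  py := G.level
  src A := A.1.src
  tgt A := A.1.tgt
  fn := h.fn
  inj v w h1 h2 := h.inj (Prod.ext h1 h2)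
  lt A := (h.mono A A.2).1
  cont A := (h.fn_spec A).1
  fn_src A := (h.fn_spec A).2.1
  fn_tgt A := (h.fn_spec A).2.2.1
  avoid A v h1 h2 h3 := h.avoids A A.2 v (((h.fn_spec A).2.2.2 _ _).2 ⟨h1, h2, h3.symm⟩)
  cross A B t hne h1 h2 h3 h4 h5 := by
    obtain ⟨v, hA, hB, hp⟩ := h.nonCrossing A A.2 B B.2 (fun e => hne (Subtype.ext e))
      (h.fn A t, t) ⟨((h.fn_spec A).2.2.2 _ _).2 ⟨h1, h2, rfl⟩,
        ((h.fn_spec B).2.2.2 _ _).2 ⟨h3, h4, h5⟩⟩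
    exact ⟨v, hA, hB, (Prod.ext_iff.1 hp).2.symm⟩

theorem mem_pts (h : Γ.IsMonotoneFamily 𝒜) (A : 𝒜) {x t : ℝ} : (x, t) ∈ A.1.pts ↔
    G.level A.1.src ≤ t ∧ t ≤ G.level A.1.tgt ∧ x = h.sys.fn A t :=
  (h.fn_spec A).2.2.2 x t

theorem passesLeftOf (h : Γ.IsMonotoneFamily 𝒜) (A : 𝒜) {p : ℝ × ℝ} :
    PassesLeftOf A.1.pts p ↔
      G.level A.1.src ≤ p.2 ∧ p.2 ≤ G.level A.1.tgt ∧ h.sys.fn A p.2 < p.1 := by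
  constructor
  · rintro ⟨x, hx, hm⟩
    obtain ⟨h1, h2, rfl⟩ := (h.mem_pts A).1 hm
    exact ⟨h1, h2, hx⟩
  · rintro ⟨h1, h2, h3⟩
    exact ⟨_, h3, (h.mem_pts A).2 ⟨h1, h2, rfl⟩⟩

theorem passesRightOf (h : Γ.IsMonotoneFamily 𝒜) (A : 𝒜) {p : ℝ × ℝ} :
    PassesRightOf A.1.pts p ↔
      G.level A.1.src ≤ p.2 ∧ p.2 ≤ G.level A.1.tgt ∧ p.1 < h.sys.fn A p.2 := by
  constructor
  · rintro ⟨x, hx, hm⟩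
    obtain ⟨h1, h2, rfl⟩ := (h.mem_pts A).1 hm
    exact ⟨h1, h2, hx⟩
  · rintro ⟨h1, h2, h3⟩
    exact ⟨_, h3, (h.mem_pts A).2 ⟨h1, h2, rfl⟩⟩

end IsMonotoneFamily

theorem IsLevelPlanar.family (h : Γ.IsLevelPlanar) : Γ.IsMonotoneFamily Γ.edgeArcs :=
  ⟨h.1, fun A hA => (h.2.1 A hA).1, fun A hA => (h.2.1 A hA).2, h.2.2⟩

variable (Γ) in
/-- The drawn edge from `u` to `v`. -/
def edgeArc {u v : V} (h : G.Adj u v) : Γ.edgeArcs := ⟨⟨u, v, Γ.curve u v⟩, h, rfl⟩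

theorem edgeArcs_ext {A B : Γ.edgeArcs} (h1 : A.1.src = B.1.src) (h2 : A.1.tgt = B.1.tgt) :
    A = B := by
  refine Subtype.ext (Arc.ext h1 h2 ?_)
  rw [A.2.2, B.2.2, h1, h2]

theorem finite_edgeArcs [Finite V] : (Γ.edgeArcs).Finite := by
  have : Function.Injective fun A : Γ.edgeArcs => (A.1.src, A.1.tgt) := fun A B h =>
    edgeArcs_ext (Prod.ext_iff.1 h).1 (Prod.ext_iff.1 h).2
  exact Set.finite_coe_iff.1 (Finite.of_injective _ this)

/-- Of at least three incident edges, three point in one direction, or two in one direction and one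
in the other. With both directions these are four classes of at most `8|C|` vertices each. -/
theorem ncard_highDegree_le [Finite V] {C : Finset V} (hC : G.IsVertexCover C)
    (hΓ : Γ.IsLevelPlanar) : (G.highDegree C).ncard ≤ 32 * C.card := by
  have hcov : ∀ A : Γ.edgeArcs, A.1.src ∈ (C : Set V) ∨ A.1.tgt ∈ (C : Set V) :=
    fun A => hC _ _ A.2.1
  have b1 := hΓ.family.sys.ncard_three_out_le hcov fun _ _ => edgeArcs_ext
  have b2 := hΓ.family.sys.ncard_two_out_one_in_le hcov fun _ _ => edgeArcs_ext
  have b3 := hΓ.family.sys.flipY.ncard_three_out_le (fun A => (hcov A).symm)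
    fun _ _ h1 h2 => edgeArcs_ext h2 h1
  have b4 := hΓ.family.sys.flipY.ncard_two_out_one_in_le (fun A => (hcov A).symm)
    fun _ _ h1 h2 => edgeArcs_ext h2 h1
  rw [Set.ncard_coe_finset] at b1 b2 b3 b4
  refine le_trans (Set.ncard_le_ncard (t := (_ ∪ _) ∪ (_ ∪ _)) ?_ (Set.toFinite _))
    ((Set.ncard_union_le _ _).trans (Nat.add_le_add ((Set.ncard_union_le _ _).trans
      (Nat.add_le_add b1 b2)) ((Set.ncard_union_le _ _).trans (Nat.add_le_add b3 b4))) |>.trans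
        (by omega))
  rintro v ⟨hv, hdeg⟩
  have hun : G.nbrs v = {u | G.Adj u v} ∪ {u | G.Adj v u} := rfl
  rw [hun] at hdeg
  have hsum := Set.ncard_union_le {u | G.Adj u v} {u | G.Adj v u}
  have hcases : 2 < {u | G.Adj v u}.ncard ∨
      (1 < {u | G.Adj v u}.ncard ∧ 0 < {u | G.Adj u v}.ncard) ∨ 2 < {u | G.Adj u v}.ncard ∨
      (1 < {u | G.Adj u v}.ncard ∧ 0 < {u | G.Adj v u}.ncard) := by omega
  have ne1 : ∀ {a b : V} (ha : G.Adj v a) (hb : G.Adj v b), a ≠ b → Γ.edgeArc ha ≠ Γ.edgeArc hb :=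
    fun ha hb hne e => hne (congrArg (fun A : Γ.edgeArcs => A.1.tgt) e)
  have ne2 : ∀ {a b : V} (ha : G.Adj a v) (hb : G.Adj b v), a ≠ b → Γ.edgeArc ha ≠ Γ.edgeArc hb :=
    fun ha hb hne e => hne (congrArg (fun A : Γ.edgeArcs => A.1.src) e)
  rcases hcases with h | ⟨h, h'⟩ | h | ⟨h, h'⟩
  · obtain ⟨a, b, c, ha, hb, hc, hab, hac, hbc⟩ := (Set.two_lt_ncard_iff (Set.toFinite _)).1 h
    exact Or.inl (Or.inl ⟨hv, Γ.edgeArc ha, Γ.edgeArc hb, Γ.edgeArc hc, rfl, rfl, rfl,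
      ne1 _ _ hab, ne1 _ _ hac, ne1 _ _ hbc⟩)
  · obtain ⟨a, b, ha, hb, hab⟩ := (Set.one_lt_ncard_iff (Set.toFinite _)).1 h
    obtain ⟨c, hc⟩ := (Set.ncard_pos (Set.toFinite _)).1 h'
    exact Or.inl (Or.inr ⟨hv, Γ.edgeArc ha, Γ.edgeArc hb, Γ.edgeArc hc, rfl, rfl, rfl,
      ne1 _ _ hab⟩)
  · obtain ⟨a, b, c, ha, hb, hc, hab, hac, hbc⟩ := (Set.two_lt_ncard_iff (Set.toFinite _)).1 h
    exact Or.inr (Or.inl ⟨hv, Γ.edgeArc ha, Γ.edgeArc hb, Γ.edgeArc hc, rfl, rfl, rfl,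
      ne2 _ _ hab, ne2 _ _ hac, ne2 _ _ hbc⟩)
  · obtain ⟨a, b, ha, hb, hab⟩ := (Set.one_lt_ncard_iff (Set.toFinite _)).1 h
    obtain ⟨c, hc⟩ := (Set.ncard_pos (Set.toFinite _)).1 h'
    exact Or.inr (Or.inr ⟨hv, Γ.edgeArc ha, Γ.edgeArc hb, Γ.edgeArc hc, rfl, rfl, rfl,
      ne2 _ _ hab⟩)

end LevelGraph.Drawing

/-! ### The even-odd rule for two nested forks -/

namespace ArcSystem

variable {V ι : Type*} {M : ArcSystem V ι}

/-- The arc `i` passes to the left of the point `(x, y)`; whether it counts at the heights of its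
endpoints is determined by the conventions `P` and `Q`. -/
def Hit (M : ArcSystem V ι) (P Q : Prop) (i : ι) (x y : ℝ) : Prop :=
  ((M.py (M.src i) < y ∧ y < M.py (M.tgt i)) ∨ (y = M.py (M.src i) ∧ P) ∨
    (y = M.py (M.tgt i) ∧ Q)) ∧ M.fn i y < x

theorem hit_of_lt {P Q : Prop} {i : ι} {x y : ℝ} (h1 : M.py (M.src i) < y)
    (h2 : y < M.py (M.tgt i)) : M.Hit P Q i x y ↔ M.fn i y < x :=
  ⟨fun h => h.2, fun h => ⟨Or.inl ⟨h1, h2⟩, h⟩⟩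

theorem not_hit_of_lt_src {P Q : Prop} {i : ι} {x y : ℝ} (h : y < M.py (M.src i)) :
    ¬ M.Hit P Q i x y := by
  have := M.lt i
  rintro ⟨h1 | h1 | h1, -⟩ <;> linarith [h1.1]

theorem not_hit_of_tgt_lt {P Q : Prop} {i : ι} {x y : ℝ} (h : M.py (M.tgt i) < y) :
    ¬ M.Hit P Q i x y := by
  have := M.lt i
  rintro ⟨h1 | h1 | h1, -⟩
  · linarith [h1.2]
  · linarith [h1.1]
  · linarith [h1.1]

theorem hit_src_iff {P Q : Prop} {i : ι} {x : ℝ} :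
    M.Hit P Q i x (M.py (M.src i)) ↔ P ∧ M.px (M.src i) < x := by
  have := M.lt i
  rw [Hit, M.fn_src]
  constructor
  · rintro ⟨h1 | h1 | h1, h2⟩
    · exact absurd h1.1 (lt_irrefl _)
    · exact ⟨h1.2, h2⟩
    · exact absurd h1.1 this.ne
  · exact fun h => ⟨Or.inr (Or.inl ⟨rfl, h.1⟩), h.2⟩

theorem hit_tgt_iff {P Q : Prop} {i : ι} {x : ℝ} :
    M.Hit P Q i x (M.py (M.tgt i)) ↔ Q ∧ M.px (M.tgt i) < x := by
  have := M.lt i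
  rw [Hit, M.fn_tgt]
  constructor
  · rintro ⟨h1 | h1 | h1, h2⟩
    · exact absurd h1.2 (lt_irrefl _)
    · exact absurd h1.1 this.ne'
    · exact ⟨h1.2, h2⟩
  · exact fun h => ⟨Or.inr (Or.inr ⟨rfl, h.1⟩), h.2⟩

/-- The even-odd condition for the closed curve formed by the four arcs `l`, `r`, `l'`, `r'`. -/
def OddParity (M : ArcSystem V ι) (P Q : Prop) (l r l' r' : ι) (u : V) : Prop :=
  ¬ ((M.Hit P Q l (M.px u) (M.py u) ↔ M.Hit P Q r (M.px u) (M.py u)) ↔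
    (M.Hit P Q l' (M.px u) (M.py u) ↔ M.Hit P Q r' (M.px u) (M.py u)))

/-- The point `u` does not lie on the arc `i`. -/
def Off (M : ArcSystem V ι) (u : V) (i : ι) : Prop :=
  ¬ (M.py (M.src i) ≤ M.py u ∧ M.py u ≤ M.py (M.tgt i) ∧ M.px u = M.fn i (M.py u))

namespace IsFork

variable {C : Set V} {h h' v w : V} {l r l' r' : ι} {P Q : Prop}

theorem rightOf_nested (F' : M.IsFork C w l' r') (F : M.IsFork C v l r)
    (hl : M.tgt l' = M.tgt l) (hr : M.tgt r' = M.tgt r) (hlt : M.py w < M.py v) :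
    M.RightOf l' l :=
  ⟨M.py v, by rw [F'.src_left]; exact hlt.le, by rw [hl]; exact F.lt_left.le, by rw [F.src_left],
    F.lt_left.le, by
      rw [F.fn_left]
      exact F'.lt_of_nested_left F hl hr (by rintro rfl; exact lt_irrefl _ hlt) hlt.le⟩

/-- Up to the outer apex the parity is even. Up to the inner apex the inner legs cancel, and the
outer legs decide. Above it, `l` is compared with `l'` and `r` with `r'`: each pair has a common
upper end and stops counting at the same height. One of the pairs disagrees at `c`, so `c` lies
between its two arcs. -/
theorem inLens_of_oddParity (F' : M.IsFork C w l' r') (F : M.IsFork C v l r)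
    (hl : M.tgt l' = M.tgt l) (hr : M.tgt r' = M.tgt r) (hlt : M.py w < M.py v) {c : V}
    (ol : M.Off c l) (or' : M.Off c r')
    (hodd : M.OddParity P Q l r l' r' c) : M.InLens l' r' l r c := by
  have ka := F.lt_left
  have kb := F.lt_right
  have sl := F.src_left
  have sr := F.src_right
  have sl' := F'.src_left
  have sr' := F'.src_right
  have two : ∀ i, (M.Hit P Q i (M.px c) (M.py c) → M.py (M.src i) ≤ M.py c ∧
      M.py c ≤ M.py (M.tgt i)) := by
    rintro i hi
    constructor
    · by_contra hc; exact not_hit_of_lt_src (not_le.1 hc) hi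
    · by_contra hc; exact not_hit_of_tgt_lt (not_le.1 hc) hi
  have hw : M.py w < M.py c := by
    by_contra hc
    push Not at hc
    have n1 : ¬ M.Hit P Q l (M.px c) (M.py c) := not_hit_of_lt_src (by rw [sl]; linarith)
    have n2 : ¬ M.Hit P Q r (M.px c) (M.py c) := not_hit_of_lt_src (by rw [sr]; linarith)
    refine hodd (iff_of_true (iff_of_false n1 n2) ?_)
    rcases eq_or_lt_of_le hc with e | e
    · have e1 := hit_src_iff (M := M) (P := P) (Q := Q) (i := l') (x := M.px c)
      have e2 := hit_src_iff (M := M) (P := P) (Q := Q) (i := r') (x := M.px c)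
      rw [sl', ← e] at e1
      rw [sr', ← e] at e2
      exact e1.trans e2.symm
    · exact iff_of_false (not_hit_of_lt_src (by rw [sl']; exact e))
        (not_hit_of_lt_src (by rw [sr']; exact e))
  -- the position with respect to the legs of the outer fork
  have outer : M.py c < M.py (M.tgt l) → M.py c < M.py (M.tgt r) →
      ¬ (M.Hit P Q l' (M.px c) (M.py c) ↔ M.Hit P Q r' (M.px c) (M.py c)) →
      M.fn l' (M.py c) < M.px c ∧ M.px c < M.fn r' (M.py c) := by
    intro h1 h2 h3
    rw [hit_of_lt (by rw [sl']; exact hw) (by rw [hl]; exact h1),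
      hit_of_lt (by rw [sr']; exact hw) (by rw [hr]; exact h2)] at h3
    have := F'.fn_lt hw (by rw [hl]; exact h1.le) (by rw [hr]; exact h2.le)
    have hne : M.px c ≠ M.fn r' (M.py c) := fun e =>
      or' ⟨by rw [sr']; exact hw.le, by rw [hr]; exact h2.le, e⟩
    by_cases h4 : M.fn r' (M.py c) < M.px c
    · exact absurd (iff_of_true (by linarith) h4) h3
    · have h5 : M.fn l' (M.py c) < M.px c := by
        by_contra h5; exact h3 (iff_of_false h5 h4)
      exact ⟨h5, lt_of_le_of_ne (not_lt.1 h4) hne⟩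
  refine ⟨by rw [sl']; exact hw, ?_⟩
  rw [sl]
  rcases lt_trichotomy (M.py c) (M.py v) with hv | hv | hv
  · have n1 : ¬ M.Hit P Q l (M.px c) (M.py c) := not_hit_of_lt_src (by rw [sl]; linarith)
    have n2 : ¬ M.Hit P Q r (M.px c) (M.py c) := not_hit_of_lt_src (by rw [sr]; linarith)
    exact Or.inl ⟨hv, outer (by linarith) (by linarith) fun e =>
      hodd (iff_of_true (iff_of_false n1 n2) e)⟩
  · have e1 := hit_src_iff (M := M) (P := P) (Q := Q) (i := l) (x := M.px c)
    have e2 := hit_src_iff (M := M) (P := P) (Q := Q) (i := r) (x := M.px c)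
    rw [sl, ← hv] at e1
    rw [sr, ← hv] at e2
    obtain ⟨o1, o2⟩ := outer (by linarith) (by linarith) fun e =>
      hodd (iff_of_true (e1.trans e2.symm) e)
    have f1 : M.fn l (M.py c) = M.px v := by rw [hv, F.fn_left]
    have f2 : M.fn r (M.py c) = M.px v := by rw [hv, F.fn_right]
    have hne : M.px c ≠ M.px v := fun e => ol ⟨by rw [sl, hv], by linarith, by rw [f1, e]⟩
    rcases lt_or_gt_of_ne hne with h1 | h1
    · exact Or.inr (Or.inl ⟨hv.ge, by linarith, o1, by rw [f1]; exact h1⟩)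
    · exact Or.inr (Or.inr ⟨hv.ge, by linarith, by rw [f2]; exact h1, o2⟩)
  · -- the left legs and the right legs each form a pair with common target
    have hR := F'.rightOf_nested F hl hr hlt
    by_cases hL : M.Hit P Q l (M.px c) (M.py c) ↔ M.Hit P Q l' (M.px c) (M.py c)
    · have hN : ¬ (M.Hit P Q r (M.px c) (M.py c) ↔ M.Hit P Q r' (M.px c) (M.py c)) := by
        intro hr2; apply hodd; rw [hL, hr2]
      have hb : M.py c < M.py (M.tgt r) := by
        by_contra hb
        push Not at hb
        rcases eq_or_lt_of_le hb with e | e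
        · have e1 := hit_tgt_iff (M := M) (P := P) (Q := Q) (i := r) (x := M.px c)
          have e2 := hit_tgt_iff (M := M) (P := P) (Q := Q) (i := r') (x := M.px c)
          rw [e] at e1
          rw [hr, e] at e2
          exact hN (e1.trans e2.symm)
        · exact hN (iff_of_false (not_hit_of_tgt_lt e) (not_hit_of_tgt_lt (by rw [hr]; exact e)))
      rw [hit_of_lt (by rw [sr]; exact hv) hb, hit_of_lt (by rw [sr']; exact hw)
        (by rw [hr]; exact hb)] at hN
      have hlt' := neg_lt_neg_iff.1 <| (F'.flipX.rightOf_nested F.flipX hr hl hlt).fn_lt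
        (t := M.py c) (by rw [F'.flipX.src_left]; exact hw.le) (by
          change M.py c ≤ M.py (M.tgt r'); rw [hr]; exact hb.le)
        (by rw [F.flipX.src_left]; exact hv.le) hb.le
        (Or.inr ⟨by rw [F.flipX.src_left]; exact hv, hb⟩)
      have hne : M.px c ≠ M.fn r' (M.py c) := fun e =>
        or' ⟨by rw [sr']; exact hw.le, by rw [hr]; exact hb.le, e⟩
      refine Or.inr (Or.inr ⟨hv.le, hb, ?_⟩)
      by_cases h4 : M.fn r' (M.py c) < M.px c
      · exact absurd (iff_of_true (by linarith) h4) hN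
      · have h5 : M.fn r (M.py c) < M.px c := by
          by_contra h5; exact hN (iff_of_false h5 h4)
        exact ⟨h5, lt_of_le_of_ne (not_lt.1 h4) hne⟩
    · have hb : M.py c < M.py (M.tgt l) := by
        by_contra hb
        push Not at hb
        rcases eq_or_lt_of_le hb with e | e
        · have e1 := hit_tgt_iff (M := M) (P := P) (Q := Q) (i := l) (x := M.px c)
          have e2 := hit_tgt_iff (M := M) (P := P) (Q := Q) (i := l') (x := M.px c)
          rw [e] at e1
          rw [hl, e] at e2
          exact hL (e1.trans e2.symm)
        · exact hL (iff_of_false (not_hit_of_tgt_lt e) (not_hit_of_tgt_lt (by rw [hl]; exact e)))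
      rw [hit_of_lt (by rw [sl]; exact hv) hb, hit_of_lt (by rw [sl']; exact hw)
        (by rw [hl]; exact hb)] at hL
      have hlt' := hR.fn_lt (t := M.py c) (by rw [sl']; exact hw.le) (by rw [hl]; exact hb.le)
        (by rw [sl]; exact hv.le) hb.le (Or.inr ⟨by rw [sl]; exact hv, hb⟩)
      have hne : M.px c ≠ M.fn l (M.py c) := fun e => ol ⟨by rw [sl]; exact hv.le, hb.le, e⟩
      refine Or.inr (Or.inl ⟨hv.le, hb, ?_⟩)
      by_cases h4 : M.fn l (M.py c) < M.px c
      · exact absurd (iff_of_true h4 (by linarith)) hL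
      · have h5 : M.fn l' (M.py c) < M.px c := by
          by_contra h5; exact hL (iff_of_false h4 h5)
        exact ⟨h5, lt_of_le_of_ne (not_lt.1 h4) hne⟩

/-- The start of a fork nested strictly between two others satisfies the even-odd condition. -/
theorem oddParity_of_between {g : V} {l'' r'' : ι} (F' : M.IsFork C w l' r')
    (F : M.IsFork C v l r) (F'' : M.IsFork C g l'' r'')
    (hl'' : M.tgt l' = M.tgt l'') (hr'' : M.tgt r' = M.tgt r'')
    (h1 : M.py w < M.py g) (h2 : M.py g < M.py v) : M.OddParity P Q l r l' r' g := by
  have hne : g ≠ w := by rintro rfl; exact lt_irrefl _ h1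
  have e1 := F'.lt_of_nested_left F'' hl'' hr'' hne h1.le
  have e2 := F'.lt_of_nested_right F'' hl'' hr'' hne h1.le
  intro hc
  have n := hc.1 (iff_of_false (not_hit_of_lt_src (by rw [F.src_left]; exact h2))
    (not_hit_of_lt_src (by rw [F.src_right]; exact h2)))
  rw [hit_of_lt (by rw [F'.src_left]; exact h1) (by rw [hl'']; exact F''.lt_left),
    hit_of_lt (by rw [F'.src_right]; exact h1) (by rw [hr'']; exact F''.lt_right)] at n
  linarith [n.1 e1]

theorem off_of_ne (F : M.IsFork C v l r) {g : V} (hg : g ∉ C) (hne : g ≠ v) :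
    M.Off g l ∧ M.Off g r := by
  constructor
  · rintro ⟨h1, h2, h3⟩
    rcases M.avoid l g h1 h2 h3.symm with e | e
    · exact hne (e.trans F.src_left)
    · exact hg (e ▸ F.left_mem)
  · rintro ⟨h1, h2, h3⟩
    rcases M.avoid r g h1 h2 h3.symm with e | e
    · exact hne (e.trans F.src_right)
    · exact hg (e ▸ F.right_mem)

/-- This and `inLens_mono_inner` carry a vertex of `C` between neighbouring forks over to forks that
are farther apart. -/
theorem inLens_mono_outer {g : V} {l'' r'' : ι} (F' : M.IsFork C w l' r')
    (F : M.IsFork C v l r) (G : M.IsFork C g l'' r'') (hl : M.tgt l' = M.tgt l)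
    (hr : M.tgt r' = M.tgt r) (hl'' : M.tgt l'' = M.tgt l') (hr'' : M.tgt r'' = M.tgt r')
    (hgw : M.py g < M.py w) {c : V} (hc : M.InLens l' r' l r c) :
    M.InLens l'' r'' l r c := by
  have ka := F.lt_left
  have kb := F.lt_right
  obtain ⟨h0, h1⟩ := hc
  rw [F'.src_left] at h0
  have eL : M.py c < M.py (M.tgt l) → M.fn l'' (M.py c) < M.fn l' (M.py c) := fun h =>
    (G.rightOf_nested F' hl'' hr'' hgw).fn_lt (by rw [G.src_left]; linarith)
      (by rw [hl'', hl]; exact h.le) (by rw [F'.src_left]; exact h0.le) (by rw [hl]; exact h.le)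
      (Or.inr ⟨by rw [F'.src_left]; exact h0, by rw [hl]; exact h⟩)
  have eR : M.py c < M.py (M.tgt r) → M.fn r' (M.py c) < M.fn r'' (M.py c) := fun h =>
    neg_lt_neg_iff.1 <| (G.flipX.rightOf_nested F'.flipX hr'' hl'' hgw).fn_lt
      (t := M.py c) (by rw [G.flipX.src_left]; exact (hgw.trans h0).le)
      (by change M.py c ≤ M.py (M.tgt r''); rw [hr'', hr]; exact h.le)
      (by rw [F'.flipX.src_left]; exact h0.le)
      (by change M.py c ≤ M.py (M.tgt r'); rw [hr]; exact h.le)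
      (Or.inr ⟨by rw [F'.flipX.src_left]; exact h0,
        by change M.py c < M.py (M.tgt r'); rw [hr]; exact h⟩)
  refine ⟨by rw [G.src_left]; linarith, ?_⟩
  rw [F.src_left] at *
  rcases h1 with ⟨k1, k2, k3⟩ | ⟨k1, k2, k3, k4⟩ | ⟨k1, k2, k3, k4⟩
  · have := eL (by linarith)
    have := eR (by linarith)
    exact Or.inl ⟨k1, by linarith, by linarith⟩
  · have := eL k2
    exact Or.inr (Or.inl ⟨k1, k2, by linarith, k4⟩)
  · have := eR k2
    exact Or.inr (Or.inr ⟨k1, k2, k3, by linarith⟩)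

/-- A point beside the middle fork but below the innermost apex changes its case: it now counts as
lying between the two outer legs below the inner fork. -/
theorem inLens_mono_inner {g : V} {l'' r'' : ι} (F' : M.IsFork C w l' r')
    (F : M.IsFork C v l r) (G : M.IsFork C g l'' r'') (hl : M.tgt l' = M.tgt l)
    (hr : M.tgt r' = M.tgt r) (hl'' : M.tgt l = M.tgt l'') (hr'' : M.tgt r = M.tgt r'')
    (hwv : M.py w < M.py v) (hvg : M.py v < M.py g) {c : V} (hc : M.InLens l' r' l r c) :
    M.InLens l' r' l'' r'' c := by
  have ka := G.lt_left
  have kb := G.lt_right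
  obtain ⟨h0, h1⟩ := hc
  rw [F'.src_left] at h0
  refine ⟨by rw [F'.src_left]; exact h0, ?_⟩
  rw [F.src_left] at h1
  rw [G.src_left]
  have eL : M.py g ≤ M.py c → M.py c < M.py (M.tgt l) → M.fn l (M.py c) < M.fn l'' (M.py c) :=
    fun h' h => (F.rightOf_nested G hl'' hr'' hvg).fn_lt (by rw [F.src_left]; linarith) h.le
      (by rw [G.src_left]; exact h') (by rw [← hl'']; exact h.le)
      (Or.inl ⟨by rw [F.src_left]; linarith, h⟩)
  have eR : M.py g ≤ M.py c → M.py c < M.py (M.tgt r) → M.fn r'' (M.py c) < M.fn r (M.py c) :=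
    fun h' h => neg_lt_neg_iff.1 <| (F.flipX.rightOf_nested G.flipX hr'' hl'' hvg).fn_lt
      (t := M.py c) (by rw [F.flipX.src_left]; exact (hvg.trans_le h').le) h.le
      (by rw [G.flipX.src_left]; exact h')
      (by change M.py c ≤ M.py (M.tgt r''); rw [← hr'']; exact h.le)
      (Or.inl ⟨by rw [F.flipX.src_left]; exact hvg.trans_le h', h⟩)
  -- below the start of the innermost fork, the middle fork lies inside the outer one
  have oL : M.py v ≤ M.py c → M.py c < M.py g → M.fn l' (M.py c) < M.fn l (M.py c) := fun h' h =>
    (F'.rightOf_nested F hl hr hwv).fn_lt (by rw [F'.src_left]; linarith)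
      (by rw [hl, hl'']; linarith) (by rw [F.src_left]; linarith) (by rw [hl'']; linarith)
      (Or.inl ⟨by rw [F'.src_left]; linarith, by rw [hl, hl'']; linarith⟩)
  have oR : M.py v ≤ M.py c → M.py c < M.py g → M.fn r (M.py c) < M.fn r' (M.py c) := fun h' h =>
    neg_lt_neg_iff.1 <| (F'.flipX.rightOf_nested F.flipX hr hl hwv).fn_lt (t := M.py c)
      (by rw [F'.flipX.src_left]; exact h0.le)
      (by change M.py c ≤ M.py (M.tgt r'); rw [hr, hr'']; linarith)
      (by rw [F.flipX.src_left]; exact h')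
      (by change M.py c ≤ M.py (M.tgt r); rw [hr'']; linarith)
      (Or.inl ⟨by rw [F'.flipX.src_left]; exact h0,
        by change M.py c < M.py (M.tgt r'); rw [hr, hr'']; linarith⟩)
  have mid : M.py v ≤ M.py c → M.py c < M.py g → M.fn l (M.py c) ≤ M.fn r (M.py c) := by
    intro h' h
    rcases eq_or_lt_of_le h' with e | e
    · rw [← e, F.fn_left, F.fn_right]
    · exact (F.fn_lt e (by rw [hl'']; linarith) (by rw [hr'']; linarith)).le
  rcases h1 with ⟨k1, k2, k3⟩ | ⟨k1, k2, k3, k4⟩ | ⟨k1, k2, k3, k4⟩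
  · exact Or.inl ⟨by linarith, k2, k3⟩
  · rcases lt_or_ge (M.py c) (M.py g) with e | e
    · have := oR k1 e
      have := mid k1 e
      exact Or.inl ⟨e, k3, by linarith⟩
    · have := eL e k2
      exact Or.inr (Or.inl ⟨e, by rw [← hl'']; exact k2, k3, by linarith⟩)
  · rcases lt_or_ge (M.py c) (M.py g) with e | e
    · have := oL k1 e
      have := mid k1 e
      exact Or.inl ⟨e, by linarith, k4⟩
    · have := eR e k2
      exact Or.inr (Or.inr ⟨e, by rw [← hr'']; exact k2, by linarith, k4⟩)

/-- Forks are few if nested forks with the same ends have a point of `C` between them. -/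
theorem ncard_le_of_forall [Finite V] {H : Set V} (hF : ∀ h ∈ H, ∃ l r, M.IsFork C h l r)
    (hlens : ∀ h' ∈ H, ∀ h ∈ H, ∀ l' r' l r, M.IsFork C h' l' r' → M.IsFork C h l r →
      M.tgt l' = M.tgt l → M.tgt r' = M.tgt r → M.py h' < M.py h →
      ∃ c ∈ C, M.InLens l' r' l r c) : H.ncard ≤ 8 * C.ncard := by
  rcases isEmpty_or_nonempty ι with hι | hι
  · have : H = ∅ := Set.eq_empty_of_forall_notMem fun h hh =>
      let ⟨i, _⟩ := hF h hh
      hι.elim i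
    simp [this]
  choose! l r hlr using hF
  exact ncard_le hlr fun h' hh' h hh => hlens h' hh' h hh _ _ _ _ (hlr h' hh') (hlr h hh)

end IsFork

end ArcSystem

/-- Equivalence is the negation of exclusive or, so the nested equivalences express the sum of the
four bits modulo 2. -/
theorem odd_ncard_sep_four {α : Type*} {a b c d : α} (hab : a ≠ b) (hac : a ≠ c) (had : a ≠ d)
    (hbc : b ≠ c) (hbd : b ≠ d) (hcd : c ≠ d) (p : α → Prop) :
    Odd {x ∈ ({a, b, c, d} : Set α) | p x}.ncard ↔ ¬ ((p a ↔ p b) ↔ (p c ↔ p d)) := by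
  classical
  have : {x ∈ ({a, b, c, d} : Set α) | p x} = ↑(({a, b, c, d} : Finset α).filter p) := by
    ext; simp
  rw [this, Set.ncard_coe_finset, Finset.card_filter,
    Finset.sum_insert (by simp [hab, hac, had]), Finset.sum_insert (by simp [hbc, hbd]),
    Finset.sum_insert (by simp [hcd]), Finset.sum_singleton]
  by_cases h1 : p a <;> by_cases h2 : p b <;> by_cases h3 : p c <;> by_cases h4 : p d <;>
    simp only [h1, h2, h3, h4, if_true, if_false] <;> decide

/-! ### Ears as forks, treated for bottom and top ears at once -/

namespace LevelGraph.Drawing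

variable {V : Type*} {G : LevelGraph V} {Γ : G.Drawing}

/-- The leg of `h` to the end `f` passes to the left or right of the end `n`. -/
def FarSide (M : ArcSystem V Γ.edgeArcs) (left : Bool) (h f n : V) : Prop :=
  ∃ i, M.src i = h ∧ M.tgt i = f ∧
    if left then M.fn i (M.py n) < M.px n else M.px n < M.fn i (M.py n)

/-- A description of the ears in `B` (all bottom ears, or all top ears) as forks in the arc system
`M`. For ends at different levels, `far a b` and `near a b` are the end that is farther from and the
end that is nearer to the ears. -/
structure EarModel (C : Finset V) (M : ArcSystem V Γ.edgeArcs) (B : Set V) (far near : V → V → V)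
    (flat : Bool) (P Q : Prop) : Prop where
  ear : ∀ h ∈ B, G.IsEar C h
  arc : ∀ h ∈ B, ∀ c ∈ G.nbrs h, ∃ i, M.src i = h ∧ M.tgt i = c
  nbr : ∀ h ∈ B, ∀ i : Γ.edgeArcs, i.1.Incident h → M.src i = h ∧ M.tgt i ∈ G.nbrs h
  incident : ∀ i : Γ.edgeArcs, i.1.Incident (M.src i)
  simple : ∀ i j, M.src i = M.src j → M.tgt i = M.tgt j → i = j
  far_near : ∀ a b, (far a b = a ∧ near a b = b) ∨ (far a b = b ∧ near a b = a)
  py_near : ∀ a b, G.level b < G.level a → M.py (near a b) < M.py (far a b)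
  px_eq : ∀ v, M.px v = Γ.x v
  py_eq : ∀ v w, G.level v = G.level w → M.py v = M.py w
  -- `flat` is the side that is assigned by convention when the two ends have equal levels.
  side_iff : ∀ h ∈ B, ∀ left a b, h ∈ Γ.sideEars C left a b ↔ G.IsEarOf C a b h ∧
    ((G.level b < G.level a ∧ FarSide M left h (far a b) (near a b)) ∨
      (G.level b = G.level a ∧ left = flat))
  side_mem : ∀ h ∈ B, ∀ left a b w, h ∈ Γ.sideEars C left a b → w ∈ Γ.sideEars C left a b → w ∈ B
  outer : ∀ h ∈ B, ∀ left a b, h ∈ Γ.sideEars C left a b →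
    (G.level a < G.level h → ∀ w ∈ Γ.sideEars C left a b, G.level w ≤ G.level h) →
    (G.level h < G.level b → ∀ w ∈ Γ.sideEars C left a b, G.level h ≤ G.level w) →
    ∀ w ∈ Γ.sideEars C left a b, M.py h ≤ M.py w
  inner : ∀ h ∈ B, ∀ left a b, h ∈ Γ.sideEars C left a b →
    (G.level a < G.level h → ∀ w ∈ Γ.sideEars C left a b, G.level h ≤ G.level w) →
    (G.level h < G.level b → ∀ w ∈ Γ.sideEars C left a b, G.level w ≤ G.level h) →
    ∀ w ∈ Γ.sideEars C left a b, M.py w ≤ M.py h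
  -- `P` and `Q` tell whether an arc counts at the height of its source and of its target in `M`. A
  -- reflection exchanges the two.
  hit_iff : ∀ (i : Γ.edgeArcs) u, (G.level i.1.src ≤ G.level u ∧ G.level u < G.level i.1.tgt ∧
    PassesLeftOf i.1.pts (Γ.pos u)) ↔ M.Hit P Q i (M.px u) (M.py u)
  mem_iff : ∀ (i : Γ.edgeArcs) u, Γ.pos u ∈ i.1.pts ↔ ¬ M.Off u i

namespace EarModel

variable {C : Finset V} {M : ArcSystem V Γ.edgeArcs} {B : Set V} {far near : V → V → V}
  {flat : Bool} {P Q : Prop}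

theorem exists_fork [Finite V] (E : EarModel C M B far near flat P Q) (hC : G.IsVertexCover C)
    {h : V} (hh : h ∈ B) : ∃ l r, M.IsFork C h l r := by
  obtain ⟨hhC, hcard, -⟩ := E.ear h hh
  obtain ⟨a, b, hab, hn⟩ := Set.ncard_eq_two.1 hcard
  obtain ⟨i, hi, hia⟩ := E.arc h hh a (by rw [hn]; simp)
  obtain ⟨j, hj, hjb⟩ := E.arc h hh b (by rw [hn]; simp)
  have hnC : ∀ c ∈ G.nbrs h, c ∈ C := by
    rintro c (hc | hc)
    · exact (hC _ _ hc).resolve_right hhC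
    · exact (hC _ _ hc).resolve_left hhC
  have ha := hnC a (by rw [hn]; simp)
  have hb := hnC b (by rw [hn]; simp)
  have hij : i ≠ j := by rintro rfl; exact hab (hia.symm.trans hjb)
  rcases ArcSystem.rightOf_or_of_src_eq hij (hi.trans hj.symm) with hR | hR
  · exact ⟨i, j, hi, hj, hhC, hia ▸ ha, hjb ▸ hb, by rw [hia, hjb]; exact hab, hR⟩
  · exact ⟨j, i, hj, hi, hhC, hjb ▸ hb, hia ▸ ha, by rw [hia, hjb]; exact hab.symm, hR⟩

theorem nbrs_eq (E : EarModel C M B far near flat P Q) {h : V} (hh : h ∈ B) {l r : Γ.edgeArcs}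
    (F : M.IsFork C h l r) : G.nbrs h = {M.tgt l, M.tgt r} := by
  have hl := (E.nbr h hh l (F.src_left ▸ E.incident l)).2
  have hr := (E.nbr h hh r (F.src_right ▸ E.incident r)).2
  have hcard := (E.ear h hh).2.1
  symm
  refine Set.eq_of_subset_of_ncard_le ?_ ?_ (Set.finite_of_ncard_ne_zero (by omega))
  · rintro c (rfl | rfl)
    · exact hl
    · exact hr
  · rw [hcard, Set.ncard_pair F.tgt_ne]

theorem eq_leg (E : EarModel C M B far near flat P Q) {h : V} (hh : h ∈ B) {l r i : Γ.edgeArcs}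
    (F : M.IsFork C h l r) (hi : i.1.Incident h) : i = l ∨ i = r := by
  obtain ⟨h1, h2⟩ := E.nbr h hh i hi
  rw [E.nbrs_eq hh F] at h2
  rcases h2 with h2 | h2
  · exact Or.inl (E.simple _ _ (h1.trans F.src_left.symm) h2)
  · exact Or.inr (E.simple _ _ (h1.trans F.src_right.symm) h2)

/-- The ends of the left and the right leg of an ear of the pair `a`, `b`. -/
theorem ends_of_mem_side (E : EarModel C M B far near flat P Q) {h : V} (hh : h ∈ B)
    {l r : Γ.edgeArcs} (F : M.IsFork C h l r) {left : Bool} {a b : V}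
    (hs : h ∈ Γ.sideEars C left a b) :
    (G.level b < G.level a ∧ ((left = true ∧ M.tgt l = far a b ∧ M.tgt r = near a b) ∨
      (left = false ∧ M.tgt l = near a b ∧ M.tgt r = far a b))) ∨
    (G.level b = G.level a ∧ left = flat ∧ Γ.x (M.tgt l) < Γ.x (M.tgt r)) := by
  obtain ⟨⟨he, hn, hab⟩, h1⟩ := (E.side_iff h hh left a b).1 hs
  have hset := hn.symm.trans (E.nbrs_eq hh F)
  have hab' : a ≠ b := by
    rintro rfl
    have := he.2.1
    rw [hn, Set.pair_eq_singleton, Set.ncard_singleton] at this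
    omega
  have hcases : (M.tgt l = a ∧ M.tgt r = b) ∨ (M.tgt l = b ∧ M.tgt r = a) := by
    have e1 : a ∈ ({M.tgt l, M.tgt r} : Set V) := hset ▸ by simp
    have e2 : b ∈ ({M.tgt l, M.tgt r} : Set V) := hset ▸ by simp
    rcases e1 with e1 | e1 <;> rcases e2 with e2 | e2
    · exact absurd (e1.trans e2.symm) hab'
    · exact Or.inl ⟨e1.symm, e2.symm⟩
    · exact Or.inr ⟨e2.symm, e1.symm⟩
    · exact absurd (e1.trans e2.symm) hab'
  rcases h1 with ⟨hlt, i, hi, hif, hpass⟩ | ⟨heq, hflat⟩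
  · refine Or.inl ⟨hlt, ?_⟩
    have hpy := E.py_near a b hlt
    have hcases' : (M.tgt l = far a b ∧ M.tgt r = near a b) ∨
        (M.tgt l = near a b ∧ M.tgt r = far a b) := by
      rcases E.far_near a b with ⟨e1, e2⟩ | ⟨e1, e2⟩ <;> rw [e1, e2]
      · exact hcases
      · exact hcases.symm
    -- At the height of the near end, the leg to the near end has arrived there and the other leg is
    -- beside it. So the leg to the far end passes on the left exactly if it is the left leg.
    rcases hcases' with ⟨e1, e2⟩ | ⟨e1, e2⟩
    · obtain rfl : i = l := E.simple _ _ (hi.trans F.src_left.symm) (hif.trans e1.symm)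
      have hn : M.py h < M.py (near a b) := e2 ▸ F.lt_right
      have := F.fn_lt hn (by rw [e1]; exact hpy.le) (by rw [e2])
      have e3 := M.fn_tgt r
      rw [e2] at e3
      cases left
      · simp only [Bool.false_eq_true, if_false] at hpass
        linarith
      · exact Or.inl ⟨rfl, e1, e2⟩
    · obtain rfl : i = r := E.simple _ _ (hi.trans F.src_right.symm) (hif.trans e2.symm)
      have hn : M.py h < M.py (near a b) := e1 ▸ F.lt_left
      have := F.fn_lt hn (by rw [e1]) (by rw [e2]; exact hpy.le)
      have e3 := M.fn_tgt l
      rw [e1] at e3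
      cases left
      · exact Or.inr ⟨rfl, e1, e2⟩
      · simp only [if_true] at hpass
        linarith
  · refine Or.inr ⟨heq, hflat, ?_⟩
    have hpy : M.py (M.tgt l) = M.py (M.tgt r) := by
      rcases hcases with ⟨e1, e2⟩ | ⟨e1, e2⟩ <;> rw [e1, e2]
      · exact E.py_eq _ _ heq.symm
      · exact E.py_eq _ _ heq
    have := F.fn_lt F.lt_left le_rfl hpy.le
    rw [M.fn_tgt, hpy, M.fn_tgt, E.px_eq, E.px_eq] at this
    exact this

/-- The side fixes which neighbour belongs to the left leg. The ears of one pair and side are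
therefore forks with the same ends, nested by height. `mem_side_of_ends` is the converse. -/
theorem ends_eq (E : EarModel C M B far near flat P Q) {h h' : V} (hh : h ∈ B) (hh' : h' ∈ B)
    {l r l' r' : Γ.edgeArcs} (F : M.IsFork C h l r) (F' : M.IsFork C h' l' r') {left : Bool}
    {a b : V} (hs : h ∈ Γ.sideEars C left a b) (hs' : h' ∈ Γ.sideEars C left a b) :
    M.tgt l' = M.tgt l ∧ M.tgt r' = M.tgt r := by
  have hn := ((E.side_iff h hh left a b).1 hs).1.2.1.symm.trans (E.nbrs_eq hh F)
  have hn' := ((E.side_iff h' hh' left a b).1 hs').1.2.1.symm.trans (E.nbrs_eq hh' F')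
  rcases E.ends_of_mem_side hh F hs with ⟨h1, h2⟩ | ⟨h1, h2, h3⟩ <;>
    rcases E.ends_of_mem_side hh' F' hs' with ⟨k1, k2⟩ | ⟨k1, k2, k3⟩
  · rcases h2 with ⟨rfl, e1, e2⟩ | ⟨rfl, e1, e2⟩ <;> rcases k2 with ⟨d0, d1, d2⟩ | ⟨d0, d1, d2⟩ <;>
      first | (cases d0; done) | exact ⟨d1.trans e1.symm, d2.trans e2.symm⟩
  · linarith
  · linarith
  · have e : ({M.tgt l', M.tgt r'} : Set V) = {M.tgt l, M.tgt r} := hn'.symm.trans hn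
    have e1 : M.tgt l' ∈ ({M.tgt l, M.tgt r} : Set V) := e ▸ by simp
    have e2 : M.tgt r' ∈ ({M.tgt l, M.tgt r} : Set V) := e ▸ by simp
    rcases e1 with e1 | e1 <;> rcases e2 with e2 | e2
    · exact absurd (e1.trans e2.symm) F'.tgt_ne
    · exact ⟨e1, e2⟩
    · rw [e1, e2] at k3
      exact absurd k3 (lt_asymm h3)
    · exact absurd (e1.trans e2.symm) F'.tgt_ne

theorem mem_side_of_ends (E : EarModel C M B far near flat P Q) {h h' : V} (hh : h ∈ B)
    (hh' : h' ∈ B) {l r l' r' : Γ.edgeArcs} (F : M.IsFork C h l r) (F' : M.IsFork C h' l' r')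
    (hl : M.tgt l' = M.tgt l) (hr : M.tgt r' = M.tgt r) {left : Bool} {a b : V}
    (hs : h ∈ Γ.sideEars C left a b) : h' ∈ Γ.sideEars C left a b := by
  obtain ⟨⟨he, hn, hab⟩, -⟩ := (E.side_iff h hh left a b).1 hs
  refine (E.side_iff h' hh' left a b).2 ⟨⟨E.ear h' hh', ?_, hab⟩, ?_⟩
  · rw [E.nbrs_eq hh' F', hl, hr, ← E.nbrs_eq hh F, hn]
  · rcases E.ends_of_mem_side hh F hs with ⟨h1, h2⟩ | ⟨h1, h2, -⟩
    · refine Or.inl ⟨h1, ?_⟩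
      have hpy := E.py_near a b h1
      rcases h2 with ⟨rfl, e1, e2⟩ | ⟨rfl, e1, e2⟩
      · refine ⟨l', F'.src_left, hl.trans e1, ?_⟩
        have k1 := F'.lt_right
        rw [hr, e2] at k1
        have := F'.fn_lt k1 (by rw [hl, e1]; exact hpy.le) (by rw [hr, e2])
        have e3 := M.fn_tgt r'
        rw [hr, e2] at e3
        simpa [e3] using this
      · refine ⟨r', F'.src_right, hr.trans e2, ?_⟩
        have k1 := F'.lt_left
        rw [hl, e1] at k1
        have := F'.fn_lt k1 (by rw [hl, e1]) (by rw [hr, e2]; exact hpy.le)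
        have e3 := M.fn_tgt l'
        rw [hl, e1] at e3
        simpa [e3] using this
    · exact Or.inr ⟨h1, h2⟩

/-- An ear has no edges besides its two legs, so the 4-cycle consists of four distinct arcs. -/
theorem encloses_iff (E : EarModel C M B far near flat P Q) {v w : V} (hv : v ∈ B) (hw : w ∈ B)
    (hvw : v ≠ w) {l r l' r' : Γ.edgeArcs} (F : M.IsFork C v l r) (F' : M.IsFork C w l' r') {u : V} :
    Γ.Encloses (Γ.arcsAt {v, w}) (Γ.pos u) ↔
      (M.Off u l ∧ M.Off u r ∧ M.Off u l' ∧ M.Off u r') ∧ M.OddParity P Q l r l' r' u := by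
  have hK : Γ.arcsAt {v, w} = {l.1, r.1, l'.1, r'.1} := by
    ext A
    constructor
    · rintro ⟨hA, x, rfl | rfl, hx⟩
      · rcases E.eq_leg (i := ⟨A, hA⟩) hv F hx with e | e
        · simp [← e]
        · simp [← e]
      · rcases E.eq_leg (i := ⟨A, hA⟩) hw F' hx with e | e
        · simp [← e]
        · simp [← e]
    · rintro (rfl | rfl | rfl | rfl)
      · exact ⟨l.2, v, by simp, F.src_left ▸ E.incident l⟩
      · exact ⟨r.2, v, by simp, F.src_right ▸ E.incident r⟩
      · exact ⟨l'.2, w, by simp, F'.src_left ▸ E.incident l'⟩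
      · exact ⟨r'.2, w, by simp, F'.src_right ▸ E.incident r'⟩
  have d1 : l ≠ r := fun e => F.tgt_ne (by rw [e])
  have d2 : l' ≠ r' := fun e => F'.tgt_ne (by rw [e])
  have d3 : ∀ i j : Γ.edgeArcs, M.src i = v → M.src j = w → i ≠ j := by
    rintro i j h1 h2 rfl
    exact hvw (h1.symm.trans h2)
  have sub : ∀ {i j : Γ.edgeArcs}, i ≠ j → i.1 ≠ j.1 := fun h e => h (Subtype.ext e)
  have s1 := F.src_left
  have s2 := F.src_right
  have s3 := F'.src_left
  have s4 := F'.src_right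
  rw [Encloses, hK, odd_ncard_sep_four (sub d1) (sub (d3 l l' s1 s3)) (sub (d3 l r' s1 s4))
    (sub (d3 r l' s2 s3)) (sub (d3 r r' s2 s4)) (sub d2)]
  refine and_congr ?_ (not_congr (iff_congr (iff_congr (E.hit_iff l u) (E.hit_iff r u))
    (iff_congr (E.hit_iff l' u) (E.hit_iff r' u))))
  simp only [Set.mem_insert_iff, Set.mem_singleton_iff, forall_eq_or_imp, forall_eq, E.mem_iff,
    not_not]

/-- In the model an outermost ear is a lowest fork of its pair and side. Two of them with the same
ends cannot start at different heights, so the lens condition holds vacuously. -/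
theorem ncard_outermost_le [Finite V] (E : EarModel C M B far near flat P Q)
    (hC : G.IsVertexCover C) : {v | v ∈ B ∧ Γ.IsOutermost C v}.ncard ≤ 8 * C.card := by
  rw [← Set.ncard_coe_finset C]
  refine ArcSystem.IsFork.ncard_le_of_forall (M := M) (fun h hh => E.exists_fork hC hh.1) ?_
  rintro h' ⟨hh', left', a', b', hs', o1', o2'⟩ h ⟨hh, left, a, b, hs, o1, o2⟩ l' r' l r F' F hl hr
    hlt
  have := E.outer h hh left a b hs o1 o2 h' (E.mem_side_of_ends hh hh' F F' hl hr hs)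
  exact absurd this (not_le.2 hlt)

/-- As for outermost ears, with highest forks in place of lowest ones. -/
theorem ncard_innermost_le [Finite V] (E : EarModel C M B far near flat P Q)
    (hC : G.IsVertexCover C) : {v | v ∈ B ∧ Γ.IsInnermost C v}.ncard ≤ 8 * C.card := by
  rw [← Set.ncard_coe_finset C]
  refine ArcSystem.IsFork.ncard_le_of_forall (M := M) (fun h hh => E.exists_fork hC hh.1) ?_
  rintro h' ⟨hh', left', a', b', hs', o1', o2'⟩ h ⟨hh, left, a, b, hs, o1, o2⟩ l' r' l r F' F hl hr
    hlt
  have := E.inner h' hh' left' a' b' hs' o1' o2' h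
    (E.mem_side_of_ends hh' hh F' F hl.symm hr.symm hs')
  exact absurd this (not_le.2 hlt)

theorem matchingBoundingEars_symm {left : Bool} {a b v w : V}
    (h : Γ.MatchingBoundingEars C left a b v w) : Γ.MatchingBoundingEars C left a b w v := by
  obtain ⟨h1, h2, h3, h4, h5⟩ := h
  refine ⟨h2, h1, h3.symm, ?_, ?_⟩ <;> rw [Set.pair_comm]
  · exact h4
  · exact h5

/-- The apex of an ear in between would be a point of the subdrawing inside the face. -/
theorem not_between (E : EarModel C M B far near flat P Q)
    {left : Bool} {a b v w : V} (hm : Γ.MatchingBoundingEars C left a b v w) (hv : v ∈ B)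
    (hw : w ∈ B) {l r l' r' : Γ.edgeArcs} (F : M.IsFork C v l r) (F' : M.IsFork C w l' r')
    {g : V} (hg : g ∈ B) {l'' r'' : Γ.edgeArcs} (F'' : M.IsFork C g l'' r'')
    (hl : M.tgt l'' = M.tgt l) (hr : M.tgt r'' = M.tgt r)
    (h1 : M.py w < M.py g) (h2 : M.py g < M.py v) : False := by
  obtain ⟨hsv, hsw, hne, hemp, -⟩ := hm
  obtain ⟨e1, e2⟩ := E.ends_eq hv hw F F' hsv hsw
  have hsg := E.mem_side_of_ends hv hg F F'' hl hr hsv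
  have hgv : g ≠ v := by rintro rfl; exact lt_irrefl _ h2
  have hgw : g ≠ w := by rintro rfl; exact lt_irrefl _ h1
  refine hemp l''.1 ⟨l''.2, g, hsg, F''.src_left ▸ E.incident l''⟩ (Γ.pos g) ?_ ?_
  · rw [E.mem_iff, ArcSystem.Off, not_not]
    exact ⟨by rw [F''.src_left], F''.lt_left.le, F''.fn_left.symm⟩
  · rw [E.encloses_iff hv hw hne F F']
    exact ⟨⟨(F.off_of_ne F''.notMem hgv).1, (F.off_of_ne F''.notMem hgv).2,
      (F'.off_of_ne F''.notMem hgw).1, (F'.off_of_ne F''.notMem hgw).2⟩,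
      F'.oddParity_of_between F F'' (e1.trans hl.symm) (e2.trans hr.symm) h1 h2⟩

theorem exists_inLens (E : EarModel C M B far near flat P Q)
    {left : Bool} {a b v w : V} (hm : Γ.MatchingBoundingEars C left a b v w) (hv : v ∈ B)
    (hw : w ∈ B) {l r l' r' : Γ.edgeArcs} (F : M.IsFork C v l r) (F' : M.IsFork C w l' r')
    (h1 : M.py w < M.py v) : ∃ c ∈ C, M.InLens l' r' l r c := by
  obtain ⟨hsv, hsw, hne, -, c, hc, henc⟩ := hm
  obtain ⟨e1, e2⟩ := E.ends_eq hv hw F F' hsv hsw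
  obtain ⟨⟨o1, o2, o3, o4⟩, hodd⟩ := (E.encloses_iff hv hw hne F F').1 henc
  exact ⟨c, hc, F'.inLens_of_oddParity F e1 e2 h1 o1 o4 hodd⟩

/-- The upper and the lower ears of matching pairs are counted separately, at most `8|C|` of each.
No fork with the same ends lies strictly between matching ears. Hence a fork nested with the given
ear on the side of its partner is the partner itself or lies beyond it, and the vertex of `C` in the
face lies in their lens by monotonicity. -/
theorem ncard_bounding_le [Finite V] (E : EarModel C M B far near flat P Q)
    (hC : G.IsVertexCover C) : {v | v ∈ B ∧ Γ.IsBounding C v}.ncard ≤ 16 * C.card := by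
  have hsub : {v | v ∈ B ∧ Γ.IsBounding C v} ⊆
      {v | v ∈ B ∧ ∃ left a b w, w ∈ B ∧ Γ.MatchingBoundingEars C left a b v w ∧ M.py w < M.py v} ∪
      {w | w ∈ B ∧ ∃ left a b v, v ∈ B ∧ Γ.MatchingBoundingEars C left a b v w ∧
        M.py w < M.py v} := by
    rintro v ⟨hv, left, a, b, w, hm⟩
    have hw := E.side_mem v hv left a b w hm.1 hm.2.1
    obtain ⟨l, r, F⟩ := E.exists_fork hC hv
    obtain ⟨l', r', F'⟩ := E.exists_fork hC hw
    obtain ⟨e1, e2⟩ := E.ends_eq hv hw F F' hm.1 hm.2.1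
    rcases lt_or_gt_of_ne (F'.py_ne F e1 e2 hm.2.2.1) with h | h
    · exact Or.inl ⟨hv, left, a, b, w, hw, hm, h⟩
    · exact Or.inr ⟨hv, left, a, b, w, hw, matchingBoundingEars_symm hm, h⟩
  refine (Set.ncard_le_ncard hsub (Set.toFinite _)).trans ((Set.ncard_union_le _ _).trans ?_)
  have key : ∀ m n k : ℕ, m ≤ 8 * k → n ≤ 8 * k → m + n ≤ 16 * k := fun m n k _ _ => by omega
  refine key _ _ _ ?_ ?_ <;> rw [← Set.ncard_coe_finset C] <;>
    refine ArcSystem.IsFork.ncard_le_of_forall (M := M) (fun h hh => E.exists_fork hC hh.1) ?_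
  · rintro h' ⟨hh', -⟩ h ⟨hh, left, a, b, w, hw, hm, hlt'⟩ l' r' l r F' F hl hr hlt
    obtain ⟨l'', r'', F''⟩ := E.exists_fork hC hw
    obtain ⟨e1, e2⟩ := E.ends_eq hh hw F F'' hm.1 hm.2.1
    obtain ⟨c, hc, hin⟩ := E.exists_inLens hm hh hw F F'' hlt'
    refine ⟨c, hc, ?_⟩
    by_cases hne : h' = w
    · subst hne
      obtain rfl : l' = l'' := E.simple _ _ (F'.src_left.trans F''.src_left.symm) (hl.trans e1.symm)
      obtain rfl : r' = r'' :=
        E.simple _ _ (F'.src_right.trans F''.src_right.symm) (hr.trans e2.symm)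
      exact hin
    · rcases lt_or_gt_of_ne (F'.py_ne F'' (hl.trans e1.symm) (hr.trans e2.symm) (Ne.symm hne))
        with h1 | h1
      · exact F''.inLens_mono_outer F F' e1 e2 (hl.trans e1.symm) (hr.trans e2.symm) h1 hin
      · exact (E.not_between hm hh hw F F'' hh' F' hl hr h1 hlt).elim
  · rintro h' ⟨hh', left, a, b, v, hv, hm, hlt'⟩ h ⟨hh, -⟩ l' r' l r F' F hl hr hlt
    obtain ⟨l'', r'', F''⟩ := E.exists_fork hC hv
    obtain ⟨e1, e2⟩ := E.ends_eq hv hh' F'' F' hm.1 hm.2.1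
    obtain ⟨c, hc, hin⟩ := E.exists_inLens hm hv hh' F'' F' hlt'
    refine ⟨c, hc, ?_⟩
    by_cases hne : h = v
    · subst hne
      obtain rfl : l = l'' := E.simple _ _ (F.src_left.trans F''.src_left.symm) (hl.symm.trans e1)
      obtain rfl : r = r'' :=
        E.simple _ _ (F.src_right.trans F''.src_right.symm) (hr.symm.trans e2)
      exact hin
    · rcases lt_or_gt_of_ne (F.py_ne F'' (hl.symm.trans e1) (hr.symm.trans e2) (Ne.symm hne))
        with h1 | h1
      · exact (E.not_between hm hv hh' F'' F' hh F (hl.symm.trans e1) (hr.symm.trans e2) hlt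
          h1).elim
      · exact F'.inLens_mono_inner F'' F e1 e2 (e1.symm.trans hl) (e2.symm.trans hr) hlt' h1 hin

end EarModel

end LevelGraph.Drawing

/-! ### Bottom ears, top ears, and the size of the core -/

namespace LevelGraph

variable {V : Type*} {G : LevelGraph V}

/-- The ears that lie below their neighbours. -/
def bottomEars (G : LevelGraph V) (C : Finset V) : Set V := {h | G.IsEar C h ∧ ∃ u, G.Adj h u}

/-- The ears that lie above their neighbours. -/
def topEars (G : LevelGraph V) (C : Finset V) : Set V := {h | G.IsEar C h ∧ ∃ u, G.Adj u h}

theorem adj_of_mem_bottomEars {C : Finset V} {h c : V} (hh : h ∈ G.bottomEars C) (hc : c ∈ G.nbrs h) :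
    G.Adj h c := by
  obtain ⟨⟨-, -, h1⟩, u, hu⟩ := hh
  rcases h1 with h1 | h1
  · exact hc.resolve_left (h1 c)
  · exact absurd hu (h1 u)

theorem adj_of_mem_topEars {C : Finset V} {h c : V} (hh : h ∈ G.topEars C) (hc : c ∈ G.nbrs h) :
    G.Adj c h := by
  obtain ⟨⟨-, -, h1⟩, u, hu⟩ := hh
  rcases h1 with h1 | h1
  · exact absurd hu (h1 u)
  · exact hc.resolve_right (h1 c)

theorem IsEarOf.mem_bottom_or_top {C : Finset V} {a b h : V} (H : G.IsEarOf C a b h) :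
    (h ∈ G.bottomEars C ∧ G.Adj h a ∧ G.Adj h b) ∨ (h ∈ G.topEars C ∧ G.Adj a h ∧ G.Adj b h) := by
  obtain ⟨he, hn, -⟩ := H
  have ha : a ∈ G.nbrs h := by rw [hn]; simp
  have hb : b ∈ G.nbrs h := by rw [hn]; simp
  rcases ha with ha' | ha'
  · exact Or.inr ⟨⟨he, a, ha'⟩, ha', adj_of_mem_topEars ⟨he, a, ha'⟩ hb⟩
  · exact Or.inl ⟨⟨he, a, ha'⟩, ha', adj_of_mem_bottomEars ⟨he, a, ha'⟩ hb⟩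

namespace Drawing

variable {Γ : G.Drawing} {C : Finset V}

/-- For ends at different levels, the edge from the bottom ear to `a` and the edge from `b` to the
top ear both pass the other end on the same side. This reverses their order between the heights of
`b` and `a`, so they would cross. -/
theorem not_bottom_and_top (hΓ : Γ.IsLevelPlanar) {left : Bool} {a b h w : V}
    (hs : h ∈ Γ.sideEars C left a b) (ws : w ∈ Γ.sideEars C left a b) (hh : h ∈ G.bottomEars C)
    (hw : w ∈ G.topEars C) : False := by
  obtain ⟨⟨-, hn, -⟩, h1⟩ := hs
  obtain ⟨⟨-, wn, -⟩, w1⟩ := ws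
  have ha := adj_of_mem_bottomEars hh (c := a) (by rw [hn]; simp)
  have hb := adj_of_mem_bottomEars hh (c := b) (by rw [hn]; simp)
  have wa := adj_of_mem_topEars hw (c := a) (by rw [wn]; simp)
  have wb := adj_of_mem_topEars hw (c := b) (by rw [wn]; simp)
  have l1 := G.level_lt _ _ ha
  have l2 := G.level_lt _ _ hb
  have l3 := G.level_lt _ _ wa
  have l4 := G.level_lt _ _ wb
  have F := hΓ.family
  rcases h1 with ⟨hlt, h1⟩ | ⟨heq, h1⟩
  · rcases w1 with ⟨-, w1⟩ | ⟨weq, -⟩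
    · have h2 := (h1.resolve_left fun h => by linarith [h.1]).2
      have w2 := (w1.resolve_right fun h => by linarith [h.1]).2
      have e1 := F.sys.fn_tgt (Γ.edgeArc ha)
      have e2 := F.sys.fn_src (Γ.edgeArc wb)
      change F.sys.fn _ (G.level a) = Γ.x a at e1
      change F.sys.fn _ (G.level b) = Γ.x b at e2
      cases left
      · simp only [Bool.false_eq_true, if_false] at h2 w2
        obtain ⟨-, -, h3⟩ := (F.passesRightOf (Γ.edgeArc ha)).1 h2
        obtain ⟨-, -, w3⟩ := (F.passesRightOf (Γ.edgeArc wb)).1 w2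
        have := ArcSystem.fn_le_of_fn_lt (M := F.sys) (i := Γ.edgeArc wb) (j := Γ.edgeArc ha)
          (t := G.level b) (t' := G.level a) (by rw [e2]; exact h3) le_rfl l4.le l2.le hlt.le
          hlt.le l3.le l1.le le_rfl
        change Γ.x a < _ at w3
        simp only [pos] at w3
        linarith
      · simp only [if_true] at h2 w2
        obtain ⟨-, -, h3⟩ := (F.passesLeftOf (Γ.edgeArc ha)).1 h2
        obtain ⟨-, -, w3⟩ := (F.passesLeftOf (Γ.edgeArc wb)).1 w2
        have := ArcSystem.fn_le_of_fn_lt (M := F.sys) (i := Γ.edgeArc ha) (j := Γ.edgeArc wb)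
          (t := G.level b) (t' := G.level a) (by rw [e2]; exact h3) l2.le hlt.le le_rfl l4.le
          l1.le le_rfl hlt.le l3.le
        simp only [pos] at w3
        linarith
    · linarith
  · rcases w1 with ⟨wlt, -⟩ | ⟨-, w1⟩
    · linarith
    · cases left
      · simp only [Bool.false_eq_true, if_false] at w1
        linarith
      · simp only [if_true] at h1
        linarith

theorem bottomModel (hΓ : Γ.IsLevelPlanar) : EarModel C hΓ.family.sys (G.bottomEars C)
    (fun a _ => a) (fun _ b => b) false True False where
  ear h hh := hh.1
  arc h hh c hc := ⟨Γ.edgeArc (adj_of_mem_bottomEars hh hc), rfl, rfl⟩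
  nbr := by
    rintro h hh i (rfl | rfl)
    · exact ⟨rfl, Or.inr i.2.1⟩
    · have := adj_of_mem_bottomEars hh (c := i.1.src) (Or.inl i.2.1)
      exact absurd (G.level_lt _ _ this) (lt_asymm (G.level_lt _ _ i.2.1))
  incident i := Or.inl rfl
  simple i j h1 h2 := edgeArcs_ext h1 h2
  far_near a b := Or.inl ⟨rfl, rfl⟩
  py_near a b h := h
  px_eq v := rfl
  py_eq v w h := h
  side_iff := by
    intro h hh left a b
    refine and_congr_right fun he => ?_
    have ha := adj_of_mem_bottomEars hh (c := a) (by rw [he.2.1]; simp)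
    have hb := adj_of_mem_bottomEars hh (c := b) (by rw [he.2.1]; simp)
    have l1 := G.level_lt _ _ ha
    have l2 := G.level_lt _ _ hb
    refine or_congr (and_congr_right fun hlt => ?_) (and_congr_right fun heq => ?_)
    · have n1 : ¬ G.level a < G.level h := l1.not_gt
      simp only [n1, false_and, l2, true_and, false_or]
      have hi : ∀ i, (hΓ.family.sys.src i = h ∧ hΓ.family.sys.tgt i = a) → i = Γ.edgeArc ha :=
        fun i h => edgeArcs_ext h.1 h.2
      have p1 := hΓ.family.passesLeftOf (Γ.edgeArc ha) (p := Γ.pos b)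
      have p2 := hΓ.family.passesRightOf (Γ.edgeArc ha) (p := Γ.pos b)
      constructor
      · intro hp
        refine ⟨Γ.edgeArc ha, rfl, rfl, ?_⟩
        cases left
        · exact (p2.1 hp).2.2
        · exact (p1.1 hp).2.2
      · rintro ⟨i, h1, h2, h3⟩
        obtain rfl := hi i ⟨h1, h2⟩
        cases left
        · exact p2.2 ⟨l2.le, hlt.le, h3⟩
        · exact p1.2 ⟨l2.le, hlt.le, h3⟩
    · cases left
      · simp [l2]
      · simp [l1.not_gt]
  side_mem h hh left a b w hs ws := by
    rcases ws.1.mem_bottom_or_top with h1 | h1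
    · exact h1.1
    · exact (not_bottom_and_top hΓ hs ws hh h1.1).elim
  outer h hh left a b hs _ h2 := h2
    (G.level_lt _ _ (adj_of_mem_bottomEars hh (c := b) (by rw [hs.1.2.1]; simp)))
  inner h hh left a b hs _ h2 := h2
    (G.level_lt _ _ (adj_of_mem_bottomEars hh (c := b) (by rw [hs.1.2.1]; simp)))
  hit_iff i u := by
    rw [hΓ.family.passesLeftOf]
    have := G.level_lt _ _ i.2.1
    constructor
    · rintro ⟨h1, h2, -, -, h3⟩
      refine ⟨?_, h3⟩
      rcases eq_or_lt_of_le h1 with e | e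
      · exact Or.inr (Or.inl ⟨e.symm, trivial⟩)
      · exact Or.inl ⟨e, h2⟩
    · rintro ⟨⟨h1, h2⟩ | ⟨h1, -⟩ | h1, h3⟩
      · exact ⟨h1.le, h2, h1.le, h2.le, h3⟩
      · exact ⟨h1.ge, h1.trans_lt this, h1.ge, (h1.trans_lt this).le, h3⟩
      · exact h1.2.elim
  mem_iff i u := by
    rw [ArcSystem.Off, not_not]
    exact hΓ.family.mem_pts i

/-- Reflection in the horizontal axis turns top ears into upward forks. It exchanges near and far
ends, and it moves the counted endpoint of an arc from its source to its target. -/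
theorem topModel (hΓ : Γ.IsLevelPlanar) : EarModel C hΓ.family.sys.flipY (G.topEars C)
    (fun _ b => b) (fun a _ => a) true False True where
  ear h hh := hh.1
  arc h hh c hc := ⟨Γ.edgeArc (adj_of_mem_topEars hh hc), rfl, rfl⟩
  nbr := by
    rintro h hh i (rfl | rfl)
    · have := adj_of_mem_topEars hh (c := i.1.tgt) (Or.inr i.2.1)
      exact absurd (G.level_lt _ _ this) (lt_asymm (G.level_lt _ _ i.2.1))
    · exact ⟨rfl, Or.inl i.2.1⟩
  incident i := Or.inr rfl
  simple i j h1 h2 := edgeArcs_ext h2 h1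
  far_near a b := Or.inr ⟨rfl, rfl⟩
  py_near a b h := neg_lt_neg h
  px_eq v := rfl
  py_eq v w h := congrArg Neg.neg h
  side_iff := by
    intro h hh left a b
    refine and_congr_right fun he => ?_
    have ha := adj_of_mem_topEars hh (c := a) (by rw [he.2.1]; simp)
    have hb := adj_of_mem_topEars hh (c := b) (by rw [he.2.1]; simp)
    have l1 := G.level_lt _ _ ha
    have l2 := G.level_lt _ _ hb
    refine or_congr (and_congr_right fun hlt => ?_) (and_congr_right fun heq => ?_)
    · have n1 : ¬ G.level h < G.level b := l2.not_gt
      simp only [n1, false_and, l1, true_and, or_false]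
      have hi : ∀ i, (hΓ.family.sys.flipY.src i = h ∧ hΓ.family.sys.flipY.tgt i = b) →
        i = Γ.edgeArc hb := fun i h => edgeArcs_ext h.2 h.1
      have p1 := hΓ.family.passesLeftOf (Γ.edgeArc hb) (p := Γ.pos a)
      have p2 := hΓ.family.passesRightOf (Γ.edgeArc hb) (p := Γ.pos a)
      have e : ∀ i, hΓ.family.sys.flipY.fn i (hΓ.family.sys.flipY.py a) =
          hΓ.family.sys.fn i (G.level a) := fun i =>
        congrArg (hΓ.family.sys.fn i) (neg_neg (G.level a))
      constructor
      · intro hp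
        refine ⟨Γ.edgeArc hb, rfl, rfl, ?_⟩
        rw [e]
        cases left
        · exact (p2.1 hp).2.2
        · exact (p1.1 hp).2.2
      · rintro ⟨i, h1, h2, h3⟩
        obtain rfl := hi i ⟨h1, h2⟩
        rw [e] at h3
        cases left
        · exact p2.2 ⟨hlt.le, l1.le, h3⟩
        · exact p1.2 ⟨hlt.le, l1.le, h3⟩
    · cases left
      · simp [l2.not_gt]
      · simp [l1]
  side_mem h hh left a b w hs ws := by
    rcases ws.1.mem_bottom_or_top with h1 | h1
    · exact (not_bottom_and_top hΓ ws hs h1.1 hh).elim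
    · exact h1.1
  outer h hh left a b hs h1 _ w hw := neg_le_neg (h1
    (G.level_lt _ _ (adj_of_mem_topEars hh (c := a) (by rw [hs.1.2.1]; simp))) w hw)
  inner h hh left a b hs h1 _ w hw := neg_le_neg (h1
    (G.level_lt _ _ (adj_of_mem_topEars hh (c := a) (by rw [hs.1.2.1]; simp))) w hw)
  hit_iff i u := by
    rw [hΓ.family.passesLeftOf]
    have := G.level_lt _ _ i.2.1
    simp only [ArcSystem.Hit, ArcSystem.flipY, neg_neg, neg_lt_neg_iff, neg_inj, and_false,
      false_or, and_true]
    constructor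
    · rintro ⟨h1, h2, -, -, h3⟩
      refine ⟨?_, h3⟩
      rcases eq_or_lt_of_le h1 with e | e
      · exact Or.inr e.symm
      · exact Or.inl ⟨h2, e⟩
    · rintro ⟨⟨h1, h2⟩ | h1, h3⟩
      · exact ⟨le_of_lt h2, h1, le_of_lt h2, le_of_lt h1, h3⟩
      · exact ⟨ge_of_eq h1, lt_of_eq_of_lt h1 this, ge_of_eq h1, le_of_lt (lt_of_eq_of_lt h1 this),
          h3⟩
  mem_iff i u := by
    rw [ArcSystem.Off, not_not]
    simp only [ArcSystem.flipY, neg_neg, neg_le_neg_iff]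
    refine (hΓ.family.mem_pts i).trans ?_
    exact and_left_comm

theorem mem_bottom_or_top_of_mem_side {left : Bool} {a b v : V} (h : v ∈ Γ.sideEars C left a b) :
    v ∈ G.bottomEars C ∨ v ∈ G.topEars C :=
  h.1.mem_bottom_or_top.imp And.left And.left

theorem ncard_le_of_bottom_top [Finite V] {p : V → Prop} {m : ℕ}
    (hp : ∀ v, p v → v ∈ G.bottomEars C ∨ v ∈ G.topEars C)
    (h1 : {v | v ∈ G.bottomEars C ∧ p v}.ncard ≤ m) (h2 : {v | v ∈ G.topEars C ∧ p v}.ncard ≤ m) :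
    {v | p v}.ncard ≤ 2 * m := by
  have hsub : {v | p v} ⊆ {v | v ∈ G.bottomEars C ∧ p v} ∪ {v | v ∈ G.topEars C ∧ p v} :=
    fun v hv => (hp v hv).imp (fun h => ⟨h, hv⟩) fun h => ⟨h, hv⟩
  have := Set.ncard_le_ncard hsub (Set.toFinite _)
  have := Set.ncard_union_le {v | v ∈ G.bottomEars C ∧ p v} {v | v ∈ G.topEars C ∧ p v}
  omega

theorem ncard_outermost_le [Finite V] (hC : G.IsVertexCover C) (hΓ : Γ.IsLevelPlanar) :
    {v | Γ.IsOutermost C v}.ncard ≤ 16 * C.card := by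
  have := ncard_le_of_bottom_top (p := Γ.IsOutermost C)
    (fun v ⟨_, _, _, h, _⟩ => mem_bottom_or_top_of_mem_side h)
    ((bottomModel hΓ).ncard_outermost_le hC) ((topModel hΓ).ncard_outermost_le hC)
  omega

theorem ncard_innermost_le [Finite V] (hC : G.IsVertexCover C) (hΓ : Γ.IsLevelPlanar) :
    {v | Γ.IsInnermost C v}.ncard ≤ 16 * C.card := by
  have := ncard_le_of_bottom_top (p := Γ.IsInnermost C)
    (fun v ⟨_, _, _, h, _⟩ => mem_bottom_or_top_of_mem_side h)
    ((bottomModel hΓ).ncard_innermost_le hC) ((topModel hΓ).ncard_innermost_le hC)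
  omega

theorem ncard_bounding_le [Finite V] (hC : G.IsVertexCover C) (hΓ : Γ.IsLevelPlanar) :
    {v | Γ.IsBounding C v}.ncard ≤ 32 * C.card := by
  have := ncard_le_of_bottom_top (p := Γ.IsBounding C)
    (fun v ⟨_, _, _, _, h, _⟩ => mem_bottom_or_top_of_mem_side h)
    ((bottomModel hΓ).ncard_bounding_le hC) ((topModel hΓ).ncard_bounding_le hC)
  omega

/-- The constant is `1 + 32 + 16 + 16 + 32`, for `C`, the vertices of high degree, and the
outermost, innermost and bounding ears. -/
theorem ncard_core_le [Finite V] (hC : G.IsVertexCover C) (hΓ : Γ.IsLevelPlanar) :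
    (Γ.core C).ncard ≤ 97 * C.card := by
  have h1 := ncard_outermost_le hC hΓ
  have h2 := ncard_innermost_le hC hΓ
  have h3 := ncard_bounding_le hC hΓ
  have h4 := ncard_highDegree_le hC hΓ
  have h5 := Set.ncard_coe_finset C
  have e1 := Set.ncard_union_le ((C : Set V) ∪ G.highDegree C) (Γ.crucial C)
  have e2 := Set.ncard_union_le (C : Set V) (G.highDegree C)
  have hcr : Γ.crucial C = {v | Γ.IsOutermost C v} ∪ ({v | Γ.IsInnermost C v} ∪
    {v | Γ.IsBounding C v}) := rfl
  have e3 := Set.ncard_union_le {v | Γ.IsOutermost C v} ({v | Γ.IsInnermost C v} ∪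
    {v | Γ.IsBounding C v})
  have e4 := Set.ncard_union_le {v | Γ.IsInnermost C v} {v | Γ.IsBounding C v}
  rw [← hcr] at e3
  have e5 : (Γ.core C).ncard = ((C : Set V) ∪ G.highDegree C ∪ Γ.crucial C).ncard := rfl
  omega

end Drawing

end LevelGraph

/-! ### The number of edges of the core -/

namespace LevelGraph.Drawing

variable {V : Type*} {G : LevelGraph V} {Γ : G.Drawing} {C : Finset V} {S 𝒜 ℬ : Set (Arc V)}

theorem IsMonotoneFamily.subset (h : Γ.IsMonotoneFamily 𝒜) (hs : ℬ ⊆ 𝒜) : Γ.IsMonotoneFamily ℬ :=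
  ⟨h.inj, fun A hA => h.mono A (hs hA), fun A hA => h.avoids A (hs hA),
    fun A hA B hB => h.nonCrossing A (hs hA) B (hs hB)⟩

/-- The vertex enclosed by two parallel curves lies between them. -/
theorem IsMonotoneFamily.between_of_encloses (h : Γ.IsMonotoneFamily 𝒜) {A B : 𝒜}
    (hs : A.1.src = B.1.src) (ht : A.1.tgt = B.1.tgt) (hr : h.sys.RightOf A B) {c : V}
    (hc : Γ.Encloses {A.1, B.1} (Γ.pos c)) :
    G.level A.1.src < G.level c ∧ G.level c < G.level A.1.tgt ∧
      h.sys.fn A (G.level c) < Γ.x c ∧ Γ.x c < h.sys.fn B (G.level c) := by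
  have hne : A.1 ≠ B.1 := fun e => by
    obtain ⟨t, -, -, -, -, h5⟩ := hr
    rw [Subtype.ext e] at h5
    exact lt_irrefl _ h5
  obtain ⟨hoff, hodd⟩ := hc
  let P : Arc V → Prop := fun X => G.level X.src ≤ (Γ.pos c).2 ∧ (Γ.pos c).2 < G.level X.tgt ∧
    PassesLeftOf X.pts (Γ.pos c)
  have hPA : P A.1 → h.sys.fn A (G.level c) < Γ.x c := fun hP => (h.passesLeftOf A |>.1 hP.2.2).2.2
  -- `A` runs to the left of `B`, so whenever `B` counts, `A` counts as well. An odd number then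
  -- means that `A` alone counts.
  have hPB : P B.1 → P A.1 := fun ⟨h1, h2, h3⟩ => by
    have h4 := (h.passesLeftOf B).1 h3
    have h1' : G.level A.1.src ≤ (Γ.pos c).2 := hs ▸ h1
    have h2' : (Γ.pos c).2 < G.level A.1.tgt := ht ▸ h2
    exact ⟨h1', h2', (h.passesLeftOf A).2 ⟨h1', h2'.le,
      (hr.fn_le h1' h2'.le h4.1 h4.2.1).trans_lt h4.2.2⟩⟩
  change Odd (Set.ncard {X ∈ ({A.1, B.1} : Set (Arc V)) | P X}) at hodd
  by_cases hA : P A.1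
  · have hB : ¬ P B.1 := fun hB => by
      have : {X ∈ ({A.1, B.1} : Set (Arc V)) | P X} = {A.1, B.1} := by
        ext X
        simp only [Set.mem_insert_iff, Set.mem_singleton_iff]
        constructor
        · exact fun hX => hX.1
        · rintro (rfl | rfl)
          exacts [⟨Or.inl rfl, hA⟩, ⟨Or.inr rfl, hB⟩]
      rw [this, Set.ncard_pair hne] at hodd
      exact absurd hodd (by decide)
    have h3 := hPA hA
    have h1' : G.level B.1.src ≤ (Γ.pos c).2 := hs ▸ hA.1
    have h2' : (Γ.pos c).2 < G.level B.1.tgt := ht ▸ hA.2.1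
    have h4 : Γ.x c ≤ h.sys.fn B (G.level c) := by
      by_contra hlt
      exact hB ⟨h1', h2', (h.passesLeftOf B).2 ⟨h1', h2'.le, not_le.1 hlt⟩⟩
    have h5 : Γ.x c ≠ h.sys.fn B (G.level c) := fun e =>
      hoff B.1 (Or.inr rfl) ((h.mem_pts B).2 ⟨h1', h2'.le, e⟩)
    refine ⟨lt_of_le_of_ne hA.1 fun e => ?_, hA.2.1, h3, lt_of_le_of_ne h4 h5⟩
    have e1 : h.sys.fn A (G.level A.1.src) = Γ.x A.1.src := h.sys.fn_src A
    have e2 : h.sys.fn B (G.level B.1.src) = Γ.x B.1.src := h.sys.fn_src B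
    have e' : G.level c = G.level A.1.src := e.symm
    rw [← hs] at e2
    rw [e', e1] at h3
    rw [e', e2] at h4
    exact absurd h4 (not_le.2 h3)
  · have : {X ∈ ({A.1, B.1} : Set (Arc V)) | P X} = ∅ := by
      ext X
      simp only [Set.mem_empty_iff_false, iff_false]
      rintro ⟨hX, hP⟩
      rcases hX with rfl | hX
      · exact hA hP
      · rw [Set.mem_singleton_iff.1 hX] at hP
        exact hA (hPB hP)
    rw [this, Set.ncard_empty] at hodd
    exact absurd hodd (by decide)

theorem IsVisibilitySet.nonCrossing (hΓ : Γ.IsLevelPlanar) (hS : Γ.IsVisibilitySet C S) {A B : Arc V}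
    (hA : A ∈ Γ.edgeArcs ∪ S) (hB : B ∈ Γ.edgeArcs ∪ S) (hne : A ≠ B) : Γ.NonCrossing A B := by
  rcases hA with hA | hA <;> rcases hB with hB | hB
  · exact hΓ.2.2 A hA B hB hne
  · rintro p ⟨h1, h2⟩
    obtain ⟨v, h3, h4, h5⟩ := (hS.1 B hB).1.2.2 A hA p ⟨h2, h1⟩
    exact ⟨v, h4, h3, h5⟩
  · exact (hS.1 A hA).1.2.2 B hB
  · exact hS.2.1 A hA B hB hne

theorem IsVisibilitySet.avoids (hΓ : Γ.IsLevelPlanar) (hS : Γ.IsVisibilitySet C S) {A : Arc V}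
    (hA : A ∈ Γ.edgeArcs ∪ S) : Γ.AvoidsVertices A :=
  hA.elim (fun hA => (hΓ.2.1 A hA).2) fun hA => (hS.1 A hA).1.2.1

theorem IsVisibilitySet.monotone_or_horizontal (hΓ : Γ.IsLevelPlanar) (hS : Γ.IsVisibilitySet C S)
    {A : Arc V} (hA : A ∈ Γ.edgeArcs ∪ S) : IsYMonotone (Γ.pos A.src) (Γ.pos A.tgt) A.pts ∨
      IsHorizontalSegment (Γ.pos A.src) (Γ.pos A.tgt) A.pts :=
  hA.elim (fun hA => Or.inl (hΓ.2.1 A hA).1) fun hA => (hS.1 A hA).1.1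

variable (Γ) in
/-- The y-monotone curves of the drawing with the inserted curves `S`. -/
def monotoneArcs (S : Set (Arc V)) : Set (Arc V) :=
  {A ∈ Γ.edgeArcs ∪ S | IsYMonotone (Γ.pos A.src) (Γ.pos A.tgt) A.pts}

variable (Γ) in
/-- The horizontal segments of the drawing with the inserted curves `S`. -/
def horizontalArcs (S : Set (Arc V)) : Set (Arc V) :=
  {A ∈ Γ.edgeArcs ∪ S | IsHorizontalSegment (Γ.pos A.src) (Γ.pos A.tgt) A.pts}

theorem IsVisibilitySet.family (hΓ : Γ.IsLevelPlanar) (hS : Γ.IsVisibilitySet C S) :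
    Γ.IsMonotoneFamily (Γ.monotoneArcs S) :=
  ⟨hΓ.1, fun _ hA => hA.2, fun _ hA => hS.avoids hΓ hA.1,
    fun _ hA _ hB hne => hS.nonCrossing hΓ hA.1 hB.1 hne⟩

/-- Of two segments that leave a vertex to the right, the shorter one ends at a vertex on the longer
one, hence at its end. -/
theorem IsVisibilitySet.horizontal_injOn (hΓ : Γ.IsLevelPlanar) (hS : Γ.IsVisibilitySet C S) :
    Set.InjOn Arc.src (Γ.horizontalArcs S) := by
  have key : ∀ {A B : Arc V}, A ∈ Γ.horizontalArcs S → B ∈ Γ.horizontalArcs S → A.src = B.src →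
      Γ.x A.tgt ≤ Γ.x B.tgt → A = B := by
    rintro A B ⟨hA, ha1, ha2, ha3⟩ ⟨hB, hb1, hb2, hb3⟩ hs hle
    have h1 : Γ.pos A.tgt ∈ B.pts := by
      rw [hb3, ← hs]
      exact ⟨ha1.symm, ha2.le, hle⟩
    have ht : A.tgt = B.tgt := (hS.avoids hΓ hB _ h1).resolve_left fun e => by
      rw [e, ← hs] at ha2
      exact lt_irrefl _ ha2
    refine Arc.ext hs ht ?_
    rw [ha3, hb3, hs, ht]
  intro A hA B hB hs
  rcases le_total (Γ.x A.tgt) (Γ.x B.tgt) with h | h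
  · exact key hA hB hs h
  · exact (key hB hA hs.symm h).symm

/-- The condition on parallel edges provides the point in each lens. Only finite subfamilies are
considered, because the finiteness of `S` is itself deduced from this bound. -/
theorem IsVisibilitySet.ncard_monotone_le [Finite V] (hΓ : Γ.IsLevelPlanar)
    (hS : Γ.IsVisibilitySet C S) (hfin : 𝒜.Finite) (h𝒜 : 𝒜 ⊆ Γ.monotoneArcs S)
    (hcore : 𝒜 ⊆ Γ.coreArcs C S) : 𝒜.ncard ≤ 3 * (Γ.core C).ncard := by
  have F := (hS.family hΓ).subset h𝒜
  have : Finite 𝒜 := hfin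
  refine F.sys.card_le_three_mul (fun A => (hcore A.2).2.1) (fun A => (hcore A.2).2.2)
    fun A B hs ht hr => ?_
  have hne : A.1 ≠ B.1 := fun e => by
    obtain ⟨t, -, -, -, -, h5⟩ := hr
    rw [Subtype.ext e] at h5
    exact lt_irrefl _ h5
  obtain ⟨c, hc, he⟩ := hS.2.2 A.1 (h𝒜 A.2).1 B.1 (h𝒜 B.2).1 hne hs ht
  exact ⟨c, Or.inl (Or.inl hc), F.between_of_encloses hs ht hr he⟩

theorem finite_of_forall_finite_ncard_le {α : Type*} {s : Set α} {n : ℕ}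
    (h : ∀ t : Set α, t.Finite → t ⊆ s → t.ncard ≤ n) : s.Finite := by
  by_contra hs
  obtain ⟨t, ht, hc⟩ := Set.Infinite.exists_subset_card_eq hs (n + 1)
  have := h t t.finite_toSet ht
  rw [Set.ncard_coe_finset, hc] at this
  omega

/-- The constant is `4 * 97`: three monotone arcs and one horizontal segment per core vertex.
Maximality plays no role, so the bound also serves the larger drawing of a refined extension. -/
theorem IsVisibilitySet.coreArcs_bound [Finite V] (hC : G.IsVertexCover C) (hΓ : Γ.IsLevelPlanar)
    (hS : Γ.IsVisibilitySet C S) :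
    (Γ.coreArcs C S).Finite ∧ (Γ.coreArcs C S).ncard ≤ 388 * C.card := by
  have hcore := ncard_core_le hC hΓ
  have hm : (Γ.coreArcs C S ∩ Γ.monotoneArcs S).Finite :=
    finite_of_forall_finite_ncard_le fun t hf ht =>
      hS.ncard_monotone_le hΓ hf (fun _ hA => (ht hA).2) fun _ hA => (ht hA).1
  have hh : Set.InjOn Arc.src (Γ.coreArcs C S ∩ Γ.horizontalArcs S) :=
    (hS.horizontal_injOn hΓ).mono Set.inter_subset_right
  have hsub : Arc.src '' (Γ.coreArcs C S ∩ Γ.horizontalArcs S) ⊆ Γ.core C := by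
    rintro _ ⟨A, hA, rfl⟩
    exact hA.1.2.1
  have hhf : (Γ.coreArcs C S ∩ Γ.horizontalArcs S).Finite :=
    Set.Finite.of_finite_image ((Set.toFinite (Γ.core C)).subset hsub) hh
  have hun : Γ.coreArcs C S ⊆ (Γ.coreArcs C S ∩ Γ.monotoneArcs S) ∪
      (Γ.coreArcs C S ∩ Γ.horizontalArcs S) := fun A hA =>
    (hS.monotone_or_horizontal hΓ hA.1).imp (fun h => ⟨hA, hA.1, h⟩) fun h => ⟨hA, hA.1, h⟩
  refine ⟨(hm.union hhf).subset hun, ?_⟩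
  have h1 := hS.ncard_monotone_le hΓ hm Set.inter_subset_right Set.inter_subset_left
  have h2 := Set.ncard_le_ncard hsub (Set.toFinite _)
  rw [Set.InjOn.ncard_image hh] at h2
  have h3 := Set.ncard_le_ncard hun (hm.union hhf)
  have h4 := Set.ncard_union_le (Γ.coreArcs C S ∩ Γ.monotoneArcs S)
    (Γ.coreArcs C S ∩ Γ.horizontalArcs S)
  omega

theorem IsVisibilitySet.finite [Finite V] (hC : G.IsVertexCover C) (hΓ : Γ.IsLevelPlanar)
    (hS : Γ.IsVisibilitySet C S) : S.Finite :=
  (hS.coreArcs_bound hC hΓ).1.subset fun A hA =>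
    ⟨Or.inr hA, Or.inl (Or.inl (hS.1 A hA).2.1), Or.inl (Or.inl (hS.1 A hA).2.2)⟩

end LevelGraph.Drawing

/-! ### Moving monotone curves in the complement of a closed set -/

/-- A y-monotone curve leads from `(x₀, y₀)` up to `(x, y)` and avoids `O` after its start. -/
def Climb (O : Set (ℝ × ℝ)) (x₀ y₀ x y : ℝ) : Prop :=
  y₀ < y ∧ ∃ g : ℝ → ℝ, Continuous g ∧ g y₀ = x₀ ∧ g y = x ∧ ∀ t, y₀ < t → t ≤ y → (g t, t) ∉ O

/-- A y-monotone curve leads from `(x₀, y₀)` down to `(x, y)` and avoids `O` after its start. -/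
def Descend (O : Set (ℝ × ℝ)) (x₀ y₀ x y : ℝ) : Prop :=
  y < y₀ ∧ ∃ g : ℝ → ℝ, Continuous g ∧ g y₀ = x₀ ∧ g y = x ∧ ∀ t, y ≤ t → t < y₀ → (g t, t) ∉ O

/-- A y-monotone curve leads from `(x₀, y₀)` up to `(x₁, y₁)` and avoids `O` in between. -/
def Joins (O : Set (ℝ × ℝ)) (x₀ y₀ x₁ y₁ : ℝ) : Prop :=
  y₀ < y₁ ∧ ∃ g : ℝ → ℝ, Continuous g ∧ g y₀ = x₀ ∧ g y₁ = x₁ ∧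
    ∀ t, y₀ < t → t < y₁ → (g t, t) ∉ O

/-- The set reflected in the horizontal axis. -/
def reflectY (O : Set (ℝ × ℝ)) : Set (ℝ × ℝ) := {q | (q.1, -q.2) ∈ O}

/-- The set reflected in the vertical axis. -/
def reflectX (O : Set (ℝ × ℝ)) : Set (ℝ × ℝ) := {q | (-q.1, q.2) ∈ O}

variable {O : Set (ℝ × ℝ)} {x₀ y₀ x y x₁ y₁ x' y' : ℝ}

theorem isClosed_reflectY (hO : IsClosed O) : IsClosed (reflectY O) :=
  hO.preimage (by fun_prop : Continuous fun q : ℝ × ℝ => (q.1, -q.2))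

theorem climb_reflectY : Climb (reflectY O) x₀ (-y₀) x (-y) ↔ Descend O x₀ y₀ x y := by
  constructor
  · rintro ⟨h, g, hg, h1, h2, h3⟩
    refine ⟨by linarith, fun t => g (-t), hg.comp continuous_neg, h1, h2, fun t ht ht' => ?_⟩
    have := h3 (-t) (by linarith) (by linarith)
    simpa only [reflectY, Set.mem_ofPred_eq, neg_neg] using this
  · rintro ⟨h, g, hg, h1, h2, h3⟩
    refine ⟨by linarith, fun t => g (-t), hg.comp continuous_neg, by simpa using h1,
      by simpa using h2, fun t ht ht' => h3 (-t) (by linarith) (by linarith)⟩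

theorem climb_reflectX : Climb (reflectX O) (-x₀) y₀ (-x) y ↔ Climb O x₀ y₀ x y := by
  constructor
  · rintro ⟨h, g, hg, h1, h2, h3⟩
    exact ⟨h, fun t => -g t, hg.neg, by simp only [h1, neg_neg], by simp only [h2, neg_neg], h3⟩
  · rintro ⟨h, g, hg, h1, h2, h3⟩
    refine ⟨h, fun t => -g t, hg.neg, by simp only [h1], by simp only [h2], fun t ht ht' => ?_⟩
    have := h3 t ht ht'
    simpa only [reflectX, Set.mem_ofPred_eq, neg_neg] using this

theorem descend_reflectX : Descend (reflectX O) (-x₀) y₀ (-x) y ↔ Descend O x₀ y₀ x y := by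
  constructor
  · rintro ⟨h, g, hg, h1, h2, h3⟩
    exact ⟨h, fun t => -g t, hg.neg, by simp only [h1, neg_neg], by simp only [h2, neg_neg], h3⟩
  · rintro ⟨h, g, hg, h1, h2, h3⟩
    refine ⟨h, fun t => -g t, hg.neg, by simp only [h1], by simp only [h2], fun t ht ht' => ?_⟩
    have := h3 t ht ht'
    simpa only [reflectX, Set.mem_ofPred_eq, neg_neg] using this

theorem joins_of_reflectX (h : Joins (reflectX O) (-x₀) y₀ (-x₁) y₁) : Joins O x₀ y₀ x₁ y₁ := by
  obtain ⟨h, g, hg, h1, h2, h3⟩ := h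
  exact ⟨h, fun t => -g t, hg.neg, by simp only [h1, neg_neg], by simp only [h2, neg_neg], h3⟩

theorem Climb.notMem (h : Climb O x₀ y₀ x y) : (x, y) ∉ O := by
  obtain ⟨h, g, -, -, rfl, h3⟩ := h
  exact h3 y h le_rfl

/-- Two y-monotone curves that meet can be concatenated. -/
theorem exists_concat {g h : ℝ → ℝ} (hg : Continuous g) (hh : Continuous h) {s : ℝ}
    (he : g s = h s) : ∃ f : ℝ → ℝ, Continuous f ∧ (∀ t ≤ s, f t = g t) ∧ ∀ t, s ≤ t → f t = h t := by
  refine ⟨fun t => if t ≤ s then g t else h t, hg.if_le hh continuous_id continuous_const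
    (fun t ht => by rw [show t = s from ht]; exact he), fun t ht => if_pos ht, fun t ht => ?_⟩
  rcases ht.eq_or_lt with rfl | h
  · simp only [le_refl, if_true, he]
  · exact if_neg (not_le.2 h)

theorem Climb.extend (h : Climb O x₀ y₀ x y) (hy : y < y') {k : ℝ → ℝ} (hk : Continuous k)
    (h1 : k y = x) (h2 : k y' = x') (h3 : ∀ t, y ≤ t → t ≤ y' → (k t, t) ∉ O) :
    Climb O x₀ y₀ x' y' := by
  obtain ⟨h, g, hg, g1, g2, g3⟩ := h
  obtain ⟨f, hf, f1, f2⟩ := exists_concat hg hk (g2.trans h1.symm)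
  refine ⟨h.trans hy, f, hf, by rw [f1 _ h.le, g1], by rw [f2 _ hy.le, h2], fun t ht ht' => ?_⟩
  rcases le_total t y with hty | hty
  · rw [f1 _ hty]; exact g3 t ht hty
  · rw [f2 _ hty]; exact h3 t hty ht'

theorem Climb.joins (h : Climb O x₀ y₀ x y) (h' : Descend O x₁ y₁ x y) : Joins O x₀ y₀ x₁ y₁ := by
  obtain ⟨h, g, hg, g1, g2, g3⟩ := h
  obtain ⟨h', k, hk, k1, k2, k3⟩ := h'
  obtain ⟨f, hf, f1, f2⟩ := exists_concat hg hk (g2.trans k2.symm)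
  refine ⟨h.trans h', f, hf, by rw [f1 _ h.le, g1], by rw [f2 _ h'.le, k1], fun t ht ht' => ?_⟩
  rcases le_total t y with hty | hty
  · rw [f1 _ hty]; exact g3 t ht hty
  · rw [f2 _ hty]; exact k3 t hty ht'

/-- The height parametrisation of a straight segment. -/
theorem exists_line (h : y₀ < y) (x₀ x : ℝ) : ∃ k : ℝ → ℝ, Continuous k ∧ k y₀ = x₀ ∧ k y = x ∧
    ∀ t, y₀ ≤ t → t ≤ y → (k t, t) ∈ segment ℝ (x₀, y₀) (x, y) := by
  have hne : y - y₀ ≠ 0 := by linarith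
  refine ⟨fun t => x₀ + (t - y₀) / (y - y₀) * (x - x₀), by fun_prop, by simp, ?_, fun t h1 h2 => ?_⟩
  · simp only [div_self hne]; ring
  · rw [segment_eq_image']
    refine ⟨(t - y₀) / (y - y₀), ⟨div_nonneg (by linarith) (by linarith),
      div_le_one_of_le₀ (by linarith) (by linarith)⟩, ?_⟩
    ext
    · simp
    · simp only [Prod.mk_sub_mk, Prod.smul_mk, Prod.mk_add_mk, smul_eq_mul]
      field_simp
      ring

/-- The end of a curve can be moved along a free horizontal segment, and then slightly up or down. -/
theorem Climb.shift (hO : IsClosed O) (h : Climb O x₀ y₀ x y)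
    (hs : ∀ ξ ∈ Set.uIcc x x', (ξ, y) ∉ O) :
    ∃ ρ > 0, ∀ t, y - ρ < t → t < y + ρ → Climb O x₀ y₀ x' t := by
  obtain ⟨h, g, hg, g1, g2, g3⟩ := h
  have hK : IsCompact (Set.uIcc x x' ×ˢ {y} : Set (ℝ × ℝ)) := isCompact_uIcc.prod isCompact_singleton
  obtain ⟨δ, hδ, hsub⟩ := hK.exists_thickening_subset_open hO.isOpen_compl (by
    rintro ⟨ξ, τ⟩ ⟨h1, h2⟩
    rw [Set.mem_singleton_iff] at h2
    simp only at h2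
    subst h2
    exact hs ξ h1)
  have hconv : Convex ℝ (Metric.thickening δ (Set.uIcc x x' ×ˢ {y} : Set (ℝ × ℝ))) :=
    ((convex_uIcc x x').prod (convex_singleton y)).thickening δ
  obtain ⟨ρ, hρ, hclose⟩ := Metric.continuous_iff.1 hg y δ hδ
  refine ⟨min (min ρ δ) (y - y₀), by simp only [gt_iff_lt, lt_inf_iff]; exact ⟨⟨hρ, hδ⟩, by linarith⟩,
    fun t h1 h2 => ?_⟩
  have m1 := min_le_left (min ρ δ) (y - y₀)
  have m2 := min_le_right (min ρ δ) (y - y₀)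
  have m3 := min_le_left ρ δ
  have m4 := min_le_right ρ δ
  -- The curve is left at a height `t0` below both `y` and `t`. From there the straight line to the
  -- new end stays in a thickening of the segment, which is convex and free.
  obtain ⟨t0, ht0, ht0'⟩ := exists_between (lt_min (by linarith) h1 :
    y - min (min ρ δ) (y - y₀) < min y t)
  have ht0y := lt_of_lt_of_le ht0' (min_le_left _ _)
  have ht0t := lt_of_lt_of_le ht0' (min_le_right _ _)
  have hmem0 : (g t0, t0) ∈ Metric.thickening δ (Set.uIcc x x' ×ˢ {y} : Set (ℝ × ℝ)) := by
    refine Metric.mem_thickening_iff.2 ⟨(x, y), ⟨Set.left_mem_uIcc, rfl⟩, ?_⟩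
    rw [Prod.dist_eq]
    have e := hclose t0 (by rw [Real.dist_eq, abs_lt]; constructor <;> linarith)
    rw [g2] at e
    refine max_lt e ?_
    simp only
    rw [Real.dist_eq, abs_lt]; constructor <;> linarith
  have hmem1 : (x', t) ∈ Metric.thickening δ (Set.uIcc x x' ×ˢ {y} : Set (ℝ × ℝ)) := by
    refine Metric.mem_thickening_iff.2 ⟨(x', y), ⟨Set.right_mem_uIcc, rfl⟩, ?_⟩
    rw [Prod.dist_eq]
    refine max_lt (by simpa using hδ) ?_
    simp only
    rw [Real.dist_eq, abs_lt]; constructor <;> linarith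
  obtain ⟨k, hk, k1, k2, k3⟩ := exists_line ht0t (g t0) x'
  refine Climb.extend (x := g t0) (y := t0) ⟨by linarith, g, hg, g1, rfl, fun τ h3 h4 =>
    g3 τ h3 (by linarith)⟩ ht0t hk k1 k2 fun τ h3 h4 => hsub (hconv.segment_subset hmem0 hmem1
      (k3 τ h3 h4))

theorem Climb.slide (hO : IsClosed O) (h : Climb O x₀ y₀ x y)
    (hs : ∀ ξ ∈ Set.uIcc x x', (ξ, y) ∉ O) : Climb O x₀ y₀ x' y := by
  obtain ⟨ρ, hρ, h'⟩ := h.shift hO hs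
  exact h' y (by linarith) (by linarith)

theorem Descend.slide (hO : IsClosed O) (h : Descend O x₀ y₀ x y)
    (hs : ∀ ξ ∈ Set.uIcc x x', (ξ, y) ∉ O) : Descend O x₀ y₀ x' y := by
  rw [← climb_reflectY] at h ⊢
  exact h.slide (isClosed_reflectY hO) fun ξ hξ => by
    simpa only [reflectY, Set.mem_ofPred_eq, neg_neg] using hs ξ hξ

/-- A curve whose interior stays away from a closed set can be moved off itself, keeping its ends. -/
theorem exists_tube (hO : IsClosed O) {F : ℝ → ℝ} (hF : Continuous F)
    (h0 : (F y₀, y₀) ∈ O) (h1 : (F y₁, y₁) ∈ O) (h : ∀ t, y₀ < t → t < y₁ → (F t, t) ∉ O) :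
    ∃ d : ℝ → ℝ, (∀ t, y₀ < t → t < y₁ → 0 < d t) ∧ ∀ c, c ≠ 0 → |c| < 1 →
      Continuous (fun t => F t + c * d t) ∧ F y₀ + c * d y₀ = F y₀ ∧ F y₁ + c * d y₁ = F y₁ ∧
        ∀ t, y₀ < t → t < y₁ → (F t + c * d t, t) ∉ O ∧ F t + c * d t ≠ F t := by
  -- The distance to `O` vanishes at both ends, which lie in `O`. A displacement by less than this
  -- distance cannot reach `O`.
  refine ⟨fun t => Metric.infDist (F t, t) O, fun t ht ht' =>
    (hO.notMem_iff_infDist_pos ⟨_, h0⟩).1 (h t ht ht'), fun c hc hc' => ⟨?_, ?_, ?_, ?_⟩⟩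
  · exact hF.add (continuous_const.mul ((Metric.continuous_infDist_pt O).comp
      (hF.prodMk continuous_id)))
  · simp only [Metric.infDist_zero_of_mem h0, mul_zero, add_zero]
  · simp only [Metric.infDist_zero_of_mem h1, mul_zero, add_zero]
  · intro t ht ht'
    have hpos := (hO.notMem_iff_infDist_pos ⟨_, h0⟩).1 (h t ht ht')
    refine ⟨fun hm => ?_, fun e => ?_⟩
    · have := Metric.infDist_le_dist_of_mem (x := (F t, t)) hm
      rw [Prod.dist_eq, dist_self, max_eq_left dist_nonneg, Real.dist_eq, sub_add_cancel_left,
        abs_neg, abs_mul, abs_of_pos hpos] at this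
      nlinarith
    · have : c * Metric.infDist (F t, t) O = 0 := by linarith
      rcases mul_eq_zero.1 this with h | h
      · exact hc h
      · exact hpos.ne' h

/-! ### Curves beside the arcs and below the segments of a drawing -/

/-- Points in the plane with a crossing-free system of y-monotone curves and horizontal segments. -/
structure Scene (V ι κ : Type*) extends ArcSystem V ι where
  left : κ → V
  right : κ → V
  left_lt : ∀ k, px (left k) < px (right k)
  py_eq : ∀ k, py (left k) = py (right k)
  avoid_hor : ∀ k v, py v = py (left k) → px (left k) ≤ px v → px v ≤ px (right k) →
    v = left k ∨ v = right k
  cross_hor : ∀ i k, py (src i) ≤ py (left k) → py (left k) ≤ py (tgt i) →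
    px (left k) ≤ fn i (py (left k)) → fn i (py (left k)) ≤ px (right k) →
    fn i (py (left k)) = px (left k) ∨ fn i (py (left k)) = px (right k)

namespace Scene

variable {V ι κ : Type*} (M : Scene V ι κ)

/-- Reflection in the vertical axis. -/
def flipX : Scene V ι κ where
  toArcSystem := M.toArcSystem.flipX
  left := M.right
  right := M.left
  left_lt k := neg_lt_neg (M.left_lt k)
  py_eq k := (M.py_eq k).symm
  avoid_hor k v h1 h2 h3 := (M.avoid_hor k v (h1.trans (M.py_eq k).symm) (neg_le_neg_iff.1 h3)
    (neg_le_neg_iff.1 h2)).symm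
  cross_hor i k h1 h2 h3 h4 := by
    simp only [ArcSystem.flipX, ← M.py_eq k, neg_le_neg_iff, neg_inj] at *
    exact (M.cross_hor i k h1 h2 h4 h3).symm

/-- The points of the curve `i`. -/
def arcSet (i : ι) : Set (ℝ × ℝ) :=
  {p | M.py (M.src i) ≤ p.2 ∧ p.2 ≤ M.py (M.tgt i) ∧ p.1 = M.fn i p.2}

/-- The points of the segment `k`. -/
def horSet (k : κ) : Set (ℝ × ℝ) :=
  {p | p.2 = M.py (M.left k) ∧ M.px (M.left k) ≤ p.1 ∧ p.1 ≤ M.px (M.right k)}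

/-- The points covered by the vertices in `P`, the curves in `Q` and the segments in `R`. -/
def cover (P : V → Prop) (Q : ι → Prop) (R : κ → Prop) : Set (ℝ × ℝ) :=
  {p | (∃ v, P v ∧ p = (M.px v, M.py v)) ∨ (∃ i, Q i ∧ p ∈ M.arcSet i) ∨ ∃ k, R k ∧ p ∈ M.horSet k}

/-- The points covered by the drawing. -/
def obstacles : Set (ℝ × ℝ) := M.cover (fun _ => True) (fun _ => True) fun _ => True

variable {M}

theorem isClosed_cover [Finite V] [Finite ι] [Finite κ] {P : V → Prop} {Q : ι → Prop}
    {R : κ → Prop} : IsClosed (M.cover P Q R) := by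
  have e : M.cover P Q R = ((fun v => (M.px v, M.py v)) '' {v | P v}) ∪
      ((⋃ i ∈ {i | Q i}, M.arcSet i) ∪ ⋃ k ∈ {k | R k}, M.horSet k) := by
    ext p
    simp only [cover, Set.mem_ofPred_eq, Set.mem_union, Set.mem_image, Set.mem_iUnion, exists_prop,
      eq_comm]
  rw [e]
  refine (Set.toFinite _).isClosed.union (((Set.toFinite _).isClosed_biUnion fun i _ => ?_).union
    ((Set.toFinite _).isClosed_biUnion fun k _ => ?_))
  · exact (isClosed_le continuous_const continuous_snd).inter
      ((isClosed_le continuous_snd continuous_const).inter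
        (isClosed_eq continuous_fst ((M.cont i).comp continuous_snd)))
  · exact (isClosed_eq continuous_snd continuous_const).inter
      ((isClosed_le continuous_const continuous_fst).inter
        (isClosed_le continuous_fst continuous_const))

theorem isClosed_obstacles [Finite V] [Finite ι] [Finite κ] : IsClosed M.obstacles :=
  isClosed_cover

theorem vertex_mem_obstacles (v : V) : (M.px v, M.py v) ∈ M.obstacles :=
  Or.inl ⟨v, trivial, rfl⟩

theorem arc_mem_obstacles {i : ι} {t : ℝ} (h1 : M.py (M.src i) ≤ t) (h2 : t ≤ M.py (M.tgt i)) :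
    (M.fn i t, t) ∈ M.obstacles :=
  Or.inr (Or.inl ⟨i, trivial, h1, h2, rfl⟩)

theorem hor_mem_obstacles {k : κ} {x : ℝ} (h1 : M.px (M.left k) ≤ x) (h2 : x ≤ M.px (M.right k)) :
    (x, M.py (M.left k)) ∈ M.obstacles :=
  Or.inr (Or.inr ⟨k, trivial, rfl, h1, h2⟩)

theorem obstacles_flipX : M.flipX.obstacles = reflectX M.obstacles := by
  ext ⟨x, t⟩
  simp only [obstacles, cover, reflectX, arcSet, horSet, Set.mem_ofPred_eq, true_and, Prod.mk.injEq,
    flipX, ArcSystem.flipX]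
  refine or_congr (exists_congr fun v => and_congr_left fun _ => neg_eq_iff_eq_neg.symm)
    (or_congr (exists_congr fun i => and_congr_right fun _ => and_congr_right fun _ =>
      neg_eq_iff_eq_neg.symm) (exists_congr fun k => ?_))
  rw [M.py_eq k]
  exact and_congr_right fun _ => ⟨fun h => ⟨by linarith, by linarith⟩,
    fun h => ⟨by linarith, by linarith⟩⟩

variable (M) in
/-- A curve climbs from the vertex `v` to `(x, y)`. -/
abbrev ClimbFrom (v : V) (x y : ℝ) : Prop := Climb M.obstacles (M.px v) (M.py v) x y

variable (M) in
/-- A curve descends from the vertex `v` to `(x, y)`. -/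
abbrev DescendFrom (v : V) (x y : ℝ) : Prop := Descend M.obstacles (M.px v) (M.py v) x y

theorem climbFrom_flipX {v : V} {x y : ℝ} : M.flipX.ClimbFrom v (-x) y ↔ M.ClimbFrom v x y := by
  rw [ClimbFrom, obstacles_flipX]; exact climb_reflectX

theorem descendFrom_flipX {v : V} {x y : ℝ} :
    M.flipX.DescendFrom v (-x) y ↔ M.DescendFrom v x y := by
  rw [DescendFrom, obstacles_flipX]; exact descend_reflectX

variable [Finite V] [Finite ι] [Finite κ]

/-- The points close to the interior of a curve can be reached from both of its ends. -/
theorem beside_arc {i : ι} {t : ℝ} (h1 : M.py (M.src i) < t) (h2 : t < M.py (M.tgt i)) :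
    ∃ δ > 0, ∀ ε, ε ≠ 0 → |ε| < δ →
      M.ClimbFrom (M.src i) (M.fn i t + ε) t ∧ M.DescendFrom (M.tgt i) (M.fn i t + ε) t := by
  obtain ⟨d, hd, htube⟩ := exists_tube (O := M.cover (fun _ => True) (fun j => j ≠ i) fun _ => True)
    (y₀ := M.py (M.src i)) (y₁ := M.py (M.tgt i)) isClosed_cover (M.cont i)
    (Or.inl ⟨M.src i, trivial, by rw [M.fn_src]⟩) (Or.inl ⟨M.tgt i, trivial, by rw [M.fn_tgt]⟩) (by
      rintro τ h3 h4 (⟨v, -, hv⟩ | ⟨j, hj, h5, h6, h7⟩ | ⟨k, -, h5, h6, h7⟩)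
      · obtain ⟨hx, hy⟩ := Prod.ext_iff.1 hv
        simp only at hx hy
        subst hy
        rcases M.avoid i v h3.le h4.le hx with rfl | rfl <;> linarith
      · exact ArcSystem.fn_ne_of_interior hj h5 h6 h3.le h4.le (Or.inr ⟨h3, h4⟩) h7.symm
      · simp only at h5 h6 h7
        subst h5
        rcases M.cross_hor i k h3.le h4.le h6 h7 with h8 | h8
        · rcases M.avoid i _ h3.le h4.le h8 with h | h <;> rw [h] at h3 h4 <;> linarith
        · have h9 := M.py_eq k
          rw [h9] at h3 h4 h8
          rcases M.avoid i _ h3.le h4.le h8 with h | h <;> rw [h] at h3 h4 <;> linarith)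
  refine ⟨d t, hd t h1 h2, fun ε hε hε' => ?_⟩
  have hdt := hd t h1 h2
  -- The factor makes the displaced arc pass through the prescribed point at height `t`. The tube
  -- avoids everything except the arc `i` itself, and the displacement keeps it off `i`.
  obtain ⟨hc, e0, e1, hfree⟩ := htube (ε / d t) (div_ne_zero hε hdt.ne')
    (by rw [abs_div, abs_of_pos hdt]; exact (div_lt_one hdt).2 hε')
  have hfree' : ∀ τ, M.py (M.src i) < τ → τ < M.py (M.tgt i) →
      (M.fn i τ + ε / d t * d τ, τ) ∉ M.obstacles := by
    rintro τ h3 h4 (hv | ⟨j, -, hj⟩ | hk)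
    · exact (hfree τ h3 h4).1 (Or.inl hv)
    · by_cases hji : j = i
      · subst hji
        exact (hfree τ h3 h4).2 hj.2.2
      · exact (hfree τ h3 h4).1 (Or.inr (Or.inl ⟨j, hji, hj⟩))
    · exact (hfree τ h3 h4).1 (Or.inr (Or.inr hk))
  have ht : M.fn i t + ε / d t * d t = M.fn i t + ε := by field_simp
  exact ⟨⟨h1, _, hc, e0.trans (M.fn_src i), ht, fun τ h3 h4 => hfree' τ h3 (by linarith)⟩,
    ⟨h2, _, hc, e1.trans (M.fn_tgt i), ht, fun τ h3 h4 => hfree' τ (by linarith) h4⟩⟩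

/-- The two arcs at a vertex with one lower and one upper neighbour can be bypassed. -/
theorem joins_of_transit {v : V} {s s' : ι} (hs : M.tgt s = v) (hs' : M.src s' = v)
    (honly : ∀ i, M.src i = v ∨ M.tgt i = v → i = s ∨ i = s')
    (hv : ∀ k, v ≠ M.left k ∧ v ≠ M.right k) :
    Joins M.obstacles (M.px (M.src s)) (M.py (M.src s)) (M.px (M.tgt s')) (M.py (M.tgt s')) := by
  have hlt : M.py (M.src s) < M.py v := hs ▸ M.lt s
  have hlt' : M.py v < M.py (M.tgt s') := hs' ▸ M.lt s'
  have hfs : M.fn s (M.py v) = M.px v := by rw [← hs, M.fn_tgt]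
  have hfs' : M.fn s' (M.py v) = M.px v := by rw [← hs', M.fn_src]
  obtain ⟨F, hF, hF1, hF2⟩ := exists_concat (M.cont s) (M.cont s') (hfs.trans hfs'.symm)
  have hF0 : F (M.py (M.src s)) = M.px (M.src s) := by rw [hF1 _ hlt.le, M.fn_src]
  have hF3 : F (M.py (M.tgt s')) = M.px (M.tgt s') := by rw [hF2 _ hlt'.le, M.fn_tgt]
  have hne : ∀ i, i ≠ s ∧ i ≠ s' → M.src i ≠ v ∧ M.tgt i ≠ v := fun i hi =>
    ⟨fun h => (honly i (Or.inl h)).elim hi.1 hi.2, fun h => (honly i (Or.inr h)).elim hi.1 hi.2⟩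
  -- The vertex `v` and its two arcs are not counted as obstacles here: the displaced curve leaves
  -- them anyway.
  obtain ⟨d, hd, htube⟩ := exists_tube
    (O := M.cover (fun w => w ≠ v) (fun j => j ≠ s ∧ j ≠ s') fun _ => True)
    (y₀ := M.py (M.src s)) (y₁ := M.py (M.tgt s')) isClosed_cover hF
    (Or.inl ⟨M.src s, fun h => by rw [h] at hlt; exact lt_irrefl _ hlt, by rw [hF0]⟩)
    (Or.inl ⟨M.tgt s', fun h => by rw [h] at hlt'; exact lt_irrefl _ hlt', by rw [hF3]⟩) (by
      intro τ h3 h4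
      have key : (τ = M.py v ∧ F τ = M.px v) ∨ (∃ i, (i = s ∨ i = s') ∧ M.py (M.src i) < τ ∧
          τ < M.py (M.tgt i) ∧ F τ = M.fn i τ) := by
        rcases lt_trichotomy τ (M.py v) with h | h | h
        · exact Or.inr ⟨s, Or.inl rfl, h3, by rw [hs]; exact h, hF1 _ h.le⟩
        · exact Or.inl ⟨h, by rw [h, hF1 _ le_rfl, hfs]⟩
        · exact Or.inr ⟨s', Or.inr rfl, by rw [hs']; exact h, h4, hF2 _ h.le⟩
      rcases key with ⟨rfl, hx⟩ | ⟨i, hi, a1, a2, a3⟩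
      · rw [hx]
        rintro (⟨w, hw, e⟩ | ⟨j, hj, h5, h6, h7⟩ | ⟨k, -, h5, h6, h7⟩)
        · obtain ⟨e1, e2⟩ := Prod.ext_iff.1 e
          exact hw (M.inj _ _ e1 e2).symm
        · exact ArcSystem.fn_ne_px h5 h6 (hne j hj).1.symm (hne j hj).2.symm h7.symm
        · exact (M.avoid_hor k v h5 h6 h7).elim (hv k).1 (hv k).2
      · rw [a3]
        rintro (⟨w, hw, hv⟩ | ⟨j, hj, h5, h6, h7⟩ | ⟨k, -, h5, h6, h7⟩)
        · obtain ⟨hx, hy⟩ := Prod.ext_iff.1 hv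
          simp only at hx hy
          subst hy
          rcases M.avoid i w a1.le a2.le hx with rfl | rfl <;> linarith
        · have : j ≠ i := by rintro rfl; exact hi.elim hj.1 hj.2
          exact ArcSystem.fn_ne_of_interior this h5 h6 a1.le a2.le (Or.inr ⟨a1, a2⟩) h7.symm
        · simp only at h5 h6 h7
          subst h5
          rcases M.cross_hor i k a1.le a2.le h6 h7 with h8 | h8
          · rcases M.avoid i _ a1.le a2.le h8 with h | h <;> rw [h] at a1 a2 <;> linarith
          · have h9 := M.py_eq k
            rw [h9] at a1 a2 h8
            rcases M.avoid i _ a1.le a2.le h8 with h | h <;> rw [h] at a1 a2 <;> linarith)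
  obtain ⟨hc, e0, e1, hfree⟩ := htube (1 / 2) (by norm_num) (by rw [abs_of_pos] <;> norm_num)
  refine ⟨hlt.trans hlt', _, hc, e0.trans hF0, e1.trans hF3, fun τ h3 h4 => ?_⟩
  rintro (⟨w, -, hw⟩ | ⟨j, -, hj⟩ | hk)
  · by_cases hwv : w = v
    · subst hwv
      obtain ⟨e1, e2⟩ := Prod.ext_iff.1 hw
      simp only at e1 e2
      refine (hfree τ h3 h4).2 (e1.trans ?_)
      rw [e2, hF1 _ le_rfl, hfs]
    · exact (hfree τ h3 h4).1 (Or.inl ⟨w, hwv, hw⟩)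
  · by_cases hjs : j = s
    · subst hjs
      exact (hfree τ h3 h4).2 (hj.2.2.trans (hF1 _ (hs ▸ hj.2.1)).symm)
    · by_cases hjs' : j = s'
      · subst hjs'
        exact (hfree τ h3 h4).2 (hj.2.2.trans (hF2 _ (hs' ▸ hj.1)).symm)
      · exact (hfree τ h3 h4).1 (Or.inr (Or.inl ⟨j, ⟨hjs, hjs'⟩, hj⟩))
  · exact (hfree τ h3 h4).1 (Or.inr (Or.inr hk))

/-- Slightly below a horizontal segment that starts at `z` and meets no curve from below, only the
curves that end in `z` are obstacles. -/
theorem below_segment {z : V} {μ : ℝ} (hμ : M.px z ≤ μ)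
    (H : ∀ i, M.py (M.src i) < M.py z → M.py z ≤ M.py (M.tgt i) → M.px z < M.fn i (M.py z) →
      μ < M.fn i (M.py z)) :
    ∃ δ > 0, ∀ ξ t, M.px z - δ < ξ → ξ < μ + δ → M.py z - δ < t → t < M.py z →
      (ξ, t) ∈ M.obstacles → ∃ s, M.tgt s = z ∧ ξ = M.fn s t := by
  -- What is left out reaches below the level of `z` only in the arcs that end in `z`. The rest is
  -- closed and misses the segment, so it keeps a positive distance from it.
  let O' := M.cover (fun v => M.py v ≠ M.py z) (fun i => M.tgt i ≠ z ∧ M.py (M.src i) < M.py z)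
    fun k => M.py (M.left k) ≠ M.py z
  have hO' : IsClosed O' := isClosed_cover
  have hK : IsCompact (Set.Icc (M.px z) μ ×ˢ {M.py z} : Set (ℝ × ℝ)) :=
    isCompact_Icc.prod isCompact_singleton
  obtain ⟨δ, hδ, hsub⟩ := hK.exists_thickening_subset_open hO'.isOpen_compl (by
    rintro ⟨ξ, τ⟩ ⟨⟨h1, h1'⟩, h2⟩
    simp only [Set.mem_singleton_iff] at h1 h1' h2
    subst h2
    rintro (⟨v, hv, e⟩ | ⟨i, ⟨hi, hi'⟩, h5, h6, h7⟩ | ⟨k, hk, h5, h6, h7⟩)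
    · exact hv (Prod.ext_iff.1 e).2.symm
    · simp only at h5 h6 h7
      rcases h1.eq_or_lt with h8 | h8
      · rcases M.avoid i z h5 h6 (h7.symm.trans h8.symm) with h9 | h9
        · rw [h9] at hi'; exact lt_irrefl _ hi'
        · exact hi h9.symm
      · have := H i hi' h6 (h7 ▸ h8)
        linarith
    · exact hk h5.symm)
  refine ⟨δ, hδ, fun ξ t h1 h2 h3 h4 hm => ?_⟩
  have hfar : (ξ, t) ∉ O' := by
    refine hsub (Metric.mem_thickening_iff.2 ⟨(max (M.px z) (min ξ μ), M.py z),
      ⟨⟨le_max_left _ _, max_le hμ (min_le_right _ _)⟩, rfl⟩, ?_⟩)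
    rw [Prod.dist_eq]
    refine max_lt ?_ ?_
    · simp only
      rw [Real.dist_eq, abs_lt]
      rcases max_cases (M.px z) (min ξ μ) with ⟨e, h⟩ | ⟨e, h⟩ <;>
        rcases min_cases ξ μ with ⟨e', h'⟩ | ⟨e', h'⟩ <;> constructor <;> rw [e] <;> linarith
    · simp only
      rw [Real.dist_eq, abs_lt]
      constructor <;> linarith
  rcases hm with ⟨v, -, e⟩ | ⟨i, -, hi⟩ | ⟨k, -, hk⟩
  · exact absurd (Or.inl ⟨v, fun h => h4.ne ((Prod.ext_iff.1 e).2.trans h), e⟩) hfar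
  · by_cases ht : M.tgt i = z
    · exact ⟨i, ht, hi.2.2⟩
    · exact absurd (Or.inr (Or.inl ⟨i, ⟨ht, lt_of_le_of_lt hi.1 h4⟩, hi⟩)) hfar
  · exact absurd (Or.inr (Or.inr ⟨k, fun h => h4.ne (hk.1.trans h), hk⟩)) hfar

open Filter Topology in
/-- Slightly below a horizontal segment that starts at `z` and meets no curve from below, the points
can be reached from `z`, and from the lower end of a curve that ends in `z` if there is any. -/
theorem access {z : V} {μ : ℝ} (hμ : M.px z < μ)
    (H : ∀ i, M.py (M.src i) < M.py z → M.py z ≤ M.py (M.tgt i) → M.px z < M.fn i (M.py z) →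
      μ < M.fn i (M.py z)) :
    ∀ᶠ t in 𝓝[<] (M.py z), M.DescendFrom z μ t ∧
      ((∃ s, M.tgt s = z) → ∃ s, M.tgt s = z ∧ M.ClimbFrom (M.src s) μ t) := by
  obtain ⟨δ, hδ, hbelow⟩ := below_segment hμ.le H
  obtain ⟨b, hb, hb'⟩ := M.exists_between_height (M.py z)
  have ev : ∀ s, ∀ᶠ t in 𝓝[<] (M.py z), M.tgt s = z → |M.fn s t - M.px z| < min δ (μ - M.px z) := by
    intro s
    refine nhdsWithin_le_nhds ?_
    by_cases hs : M.tgt s = z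
    · have hf : M.fn s (M.py z) = M.px z := by rw [← hs, M.fn_tgt]
      have h1 := ((M.cont s).tendsto (M.py z)).eventually
        (Metric.ball_mem_nhds _ (lt_min hδ (sub_pos.2 hμ)))
      filter_upwards [h1] with t ht _
      rwa [hf, Real.dist_eq] at ht
    · exact Eventually.of_forall fun t h => absurd h hs
  filter_upwards [eventually_all.2 ev, self_mem_nhdsWithin,
    nhdsWithin_le_nhds (lt_mem_nhds (sub_lt_self (M.py z) hδ)),
    nhdsWithin_le_nhds (lt_mem_nhds hb)] with t h1 h2 h3 h4
  rw [Set.mem_Iio] at h2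
  by_cases hs : ∃ s, M.tgt s = z
  · obtain ⟨s, hs', hmax⟩ := Set.exists_max_image {s | M.tgt s = z} (fun s => M.fn s t)
      (Set.toFinite _) hs
    have hs'' : M.tgt s = z := hs'
    obtain ⟨δ', hδ', hside⟩ := beside_arc (M := M) (i := s) (t := t)
      ((hb' _ (hs'' ▸ M.lt s)).trans h4) (by rw [hs'']; exact h2)
    have h5 := abs_lt.1 (h1 s hs')
    have m1 := min_le_left δ (μ - M.px z)
    have m2 := min_le_right δ (μ - M.px z)
    obtain ⟨ε, hε, hε'⟩ := exists_between (lt_min hδ' (by linarith : 0 < μ - M.fn s t))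
    have n1 := lt_of_lt_of_le hε' (min_le_left _ _)
    have n2 := lt_of_lt_of_le hε' (min_le_right _ _)
    obtain ⟨c1, c2⟩ := hside ε hε.ne' (by rwa [abs_of_pos hε])
    have hfree : ∀ ξ ∈ Set.uIcc (M.fn s t + ε) μ, (ξ, t) ∉ M.obstacles := by
      intro ξ hξ hm
      rw [Set.uIcc_of_le (by linarith), Set.mem_Icc] at hξ
      obtain ⟨s', hs1, rfl⟩ := hbelow ξ t (by linarith) (by linarith) h3 h2 hm
      have := hmax s' hs1
      linarith
    rw [hs''] at c2
    exact ⟨c2.slide isClosed_obstacles hfree, fun _ => ⟨s, hs', c1.slide isClosed_obstacles hfree⟩⟩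
  · refine ⟨?_, fun h => absurd h hs⟩
    -- No arc ends in `z`, so the straight line to `z` is free.
    obtain ⟨k, hk, k1, k2, k3⟩ := exists_line h2 μ (M.px z)
    refine ⟨h2, k, hk, k2, k1, fun τ h5 h6 hm => ?_⟩
    have hseg : segment ℝ (μ, t) (M.px z, M.py z) ⊆ Set.Icc (M.px z) μ ×ˢ (Set.univ : Set ℝ) :=
      ((convex_Icc _ _).prod convex_univ).segment_subset ⟨⟨hμ.le, le_rfl⟩, trivial⟩
        ⟨⟨le_rfl, hμ.le⟩, trivial⟩
    have h7 : M.px z ≤ k τ ∧ k τ ≤ μ := (hseg (k3 τ h5 h6.le)).1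
    obtain ⟨s', hs1, -⟩ := hbelow (k τ) τ (by linarith) (by linarith) (by linarith) h6 hm
    exact hs ⟨s', hs1⟩

end Scene

/-! ### Curves that climb to a common point -/

theorem exists_eq_of_lt_of_le {f g : ℝ → ℝ} (hf : Continuous f) (hg : Continuous g) {a b : ℝ}
    (hab : a ≤ b) (h1 : f a < g a) (h2 : g b ≤ f b) : ∃ t, a < t ∧ t ≤ b ∧ f t = g t := by
  obtain ⟨t, ⟨h3, h4⟩, h5⟩ := intermediate_value_Icc hab (hf.sub hg).continuousOn
    (⟨by simp only [Pi.sub_apply]; linarith, by simp only [Pi.sub_apply]; linarith⟩ :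
      (0 : ℝ) ∈ Set.Icc ((f - g) a) ((f - g) b))
  simp only [Pi.sub_apply] at h5
  refine ⟨t, lt_of_le_of_ne h3 ?_, h4, by linarith⟩
  rintro rfl
  linarith

namespace Scene

variable {V ι κ : Type*} {M : Scene V ι κ} {C : Set V} {r : V → V → Prop}

variable (M) in
/-- The vertices `v` and `a` are joined by a curve. -/
def Nb (v a : V) : Prop := ∃ i, (M.src i = v ∧ M.tgt i = a) ∨ (M.tgt i = v ∧ M.src i = a)

variable (M C r) in
/-- No curve can be inserted between vertices of `C` that are not related, and vertices that are
joined by a curve or have a common neighbour outside `C` are related. -/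
structure IsSaturated : Prop where
  equiv : Equivalence r
  cov : ∀ i, M.src i ∈ C ∨ M.tgt i ∈ C
  hor_mem : ∀ k, M.left k ∈ C ∧ M.right k ∈ C
  arc : ∀ i, M.src i ∈ C → M.tgt i ∈ C → r (M.src i) (M.tgt i)
  hor : ∀ k, r (M.left k) (M.right k)
  nbr : ∀ v ∉ C, ∀ a b, M.Nb v a → M.Nb v b → r a b
  iso : ∀ v ∉ C, ∃ a, M.Nb v a
  joins : ∀ u ∈ C, ∀ w ∈ C, Joins M.obstacles (M.px u) (M.py u) (M.px w) (M.py w) → r u w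
  horizontal : ∀ u ∈ C, ∀ w ∈ C, M.py u = M.py w → M.px u < M.px w →
    (∀ x, M.px u < x → x < M.px w → (x, M.py u) ∉ M.obstacles) → r u w

theorem IsSaturated.flipX (h : M.IsSaturated C r) : M.flipX.IsSaturated C r where
  equiv := h.equiv
  cov := h.cov
  hor_mem k := (h.hor_mem k).symm
  arc := h.arc
  hor k := h.equiv.symm (h.hor k)
  nbr := h.nbr
  iso := h.iso
  joins u hu w hw hj := by
    rw [obstacles_flipX] at hj
    exact h.joins u hu w hw (joins_of_reflectX hj)
  horizontal u hu w hw he hlt hfree := by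
    refine h.equiv.symm (h.horizontal w hw u hu he.symm (neg_lt_neg_iff.1 hlt) fun x h1 h2 => ?_)
    have := hfree (-x) (neg_lt_neg h2) (neg_lt_neg h1)
    rw [obstacles_flipX] at this
    have he' : M.py w = M.py u := he.symm
    rw [he']
    simp only [reflectX, Set.mem_ofPred_eq, neg_neg] at this
    exact this

variable (M C) in
/-- The vertex `c` of `C` represents the point `(x, Y)`: a curve climbs from `c` to this point, or `c`
is this point, or `c` is the lower end of a curve to a vertex outside `C` at this point. -/
def Anchor (x Y : ℝ) (c : V) : Prop :=
  c ∈ C ∧ (M.ClimbFrom c x Y ∨ (M.px c = x ∧ M.py c = Y) ∨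
    ∃ z ∉ C, M.px z = x ∧ M.py z = Y ∧ ∃ s, M.tgt s = z ∧ M.src s = c)

theorem Anchor.flipX {x Y : ℝ} {c : V} (h : M.Anchor C x Y c) : M.flipX.Anchor C (-x) Y c := by
  obtain ⟨hc, h | ⟨h1, h2⟩ | ⟨z, hz, h1, h2, h3⟩⟩ := h
  · exact ⟨hc, Or.inl (climbFrom_flipX.2 h)⟩
  · exact ⟨hc, Or.inr (Or.inl ⟨congrArg _ h1, h2⟩)⟩
  · exact ⟨hc, Or.inr (Or.inr ⟨z, hz, congrArg _ h1, h2, h3⟩)⟩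

variable [Finite V] [Finite ι] [Finite κ]

-- A climb is moved along the free segment and lowered, and a vertex of `C` at the point itself
-- descends. For a vertex `z` outside `C`, the point is reached from the lower end of some arc into
-- `z`; this may differ from `c`, but both are neighbours of `z` and hence related.
open Filter Topology in
theorem Anchor.below {x Y μ : ℝ} {c : V} (h : M.Anchor C x Y c) (hr : M.IsSaturated C r)
    (hμ : x < μ) (hfree : ∀ ξ, x < ξ → ξ ≤ μ → (ξ, Y) ∉ M.obstacles) :
    ∀ᶠ t in 𝓝[<] Y, (∃ d ∈ C, r d c ∧ M.ClimbFrom d μ t) ∨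
      (M.px c = x ∧ M.py c = Y ∧ M.DescendFrom c μ t) := by
  obtain ⟨hc, h | ⟨rfl, rfl⟩ | ⟨z, hz, rfl, rfl, s0, hs0, hs0'⟩⟩ := h
  · obtain ⟨ρ, hρ, h'⟩ := h.shift isClosed_obstacles (x' := μ) fun ξ hξ => by
      rw [Set.uIcc_of_le hμ.le, Set.mem_Icc] at hξ
      rcases hξ.1.eq_or_lt with rfl | h1
      · exact h.notMem
      · exact hfree ξ h1 hξ.2
    filter_upwards [self_mem_nhdsWithin, nhdsWithin_le_nhds (lt_mem_nhds (sub_lt_self Y hρ))]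
      with t h1 h2
    rw [Set.mem_Iio] at h1
    exact Or.inl ⟨c, hc, hr.equiv.refl c, h' t h2 (by linarith)⟩
  · filter_upwards [access hμ fun i h1 h2 h3 => not_le.1 fun h4 =>
      hfree _ h3 h4 (arc_mem_obstacles h1.le h2)] with t ht
    exact Or.inr ⟨rfl, rfl, ht.1⟩
  · filter_upwards [access hμ fun i h1 h2 h3 => not_le.1 fun h4 =>
      hfree _ h3 h4 (arc_mem_obstacles h1.le h2)] with t ht
    obtain ⟨s, hs, hcl⟩ := ht.2 ⟨s0, hs0⟩
    exact Or.inl ⟨M.src s, (hr.cov s).resolve_right (hs ▸ hz),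
      hr.nbr z hz _ _ ⟨s, Or.inr ⟨hs, rfl⟩⟩ ⟨s0, Or.inr ⟨hs0, hs0'⟩⟩, hcl⟩

open Filter Topology in
theorem Anchor.below' {x Y μ : ℝ} {c : V} (h : M.Anchor C x Y c) (hr : M.IsSaturated C r)
    (hμ : μ < x) (hfree : ∀ ξ, ξ < x → μ ≤ ξ → (ξ, Y) ∉ M.obstacles) :
    ∀ᶠ t in 𝓝[<] Y, (∃ d ∈ C, r d c ∧ M.ClimbFrom d μ t) ∨
      (M.px c = x ∧ M.py c = Y ∧ M.DescendFrom c μ t) := by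
  have := h.flipX.below hr.flipX (neg_lt_neg hμ) fun ξ h1 h2 hm => by
    rw [obstacles_flipX] at hm
    exact hfree (-ξ) (by linarith) (by linarith) hm
  filter_upwards [this] with t ht
  refine ht.imp (fun ⟨d, hd, h1, h2⟩ => ⟨d, hd, h1, climbFrom_flipX.1 h2⟩)
    fun ⟨h1, h2, h3⟩ => ⟨neg_injective h1, h2, descendFrom_flipX.1 h3⟩

/-- Consecutive points of a level are represented by related vertices. -/
theorem Anchor.related_of_consecutive {x x' Y : ℝ} {c c' : V} (h : M.Anchor C x Y c)
    (h' : M.Anchor C x' Y c') (hr : M.IsSaturated C r) (hx : x < x')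
    (hIH : ∀ ξ t u u', t < Y → u ∈ C → u' ∈ C → M.ClimbFrom u ξ t → M.ClimbFrom u' ξ t → r u u')
    (harc : ∀ i, M.py (M.src i) ≤ Y → Y < M.py (M.tgt i) → x < M.fn i Y → x' ≤ M.fn i Y)
    (hv : ∀ v, M.py v = Y → x < M.px v → x' ≤ M.px v) : r c c' := by
  -- A segment of the drawing that meets the gap covers it entirely. Its points are neither ends of
  -- climbs nor vertices outside `C`, so the representatives are ends of this segment.
  by_cases hk : ∃ k ξ, M.py (M.left k) = Y ∧ x < ξ ∧ ξ < x' ∧ M.px (M.left k) ≤ ξ ∧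
      ξ ≤ M.px (M.right k)
  · obtain ⟨k, ξ, hY, h1, h2, h3, h4⟩ := hk
    have hl : M.px (M.left k) ≤ x := by
      by_contra hc
      have := hv _ hY (not_le.1 hc)
      linarith
    have hR : x' ≤ M.px (M.right k) := hv _ ((M.py_eq k).symm.trans hY) (by linarith)
    have key : ∀ {y d}, M.Anchor C y Y d → M.px (M.left k) ≤ y → y ≤ M.px (M.right k) →
        M.px d = y ∧ (d = M.left k ∨ d = M.right k) := by
      rintro y d ⟨hd, h | ⟨rfl, h⟩ | ⟨z, hz, rfl, h, -⟩⟩ h5 h6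
      · have := hor_mem_obstacles h5 h6
        rw [hY] at this
        exact absurd this h.notMem
      · exact ⟨rfl, M.avoid_hor k d (h.trans hY.symm) h5 h6⟩
      · rcases M.avoid_hor k z (h.trans hY.symm) h5 h6 with rfl | rfl
        · exact absurd (hr.hor_mem k).1 hz
        · exact absurd (hr.hor_mem k).2 hz
    obtain ⟨e1, e2⟩ := key h hl (by linarith)
    obtain ⟨e1', e2'⟩ := key h' (by linarith) hR
    rcases e2 with rfl | rfl
    · rcases e2' with rfl | rfl
      · exact hr.equiv.refl _
      · exact hr.hor k
    · linarith
  have hfree : ∀ ξ, x < ξ → ξ < x' → (ξ, Y) ∉ M.obstacles := by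
    rintro ξ h1 h2 (⟨v, -, e⟩ | ⟨i, -, h3, h4, h5⟩ | ⟨k, -, h3, h4, h5⟩)
    · obtain ⟨rfl, rfl⟩ := Prod.ext_iff.1 e
      exact absurd (hv v rfl h1) (not_le.2 h2)
    · simp only at h3 h4 h5
      subst h5
      rcases h4.eq_or_lt with rfl | h4
      · rw [M.fn_tgt] at h1 h2
        exact absurd (hv _ rfl h1) (not_le.2 h2)
      · exact absurd (harc i h3 h4 h1) (not_le.2 h2)
    · exact hk ⟨k, ξ, h3.symm, h1, h2, h4, h5⟩
  -- Both representatives reach a point slightly below the middle of the free gap. Two climbs are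
  -- covered by the induction hypothesis, a climb and a descent form a free curve, and two descents
  -- occur only if both are vertices at the ends of the free gap.
  obtain ⟨t, ⟨h1, h2⟩, ht⟩ := (((h.below hr (μ := (x + x') / 2) (by linarith) fun ξ h1 h2 =>
    hfree ξ h1 (by linarith)).and (h'.below' hr (μ := (x + x') / 2) (by linarith) fun ξ h1 h2 =>
      hfree ξ (by linarith) h1)).and self_mem_nhdsWithin).exists
  rcases h1 with ⟨d, hd, hdc, hcl⟩ | ⟨e1, e2, hde⟩ <;>
    rcases h2 with ⟨d', hd', hdc', hcl'⟩ | ⟨e1', e2', hde'⟩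
  · exact hr.equiv.trans (hr.equiv.symm hdc) (hr.equiv.trans (hIH _ _ _ _ ht hd hd' hcl hcl') hdc')
  · exact hr.equiv.trans (hr.equiv.symm hdc) (hr.joins d hd c' h'.1 (hcl.joins hde'))
  · exact hr.equiv.symm (hr.equiv.trans (hr.equiv.symm hdc') (hr.joins d' hd' c h.1
      (hcl'.joins hde)))
  · refine hr.horizontal c h.1 c' h'.1 (e2.trans e2'.symm) (by linarith) fun ξ h1 h2 => ?_
    rw [e2]
    exact hfree ξ (by linarith) (by linarith)

/-- Points of a level with no upwards curve in between are represented by related vertices. -/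
theorem Anchor.related (hr : M.IsSaturated C r) {Y : ℝ}
    (hIH : ∀ ξ t u u', t < Y → u ∈ C → u' ∈ C → M.ClimbFrom u ξ t → M.ClimbFrom u' ξ t → r u u')
    (n : ℕ) : ∀ {x x' : ℝ} {c c' : V}, M.Anchor C x Y c → M.Anchor C x' Y c' → x < x' →
      (∀ i, M.py (M.src i) ≤ Y → Y < M.py (M.tgt i) → x < M.fn i Y → x' ≤ M.fn i Y) →
      {v | M.py v = Y ∧ x < M.px v ∧ M.px v < x'}.ncard ≤ n → r c c' := by
  induction n with
  | zero =>
    intro x x' c c' h h' hx harc hn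
    refine h.related_of_consecutive h' hr hx hIH harc fun v hv h1 => not_lt.1 fun h2 => ?_
    have := (Set.ncard_pos (Set.toFinite _)).2
      (⟨v, hv, h1, h2⟩ : {v | M.py v = Y ∧ x < M.px v ∧ M.px v < x'}.Nonempty)
    omega
  | succ n ih =>
    intro x x' c c' h h' hx harc hn
    by_cases hz : ∃ z, M.py z = Y ∧ x < M.px z ∧ M.px z < x'
    · obtain ⟨z, hz, h1, h2⟩ := hz
      have hd : ∃ d, M.Anchor C (M.px z) Y d := by
        by_cases hzC : z ∈ C
        · exact ⟨z, hzC, Or.inr (Or.inl ⟨rfl, hz⟩)⟩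
        -- No arc leads upwards from `z`, so its neighbour lies below and represents it.
        · obtain ⟨a, i, ⟨h3, -⟩ | ⟨h3, h4⟩⟩ := hr.iso z hzC
          · have h5 : M.fn i Y = M.px z := by rw [← hz, ← h3, M.fn_src]
            have := harc i (by rw [h3, hz]) (by rw [← hz, ← h3]; exact M.lt i) (by rw [h5]; exact h1)
            linarith
          · exact ⟨a, h4 ▸ (hr.cov i).resolve_right (h3 ▸ hzC),
              Or.inr (Or.inr ⟨z, hzC, rfl, hz, i, h3, h4⟩)⟩
      obtain ⟨d, hd⟩ := hd
      have hlt1 : {v | M.py v = Y ∧ x < M.px v ∧ M.px v < M.px z}.ncard <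
          {v | M.py v = Y ∧ x < M.px v ∧ M.px v < x'}.ncard :=
        Set.ncard_lt_ncard ⟨fun v ⟨a1, a2, a3⟩ => ⟨a1, a2, a3.trans h2⟩, fun hs =>
          lt_irrefl _ (hs (show z ∈ _ from ⟨hz, h1, h2⟩)).2.2⟩ (Set.toFinite _)
      have hlt2 : {v | M.py v = Y ∧ M.px z < M.px v ∧ M.px v < x'}.ncard <
          {v | M.py v = Y ∧ x < M.px v ∧ M.px v < x'}.ncard :=
        Set.ncard_lt_ncard ⟨fun v ⟨a1, a2, a3⟩ => ⟨a1, h1.trans a2, a3⟩, fun hs =>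
          lt_irrefl _ (hs (show z ∈ _ from ⟨hz, h1, h2⟩)).2.1⟩ (Set.toFinite _)
      refine hr.equiv.trans (ih h hd h1 (fun i h3 h4 h5 => ?_) (by omega))
        (ih hd h' h2 (fun i h3 h4 h5 => harc i h3 h4 (h1.trans h5)) (by omega))
      exact h2.le.trans (harc i h3 h4 h5)
    · exact h.related_of_consecutive h' hr hx hIH harc fun v hv h1 => not_lt.1 fun h2 =>
        hz ⟨v, hv, h1, h2⟩

/-- Vertices of `C` from which curves climb to a common point are related. -/
theorem IsSaturated.related_of_climb (hr : M.IsSaturated C r) (n : ℕ) : ∀ {x y : ℝ} {u u' : V},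
    {v | M.py v < y}.ncard ≤ n → u ∈ C → u' ∈ C → M.ClimbFrom u x y → M.ClimbFrom u' x y →
      r u u' := by
  induction n with
  | zero =>
    intro x y u u' hn _ _ h _
    have := (Set.ncard_pos (Set.toFinite _)).2 (⟨u, h.1⟩ : {v | M.py v < y}.Nonempty)
    omega
  | succ n ih =>
    intro x y u u' hn hu hu' ⟨huy, g, hg, g1, g2, g3⟩ ⟨huy', g', hg', g1', g2', g3'⟩
    -- `Y` is the highest vertex level below `y`, so an arc that continues above `Y` reaches height
    -- `y`.
    obtain ⟨v0, hv0, hmax⟩ := Set.exists_max_image {v | M.py v < y} M.py (Set.toFinite _) ⟨u, huy⟩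
    rw [Set.mem_ofPred_eq] at hv0
    set Y := M.py v0 with hY
    have hcard : ∀ t ≤ Y, {v | M.py v < t}.ncard ≤ n := fun t ht => by
      have : {v | M.py v < t}.ncard < {v | M.py v < y}.ncard :=
        Set.ncard_lt_ncard ⟨fun v hv => lt_trans (lt_of_lt_of_le hv ht) hv0, fun hs =>
          absurd (hs hv0) (not_lt.2 ht)⟩ (Set.toFinite _)
      omega
    have hIH : ∀ ξ t u u', t < Y → u ∈ C → u' ∈ C → M.ClimbFrom u ξ t → M.ClimbFrom u' ξ t →
        r u u' := fun ξ t u u' ht => ih (hcard t ht.le)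
    have hanchor : ∀ {u g}, u ∈ C → M.py u < y → Continuous g → g (M.py u) = M.px u →
        (∀ t, M.py u < t → t ≤ y → (g t, t) ∉ M.obstacles) → M.py u ≤ Y ∧
          ((M.py u = Y ∧ M.px u = g Y) ∨ M.ClimbFrom u (g Y) Y) := by
      intro u g hu huy hg g1 g3
      refine ⟨hmax u huy, ?_⟩
      rcases (hmax u huy).eq_or_lt with h | h
      · exact Or.inl ⟨h, by rw [← h, g1]⟩
      · exact Or.inr ⟨h, g, hg, g1, rfl, fun t h1 h2 => g3 t h1 (by linarith)⟩
    obtain ⟨a1, a2⟩ := hanchor hu huy hg g1 g3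
    obtain ⟨a1', a2'⟩ := hanchor hu' huy' hg' g1' g3'
    have hA : M.Anchor C (g Y) Y u := ⟨hu, a2.elim (fun h => Or.inr (Or.inl ⟨h.2, h.1⟩)) Or.inl⟩
    have hA' : M.Anchor C (g' Y) Y u' := ⟨hu', a2'.elim (fun h => Or.inr (Or.inl ⟨h.2, h.1⟩)) Or.inl⟩
    have htop : ∀ i, Y < M.py (M.tgt i) → y ≤ M.py (M.tgt i) := fun i hi => not_lt.1 fun h =>
      absurd (hmax _ h) (not_le.2 hi)
    -- Such an arc between the two curves would hit one of them by height `y`, where the curves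
    -- meet.
    have harc : ∀ {u u' g g'}, M.py u ≤ Y → M.py u' ≤ Y → Continuous g → Continuous g' → g y = x →
        g' y = x → (∀ t, M.py u < t → t ≤ y → (g t, t) ∉ M.obstacles) →
        (∀ t, M.py u' < t → t ≤ y → (g' t, t) ∉ M.obstacles) →
        ∀ i, M.py (M.src i) ≤ Y → Y < M.py (M.tgt i) → g Y < M.fn i Y → g' Y ≤ M.fn i Y := by
      intro u u' g g' hu hu' hg hg' g2 g2' g3 g3' i h1 h2 h3
      by_contra h4
      have h5 := htop i h2
      rcases le_total (M.fn i y) x with h6 | h6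
      · obtain ⟨t, h7, h8, h9⟩ := exists_eq_of_lt_of_le hg (M.cont i) hv0.le h3 (by rw [g2]; exact h6)
        have := g3 t (by linarith) h8
        rw [h9] at this
        exact this (arc_mem_obstacles (by linarith) (by linarith))
      · obtain ⟨t, h7, h8, h9⟩ := exists_eq_of_lt_of_le (M.cont i) hg' hv0.le (not_le.1 h4)
          (by rw [g2']; exact h6)
        have := g3' t (by linarith) h8
        rw [← h9] at this
        exact this (arc_mem_obstacles (by linarith) (by linarith))
    rcases lt_trichotomy (g Y) (g' Y) with h | h | h
    · exact Anchor.related hr hIH _ hA hA' h (harc a1 a1' hg hg' g2 g2' g3 g3') le_rfl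
    · rw [← h] at a2'
      rcases a2 with ⟨e1, e2⟩ | a2 <;> rcases a2' with ⟨e1', e2'⟩ | a2'
      · rw [M.inj u u' (e2.trans e2'.symm) (e1.trans e1'.symm)]
        exact hr.equiv.refl _
      · have := vertex_mem_obstacles (M := M) u
        rw [e1, e2] at this
        exact absurd this a2'.notMem
      · have := vertex_mem_obstacles (M := M) u'
        rw [e1', e2'] at this
        exact absurd this a2.notMem
      · exact ih (hcard Y le_rfl) hu hu' a2 a2'
    · exact hr.equiv.symm (Anchor.related hr hIH _ hA' hA h
        (harc a1' a1 hg' hg g2' g2 g3' g3) le_rfl)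

end Scene

/-! ### From every component a curve leads above the drawing -/

/-- Close to `f`, on the side of `x`, there is a point such that the segment to `x` avoids `f`. -/
theorem exists_offset {f x δ : ℝ} (h : f ≠ x) (hδ : 0 < δ) : ∃ ε, ε ≠ 0 ∧ |ε| < δ ∧
    ∀ ξ ∈ Set.uIcc (f + ε) x, ξ ≠ f ∧ |ξ - x| ≤ |f - x| := by
  rcases h.lt_or_gt with h | h
  · obtain ⟨ε, h1, h2⟩ := exists_between (lt_min hδ (sub_pos.2 h))
    have m1 := lt_of_lt_of_le h2 (min_le_left _ _)
    have m2 := lt_of_lt_of_le h2 (min_le_right _ _)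
    refine ⟨ε, h1.ne', by rwa [abs_of_pos h1], fun ξ hξ => ?_⟩
    rw [Set.uIcc_of_le (by linarith), Set.mem_Icc] at hξ
    refine ⟨by rintro rfl; linarith, ?_⟩
    rw [abs_of_nonpos (by linarith), abs_of_nonpos (by linarith)]
    linarith
  · obtain ⟨ε, h1, h2⟩ := exists_between (lt_min hδ (sub_pos.2 h))
    have m1 := lt_of_lt_of_le h2 (min_le_left _ _)
    have m2 := lt_of_lt_of_le h2 (min_le_right _ _)
    refine ⟨-ε, neg_ne_zero.2 h1.ne', by rwa [abs_neg, abs_of_pos h1], fun ξ hξ => ?_⟩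
    rw [Set.uIcc_of_ge (by linarith), Set.mem_Icc] at hξ
    refine ⟨by rintro rfl; linarith, ?_⟩
    rw [abs_of_nonneg (by linarith), abs_of_nonneg (by linarith)]
    linarith

namespace Scene

variable {V ι κ : Type*} {M : Scene V ι κ} {C : Set V} {r : V → V → Prop}

variable (M C r) in
/-- The vertices of `C` related to `u` and the vertices outside `C` with such a neighbour. -/
def componentOf (u : V) : Set V :=
  {z | (z ∈ C ∧ r u z) ∨ (z ∉ C ∧ ∃ a ∈ C, M.Nb z a ∧ r u a)}

theorem Nb.symm {v a : V} (h : M.Nb v a) : M.Nb a v := by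
  obtain ⟨i, h⟩ := h
  exact ⟨i, h.symm.imp (fun h => ⟨h.2, h.1⟩) fun h => ⟨h.2, h.1⟩⟩

theorem IsSaturated.mem_of_nb (hr : M.IsSaturated C r) {v a : V} (h : M.Nb v a) (hv : v ∉ C) :
    a ∈ C := by
  obtain ⟨i, ⟨rfl, rfl⟩ | ⟨rfl, rfl⟩⟩ := h
  · exact (hr.cov i).resolve_left hv
  · exact (hr.cov i).resolve_right hv

theorem IsSaturated.componentOf_nb (hr : M.IsSaturated C r) {u z w : V}
    (hz : z ∈ M.componentOf C r u) (h : M.Nb z w) : w ∈ M.componentOf C r u := by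
  rcases hz with ⟨hz, hu⟩ | ⟨hz, a, ha, hza, hu⟩
  · by_cases hw : w ∈ C
    · refine Or.inl ⟨hw, hr.equiv.trans hu ?_⟩
      obtain ⟨i, ⟨rfl, rfl⟩ | ⟨rfl, rfl⟩⟩ := h
      · exact hr.arc i hz hw
      · exact hr.equiv.symm (hr.arc i hw hz)
    · exact Or.inr ⟨hw, z, hz, h.symm, hu⟩
  · exact Or.inl ⟨hr.mem_of_nb h hz, hr.equiv.trans hu (hr.nbr z hz a w hza h)⟩

theorem exists_generic [Finite V] (M : Scene V ι κ) {a b : ℝ} (h : a < b) :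
    ∃ x, a < x ∧ x < b ∧ ∀ v, M.px v ≠ x := by
  obtain ⟨x, h1, h2⟩ := (Set.Ioo_infinite h).exists_notMem_finite (Set.finite_range M.px)
  exact ⟨x, h1.1, h1.2, fun v hv => h2 ⟨v, hv⟩⟩

variable [Finite V] [Finite ι] [Finite κ]

/-- From a highest vertex of a component a curve leads upwards. -/
theorem IsSaturated.exists_start (hr : M.IsSaturated C r) {u z : V} {H : ℝ} (hH : M.py z < H)
    (hz : z ∈ M.componentOf C r u) (hout : ∀ i, M.src i ≠ z) :
    ∃ c ∈ C, r u c ∧ ∃ x y, M.py z ≤ y ∧ y < H ∧ (∀ v, M.px v ≠ x) ∧ M.ClimbFrom c x y := by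
  rcases hz with ⟨hz, hu⟩ | ⟨hz, a, ha, hza, hu⟩
  -- Near `z` there are only arcs that end in `z` and segments on its level. None of them reaches
  -- above this level, so a short line upwards is free.
  · have hcl : IsClosed (M.cover (fun v => v ≠ z) (fun i => M.tgt i ≠ z)
      fun k => M.py (M.left k) ≠ M.py z) := isClosed_cover
    obtain ⟨δ, hδ, hball⟩ := Metric.isOpen_iff.1 hcl.isOpen_compl (M.px z, M.py z) (by
      rintro (⟨v, hv, e⟩ | ⟨i, hi, h5, h6, h7⟩ | ⟨k, hk, h5, -⟩)
      · obtain ⟨e1, e2⟩ := Prod.ext_iff.1 e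
        exact hv (M.inj _ _ e1.symm e2.symm)
      · exact (M.avoid i z h5 h6 h7.symm).elim (fun h => hout i h.symm) fun h => hi h.symm
      · exact hk h5.symm)
    obtain ⟨x, hx1, hx2, hx⟩ := M.exists_generic (lt_add_of_pos_right (M.px z) hδ)
    obtain ⟨y, hy1, hy2⟩ := exists_between (lt_min (lt_add_of_pos_right (M.py z) hδ) hH)
    have m1 := lt_of_lt_of_le hy2 (min_le_left _ _)
    have m2 := lt_of_lt_of_le hy2 (min_le_right _ _)
    obtain ⟨k, hk, k1, k2, k3⟩ := exists_line hy1 (M.px z) x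
    refine ⟨z, hz, hu, x, y, hy1.le, m2, hx, hy1, k, hk, k1, k2, fun t h1 h2 hm => ?_⟩
    have hseg : segment ℝ (M.px z, M.py z) (x, y) ⊆ Metric.ball (M.px z, M.py z) δ := by
      refine (convex_ball _ _).segment_subset (Metric.mem_ball_self hδ) ?_
      rw [Metric.mem_ball, Prod.dist_eq]
      refine max_lt ?_ ?_ <;> simp only [Real.dist_eq] <;> rw [abs_lt] <;> constructor <;> linarith
    have hfar := hball (hseg (k3 t h1.le h2))
    rcases hm with ⟨v, -, e⟩ | ⟨i, -, hi⟩ | ⟨k', -, hk'⟩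
    · exact hfar (Or.inl ⟨v, fun h => h1.ne' ((Prod.ext_iff.1 e).2.trans (by rw [h])), e⟩)
    · exact hfar (Or.inr (Or.inl ⟨i, fun h => absurd hi.2.1 (by rw [h]; exact not_le.2 h1), hi⟩))
    · exact hfar (Or.inr (Or.inr ⟨k', fun h => h1.ne' (hk'.1.trans h), hk'⟩))
  -- A vertex outside `C` cannot serve as a start. The curve follows one of its arcs from a vertex
  -- of `C` and then rises vertically to the level of `z`, just to its right.
  · obtain ⟨s0, hs0⟩ : ∃ s, M.tgt s = z := by
      obtain ⟨b, i, ⟨h, -⟩ | ⟨h, -⟩⟩ := hr.iso z hz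
      exacts [absurd h (hout i), ⟨i, h⟩]
    have hcl : IsClosed (M.cover (fun v => v ≠ z) (fun i => M.tgt i ≠ z) fun _ => True) :=
      isClosed_cover
    obtain ⟨δ, hδ, hball⟩ := Metric.isOpen_iff.1 hcl.isOpen_compl (M.px z, M.py z) (by
      rintro (⟨v, hv, e⟩ | ⟨i, hi, h5, h6, h7⟩ | ⟨k, -, h5, h6, h7⟩)
      · obtain ⟨e1, e2⟩ := Prod.ext_iff.1 e
        exact hv (M.inj _ _ e1.symm e2.symm)
      · exact (M.avoid i z h5 h6 h7.symm).elim (fun h => hout i h.symm) fun h => hi h.symm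
      · rcases M.avoid_hor k z h5 h6 h7 with rfl | rfl
        exacts [hz (hr.hor_mem k).1, hz (hr.hor_mem k).2])
    obtain ⟨μ, hx1, hx2, hx⟩ := M.exists_generic (lt_add_of_pos_right (M.px z) hδ)
    have hfree : ∀ ξ, M.px z < ξ → ξ ≤ μ → (ξ, M.py z) ∉ M.obstacles := by
      intro ξ h1 h2 hm
      have hfar := @hball (ξ, M.py z) (by
        rw [Metric.mem_ball, Prod.dist_eq]
        refine max_lt ?_ (by simpa using hδ)
        simp only [Real.dist_eq]
        rw [abs_lt]; constructor <;> linarith)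
      rcases hm with ⟨v, -, e⟩ | ⟨i, -, hi⟩ | ⟨k', -, hk'⟩
      · exact hfar (Or.inl ⟨v, fun h => h1.ne' ((Prod.ext_iff.1 e).1.trans (by rw [h])), e⟩)
      · refine hfar (Or.inr (Or.inl ⟨i, fun h => h1.ne' ?_, hi⟩))
        have e : ξ = M.fn i (M.py z) := hi.2.2
        rw [e, ← h, M.fn_tgt]
      · exact hfar (Or.inr (Or.inr ⟨k', trivial, hk'⟩))
    have hev : ∀ᶠ t in nhds (M.py z), (μ, t) ∈ M.obstaclesᶜ :=
      (by fun_prop : Continuous fun t : ℝ => (μ, t)).continuousAt.eventually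
        (isClosed_obstacles.isOpen_compl.mem_nhds (hfree μ hx1 le_rfl))
    obtain ⟨ρ, hρ, hvert⟩ := Metric.eventually_nhds_iff.1 hev
    obtain ⟨t, ⟨⟨-, hacc⟩, ht1⟩, ht2⟩ := (((access hx1 fun i h1 h2 h3 => not_le.1 fun h4 =>
      hfree _ h3 h4 (arc_mem_obstacles h1.le h2)).and self_mem_nhdsWithin).and
        (nhdsWithin_le_nhds (lt_mem_nhds (sub_lt_self (M.py z) hρ)))).exists
    obtain ⟨s, hs, hcl⟩ := hacc ⟨s0, hs0⟩
    have hnb : M.Nb z (M.src s) := ⟨s, Or.inr ⟨hs, rfl⟩⟩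
    refine ⟨M.src s, hr.mem_of_nb hnb hz, hr.equiv.trans hu (hr.nbr z hz a _ hza hnb), μ, M.py z,
      le_rfl, hH, hx, hcl.extend ht1 continuous_const rfl rfl fun τ h1 h2 => hvert ?_⟩
    rw [Real.dist_eq, abs_lt]
    constructor <;> linarith

/-- Every component contains a vertex from which a curve leads above the drawing. -/
theorem IsSaturated.exists_climb (hr : M.IsSaturated C r) {u : V} (hu : u ∈ C) {H : ℝ}
    (hH : ∀ v, M.py v < H) : ∃ c ∈ C, r u c ∧ M.ClimbFrom c 0 H := by
  have hmem : ∀ {c}, c ∈ C → r u c → c ∈ M.componentOf C r u := fun hc h => Or.inl ⟨hc, h⟩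
  obtain ⟨z, hz, hmax⟩ := Set.exists_max_image (M.componentOf C r u) M.py (Set.toFinite _)
    ⟨u, hmem hu (hr.equiv.refl u)⟩
  have hout : ∀ i, M.src i ≠ z := fun i hi => by
    have h1 := hmax _ (hr.componentOf_nb hz ⟨i, Or.inl ⟨hi, rfl⟩⟩)
    have h2 := M.lt i
    rw [hi] at h2
    exact absurd h1 (not_le.2 h2)
  obtain ⟨c, hc, huc, x, y, hy1, hy2, hx, hcl⟩ := hr.exists_start (hH z) hz hout
  -- The curve is continued vertically at an abscissa that no vertex has. A first hit would be
  -- interior to an arc or a segment and is excluded by the choice of `z` as a highest vertex of the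
  -- component.
  by_cases hne : ({τ | (x, τ) ∈ M.obstacles} ∩ Set.Icc y H).Nonempty
  · have hcomp : IsCompact ({τ | (x, τ) ∈ M.obstacles} ∩ Set.Icc y H) :=
      isCompact_Icc.inter_left (isClosed_obstacles.preimage
        (by fun_prop : Continuous fun t : ℝ => (x, t)))
    obtain ⟨τ, ⟨hτ, hτ1, hτ2⟩, hleast⟩ := hcomp.exists_isLeast hne
    rw [Set.mem_ofPred_eq] at hτ
    have hyτ : y < τ := lt_of_le_of_ne hτ1 fun e => hcl.notMem (e ▸ hτ)
    have hvert : ∀ t, y ≤ t → t < τ → (x, t) ∉ M.obstacles := fun t h1 h2 hm =>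
      absurd (hleast ⟨hm, h1, by linarith⟩) (not_le.2 h2)
    have hclimb : ∀ t, y < t → t < τ → M.ClimbFrom c x t := fun t h1 h2 =>
      hcl.extend h1 continuous_const rfl rfl fun t' h3 h4 => hvert t' h3 (by linarith)
    exfalso
    by_cases hhor : ∃ k, (x, τ) ∈ M.horSet k
    · obtain ⟨k, hk1, hk2, hk3⟩ := hhor
      simp only at hk1 hk2 hk3
      have h1 := lt_of_le_of_ne hk2 (hx _)
      have h2 := lt_of_le_of_ne hk3 (hx _).symm
      -- Below a segment, the curve meets a descent from the left end of the segment. That end would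
      -- belong to the component and lie above `z`.
      obtain ⟨t, ⟨⟨hd, -⟩, ht1⟩, ht2⟩ := (((access (M := M) (z := M.left k) h1 fun i a1 a2 a3 =>
        not_le.1 fun a4 => by
          rcases M.cross_hor i k a1.le a2 a3.le (a4.trans hk3) with h | h <;> linarith).and
            self_mem_nhdsWithin).and (nhdsWithin_le_nhds (lt_mem_nhds (hk1 ▸ hyτ)))).exists
      rw [← hk1] at ht1
      have hj := (hclimb t ht2 ht1).joins hd
      have := hmax _ (hmem (hr.hor_mem k).1
        (hr.equiv.trans huc (hr.joins c hc _ (hr.hor_mem k).1 hj)))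
      linarith
    rcases hτ with ⟨v, -, e⟩ | ⟨s, -, hs1, hs2, hs3⟩ | ⟨k, -, hk⟩
    · exact hx v (Prod.ext_iff.1 e).1.symm
    · simp only at hs1 hs2 hs3
      have h1 : M.py (M.src s) < τ := lt_of_le_of_ne hs1 fun e =>
        hx (M.src s) (by rw [hs3, ← e, M.fn_src])
      have h2 : τ < M.py (M.tgt s) := lt_of_le_of_ne hs2 fun e =>
        hx (M.tgt s) (by rw [hs3, e, M.fn_tgt])
      have hclosed : IsClosed (M.cover (fun _ => True) (fun j => j ≠ s) fun _ => True) :=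
        isClosed_cover
      obtain ⟨δ, hδ, hball⟩ := Metric.isOpen_iff.1 hclosed.isOpen_compl (x, τ) (by
        rintro (⟨v, -, e⟩ | ⟨i, hi, h5, h6, h7⟩ | ⟨k, -, hk⟩)
        · exact hx v (Prod.ext_iff.1 e).1.symm
        · exact ArcSystem.fn_ne_of_interior hi h5 h6 h1.le h2.le (Or.inr ⟨h1, h2⟩)
            (h7.symm.trans hs3)
        · exact hhor ⟨k, hk⟩)
      have hev : ∀ᶠ t in nhds τ, |M.fn s t - x| < δ := by
        have h := ((M.cont s).tendsto τ).eventually (Metric.ball_mem_nhds _ hδ)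
        filter_upwards [h] with t ht
        rw [hs3]
        exact ht
      have hev' : ∀ᶠ t in nhdsWithin τ (Set.Iio τ), |M.fn s t - x| < δ := nhdsWithin_le_nhds hev
      obtain ⟨t, ⟨⟨⟨ht0, ht1⟩, ht2⟩, ht3⟩, ht4⟩ := ((((hev'.and self_mem_nhdsWithin).and
          (nhdsWithin_le_nhds (lt_mem_nhds hyτ))).and (nhdsWithin_le_nhds (lt_mem_nhds h1))).and
            (nhdsWithin_le_nhds (lt_mem_nhds (sub_lt_self τ hδ)))).exists
      have hct := hclimb t ht2 ht1
      have hst : M.fn s t ≠ x := fun e => by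
        have := arc_mem_obstacles (M := M) ht3.le (by linarith : t ≤ M.py (M.tgt s))
        rw [e] at this
        exact hct.notMem this
      obtain ⟨δ', hδ', hside⟩ := beside_arc ht3 (by linarith : t < M.py (M.tgt s))
      obtain ⟨ε, hε, hε', hoff⟩ := exists_offset hst hδ'
      have hfree : ∀ ξ ∈ Set.uIcc (M.fn s t + ε) x, (ξ, t) ∉ M.obstacles := by
        intro ξ hξ hm
        obtain ⟨o1, o2⟩ := hoff ξ hξ
        have hfar := @hball (ξ, t) (by
          rw [Metric.mem_ball, Prod.dist_eq]
          refine max_lt (o2.trans_lt ht0) ?_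
          simp only [Real.dist_eq]
          rw [abs_lt]; constructor <;> linarith)
        rcases hm with hv | ⟨i, -, hi⟩ | hk
        · exact hfar (Or.inl hv)
        · by_cases his : i = s
          · subst his
            exact o1 hi.2.2
          · exact hfar (Or.inr (Or.inl ⟨i, his, hi⟩))
        · exact hfar (Or.inr (Or.inr hk))
      obtain ⟨c1, c2⟩ := hside ε hε hε'
      have c1' := c1.slide isClosed_obstacles hfree
      have c2' := c2.slide isClosed_obstacles hfree
      -- Just below the hit, a point beside the arc is reached from both ends of `s`. If the lower
      -- end is in `C`, two climbs meet there; if the upper end is in `C`, a climb meets a descent.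
      -- In both cases the upper end joins the component.
      have htgt : M.tgt s ∈ M.componentOf C r u := by
        rcases hr.cov s with hsC | hsC
        · exact hr.componentOf_nb (hmem hsC (hr.equiv.trans huc
            (hr.related_of_climb _ le_rfl hc hsC hct c1'))) ⟨s, Or.inl ⟨rfl, rfl⟩⟩
        · exact hmem hsC (hr.equiv.trans huc (hr.joins c hc _ hsC (hct.joins c2')))
      have := hmax _ htgt
      linarith
    · exact hhor ⟨k, hk⟩
  · have h1 : M.ClimbFrom c x H := hcl.extend hy2 continuous_const rfl rfl fun t h1 h2 hm =>
      hne ⟨t, hm, h1, h2⟩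
    -- Level `H` lies above the drawing, so all components can be led to the same point with
    -- abscissa 0.
    refine ⟨c, hc, huc, h1.slide isClosed_obstacles ?_⟩
    rintro ξ - (⟨v, -, e⟩ | ⟨i, -, -, h, -⟩ | ⟨k, -, h, -⟩)
    · exact (hH v).ne (Prod.ext_iff.1 e).2.symm
    · exact absurd h (not_le.2 (hH _))
    · exact (hH _).ne h.symm

/-- In a saturated scene all vertices of the cover are related. -/
theorem IsSaturated.related (hr : M.IsSaturated C r) {u u' : V} (hu : u ∈ C) (hu' : u' ∈ C) :
    r u u' := by
  obtain ⟨z, -, hz⟩ := Set.exists_max_image Set.univ M.py (Set.toFinite _) ⟨u, trivial⟩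
  have hH : ∀ v, M.py v < M.py z + 1 := fun v => lt_of_le_of_lt (hz v trivial) (lt_add_one _)
  obtain ⟨c, hc, huc, h⟩ := hr.exists_climb hu hH
  obtain ⟨c', hc', huc', h'⟩ := hr.exists_climb hu' hH
  exact hr.equiv.trans huc (hr.equiv.trans (hr.related_of_climb _ le_rfl hc hc' h h')
    (hr.equiv.symm huc'))

end Scene

/-! ### Visibility extensions are saturated -/

namespace LevelGraph.Drawing

variable {V : Type*} {G : LevelGraph V} {Γ : G.Drawing} {C : Finset V} {S : Set (Arc V)}

theorem NonCrossing.symm {A B : Arc V} (h : Γ.NonCrossing A B) : Γ.NonCrossing B A := by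
  rintro p ⟨h1, h2⟩
  obtain ⟨v, h3, h4, h5⟩ := h p ⟨h2, h1⟩
  exact ⟨v, h4, h3, h5⟩

/-- The drawing with the inserted curves as a scene. -/
noncomputable def scene (hΓ : Γ.IsLevelPlanar) (hS : Γ.IsVisibilitySet C S) :
    Scene V (Γ.monotoneArcs S) (Γ.horizontalArcs S) where
  toArcSystem := (hS.family hΓ).sys
  left k := k.1.src
  right k := k.1.tgt
  left_lt k := k.2.2.2.1
  py_eq k := k.2.2.1
  avoid_hor k v h1 h2 h3 := hS.avoids hΓ k.2.1 v (by rw [k.2.2.2.2]; exact ⟨h1, h2, h3⟩)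
  cross_hor i k h1 h2 h3 h4 := by
    have hne : i.1 ≠ k.1 := fun e => by
      have a1 := i.2.2.1
      rw [e, k.2.2.1] at a1
      exact lt_irrefl _ a1
    obtain ⟨v, -, hv, hp⟩ := hS.nonCrossing hΓ i.2.1 k.2.1 hne
      ((hS.family hΓ).sys.fn i (G.level k.1.src), G.level k.1.src)
      ⟨((hS.family hΓ).mem_pts i).2 ⟨h1, h2, rfl⟩, by rw [k.2.2.2.2]; exact ⟨rfl, h3, h4⟩⟩
    have hx := (Prod.ext_iff.1 hp).1
    exact hv.imp (fun e => hx.trans (by rw [e]; rfl)) fun e => hx.trans (by rw [e]; rfl)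

theorem notMem_pts_of_notMem_obstacles (hΓ : Γ.IsLevelPlanar) (hS : Γ.IsVisibilitySet C S)
    {p : ℝ × ℝ} (hp : p ∉ (scene hΓ hS).obstacles) {A : Arc V} (hA : A ∈ Γ.edgeArcs ∪ S) :
    p ∉ A.pts := by
  intro hm
  rcases hS.monotone_or_horizontal hΓ hA with h | h
  · exact hp (Or.inr (Or.inl ⟨⟨A, hA, h⟩, trivial, ((hS.family hΓ).mem_pts ⟨A, hA, h⟩).1 hm⟩))
  · refine hp (Or.inr (Or.inr ⟨⟨A, hA, h⟩, trivial, ?_⟩))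
    rw [h.2.2] at hm
    exact hm

/-- A curve between vertices of `C` whose interior avoids the drawing, and that has no parallel
curve, belongs to the visibility extension. -/
theorem IsVisibilityExtension.mem (hΓ : Γ.IsLevelPlanar) (hS : Γ.IsVisibilityExtension C S)
    {A : Arc V} (hs : A.src ∈ C) (ht : A.tgt ∈ C)
    (hA : IsYMonotone (Γ.pos A.src) (Γ.pos A.tgt) A.pts ∨
      IsHorizontalSegment (Γ.pos A.src) (Γ.pos A.tgt) A.pts)
    (hfree : ∀ p ∈ A.pts, p = Γ.pos A.src ∨ p = Γ.pos A.tgt ∨ p ∉ (scene hΓ hS.1).obstacles)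
    (hpar : ∀ B ∈ Γ.edgeArcs ∪ S, A.src = B.src → A.tgt ≠ B.tgt) : A ∈ S := by
  have hcross : ∀ B ∈ Γ.edgeArcs ∪ S, Γ.NonCrossing A B := by
    rintro B hB p ⟨h1, h2⟩
    rcases hfree p h1 with rfl | rfl | h3
    · exact ⟨A.src, Or.inl rfl, hS.1.avoids hΓ hB _ h2, rfl⟩
    · exact ⟨A.tgt, Or.inr rfl, hS.1.avoids hΓ hB _ h2, rfl⟩
    · exact absurd h2 (notMem_pts_of_notMem_obstacles hΓ hS.1 h3 hB)
  have havoid : Γ.AvoidsVertices A := by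
    intro v hv
    rcases hfree _ hv with h | h | h
    · exact Or.inl (hΓ.1 h)
    · exact Or.inr (hΓ.1 h)
    · exact absurd ((scene hΓ hS.1).vertex_mem_obstacles v) h
  have hins : Γ.IsVisibilitySet C (insert A S) := by
    refine ⟨?_, ?_, ?_⟩
    · rintro B (rfl | hB)
      · exact ⟨⟨hA, havoid, fun B hB => hcross B (Or.inl hB)⟩, hs, ht⟩
      · exact hS.1.1 B hB
    · rintro B (rfl | hB) B' (rfl | hB') hne
      · exact absurd rfl hne
      · exact hcross B' (Or.inr hB')
      · exact (hcross B (Or.inr hB)).symm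
      · exact hS.1.2.1 B hB B' hB' hne
    -- The new curve has no parallel edge, so the lens condition concerns old edges only.
    · intro B hB B' hB' hne h1 h2
      have hun : Γ.edgeArcs ∪ insert A S = insert A (Γ.edgeArcs ∪ S) := Set.union_insert
      rw [hun] at hB hB'
      rcases hB with rfl | hB <;> rcases hB' with rfl | hB'
      · exact absurd rfl hne
      · exact absurd h2 (hpar B' hB' h1)
      · exact absurd h2.symm (hpar B hB h1.symm)
      · exact hS.1.2.2 B hB B' hB' hne h1 h2
  exact hS.2 hins (Set.subset_insert A S) (Set.mem_insert A S)

/-- A relation that contains the curves between vertices of `C` and the pairs of neighbours of ears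
and of vertices of degree at least 3 outside `C` relates all vertices of `C`. -/
theorem IsVisibilityExtension.related [Finite V] (hG : G.NoIsolated) (hC : G.IsVertexCover C)
    (hΓ : Γ.IsLevelPlanar) (hS : Γ.IsVisibilityExtension C S) {r : V → V → Prop}
    (hr : Equivalence r)
    (harc : ∀ A ∈ Γ.edgeArcs ∪ S, A.src ∈ C → A.tgt ∈ C → r A.src A.tgt)
    (hnbr : ∀ v, G.IsEar C v ∨ v ∈ G.highDegree C → ∀ a ∈ G.nbrs v, ∀ b ∈ G.nbrs v, r a b)
    {u w : V} (hu : u ∈ C) (hw : w ∈ C) : r u w := by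
  have hfin : (Γ.edgeArcs ∪ S).Finite := finite_edgeArcs.union (hS.1.finite hC hΓ)
  have : Finite (Γ.monotoneArcs S) := hfin.subset fun A hA => hA.1
  have : Finite (Γ.horizontalArcs S) := hfin.subset fun A hA => hA.1
  have hmono : ∀ {v a}, G.Adj v a → (⟨v, a, Γ.curve v a⟩ : Arc V) ∈ Γ.monotoneArcs S :=
    fun h => ⟨Or.inl ⟨h, rfl⟩, (hΓ.2.1 _ ⟨h, rfl⟩).1⟩
  have hedge : ∀ i : Γ.monotoneArcs S, (i.1.src ∉ C ∨ i.1.tgt ∉ C) → i.1 ∈ Γ.edgeArcs :=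
    fun i h => i.2.1.resolve_right fun hi => h.elim (fun h => h (hS.1.1 _ hi).2.1)
      fun h => h (hS.1.1 _ hi).2.2
  have hnb : ∀ {v a}, v ∉ C → (scene hΓ hS.1).Nb v a → a ∈ G.nbrs v := by
    rintro v a hv ⟨i, ⟨rfl, rfl⟩ | ⟨rfl, rfl⟩⟩
    · exact Or.inr (hedge i (Or.inl hv)).1
    · exact Or.inl (hedge i (Or.inr hv)).1
  have hjoins : ∀ u ∈ C, ∀ w ∈ C,
      Joins (scene hΓ hS.1).obstacles (Γ.x u) (G.level u) (Γ.x w) (G.level w) → r u w := by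
    rintro u hu w hw ⟨hlt, g, hg, g1, g2, g3⟩
    -- A parallel edge in the drawing would already give `r u w`. Hence there is none, and
    -- maximality puts the curve into `S`.
    by_contra hne
    let A : Arc V := ⟨u, w, {z | z.2 ∈ Set.Icc (G.level u) (G.level w) ∧ z.1 = g z.2}⟩
    have hAS : A ∈ S := by
      refine hS.mem hΓ hu hw (Or.inl ⟨hlt, g, hg.continuousOn, g1, g2, rfl⟩) ?_ ?_
      · rintro ⟨x, t⟩ ⟨⟨h1, h2⟩, h3⟩
        simp only at h1 h2 h3
        subst h3
        rcases h1.eq_or_lt with rfl | h1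
        · exact Or.inl (Prod.ext g1 rfl)
        · rcases h2.eq_or_lt with rfl | h2
          · exact Or.inr (Or.inl (Prod.ext g2 rfl))
          · exact Or.inr (Or.inr (g3 t h1 h2))
      · intro B hB (h1 : u = B.src) (h2 : w = B.tgt)
        exact hne (h1 ▸ h2 ▸ harc B hB (h1 ▸ hu) (h2 ▸ hw))
    exact hne (harc A (Or.inr hAS) hu hw)
  have hsat : (scene hΓ hS.1).IsSaturated (C : Set V) r :=
    { equiv := hr
      cov := fun i => i.2.1.elim (fun hi => hC _ _ hi.1) fun hi => Or.inl (hS.1.1 _ hi).2.1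
      hor_mem := fun k => by
        rcases k.2.1 with hk | hk
        · exact absurd k.2.2.1 (G.level_lt _ _ hk.1).ne
        · exact (hS.1.1 _ hk).2
      arc := fun i => harc i.1 i.2.1
      hor := fun k => by
        rcases k.2.1 with hk | hk
        · exact absurd k.2.2.1 (G.level_lt _ _ hk.1).ne
        · exact harc k.1 k.2.1 (hS.1.1 _ hk).2.1 (hS.1.1 _ hk).2.2
      nbr := fun v hv a b ha hb => by
        have ha' := hnb hv ha
        have hb' := hnb hv hb
        by_cases hE : G.IsEar C v ∨ v ∈ G.highDegree C
        · exact hnbr v hE a ha' b hb'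
        by_cases hab : a = b
        · rw [hab]; exact hr.refl b
        -- What remains is a vertex with one neighbour below and one above. A curve beside its two
        -- edges joins these neighbours, both of which are in `C`.
        push Not at hE
        have h2 : 1 < (G.nbrs v).ncard := (Set.one_lt_ncard_iff (Set.toFinite _)).2
          ⟨a, b, ha', hb', hab⟩
        have h3 : ¬ 3 ≤ (G.nbrs v).ncard := fun h => hE.2 ⟨hv, h⟩
        have h4 : ¬ ((∀ u, ¬ G.Adj u v) ∨ ∀ u, ¬ G.Adj v u) := fun h => hE.1 ⟨hv, by omega, h⟩
        push Not at h4
        obtain ⟨⟨p, hp⟩, q, hq⟩ := h4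
        have hpq : p ≠ q := fun e => by
          have a1 := G.level_lt _ _ hp
          have a2 := G.level_lt _ _ hq
          rw [e] at a1
          exact lt_asymm a1 a2
        have hset : {p, q} = G.nbrs v := Set.eq_of_subset_of_ncard_le (by
          rintro z (rfl | rfl)
          exacts [Or.inl hp, Or.inr hq]) (by rw [Set.ncard_pair hpq]; omega) (Set.toFinite _)
        have key : r p q := by
          refine hjoins p ((hC _ _ hp).resolve_right hv) q ((hC _ _ hq).resolve_left hv) ?_
          refine Scene.joins_of_transit (M := scene hΓ hS.1) (v := v) (s := ⟨_, hmono hp⟩)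
            (s' := ⟨_, hmono hq⟩) rfl rfl ?_ fun k => ?_
          · rintro i (rfl | rfl)
            · have hi := hedge i (Or.inl hv)
              have ht : i.1.tgt = q := (hset.symm.subset (Or.inr hi.1)).resolve_left fun h =>
                absurd (G.level_lt _ _ hi.1) (not_lt.2 (h ▸ (G.level_lt _ _ hp).le))
              exact Or.inr (Subtype.ext (Arc.ext rfl ht (hi.2.trans (by rw [ht]; rfl))))
            · have hi := hedge i (Or.inr hv)
              have ht : i.1.src = p := (hset.symm.subset (Or.inl hi.1)).resolve_right fun h =>
                absurd (G.level_lt _ _ hi.1) (not_lt.2 (h ▸ (G.level_lt _ _ hq).le))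
              exact Or.inl (Subtype.ext (Arc.ext ht rfl (hi.2.trans (by rw [ht]; rfl))))
          · rcases k.2.1 with hk | hk
            · exact absurd k.2.2.1 (G.level_lt _ _ hk.1).ne
            · exact ⟨fun e => hv (e ▸ (hS.1.1 _ hk).2.1), fun e => hv (e ▸ (hS.1.1 _ hk).2.2)⟩
        rw [← hset] at ha' hb'
        rcases ha' with rfl | rfl <;> rcases hb' with rfl | rfl
        exacts [hr.refl _, key, hr.symm key, hr.refl _]
      iso := fun v _ => by
        obtain ⟨a, ha | ha⟩ := hG v
        · exact ⟨a, ⟨_, hmono ha⟩, Or.inr ⟨rfl, rfl⟩⟩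
        · exact ⟨a, ⟨_, hmono ha⟩, Or.inl ⟨rfl, rfl⟩⟩
      joins := hjoins
      horizontal := fun u hu w hw he hlt hfree => by
        by_contra hne
        let A : Arc V := ⟨u, w, {z | z.2 = G.level u ∧ z.1 ∈ Set.Icc (Γ.x u) (Γ.x w)}⟩
        have hAS : A ∈ S := by
          refine hS.mem hΓ hu hw (Or.inr ⟨he, hlt, rfl⟩) ?_ ?_
          · rintro ⟨x, t⟩ ⟨h3, h1, h2⟩
            simp only at h1 h2 h3
            subst h3
            rcases h1.eq_or_lt with rfl | h1
            · exact Or.inl rfl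
            · rcases h2.eq_or_lt with rfl | h2
              · exact Or.inr (Or.inl (Prod.ext rfl he))
              · exact Or.inr (Or.inr (hfree x h1 h2))
          · intro B hB (h1 : u = B.src) (h2 : w = B.tgt)
            exact hne (h1 ▸ h2 ▸ harc B hB (h1 ▸ hu) (h2 ▸ hw))
        exact hne (harc A (Or.inr hAS) hu hw) }
  exact hsat.related hu hw

end LevelGraph.Drawing

/-! ### Connectedness of the core -/

namespace LevelGraph.Drawing

variable {V : Type*} {G : LevelGraph V} {Γ : G.Drawing} {C : Finset V} {S : Set (Arc V)}

variable (Γ C S) in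
/-- The vertices are equal or joined by a walk in the core. -/
def CoreRelated (u w : V) : Prop :=
  u = w ∨ ∃ hu hw, (Γ.coreGraph C S).Reachable ⟨u, hu⟩ ⟨w, hw⟩

theorem coreRelated_equivalence : Equivalence (Γ.CoreRelated C S) where
  refl _ := Or.inl rfl
  symm h := h.imp Eq.symm fun ⟨hu, hw, h⟩ => ⟨hw, hu, h.symm⟩
  trans := by
    rintro u v w (rfl | ⟨hu, hv, h⟩) (rfl | ⟨hv', hw, h'⟩)
    exacts [Or.inl rfl, Or.inr ⟨hv', hw, h'⟩, Or.inr ⟨hu, hv, h⟩, Or.inr ⟨hu, hw, h.trans h'⟩]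

theorem coreRelated_of_arc {A : Arc V} (hA : A ∈ Γ.edgeArcs ∪ S) (hs : A.src ∈ Γ.core C)
    (ht : A.tgt ∈ Γ.core C) : Γ.CoreRelated C S A.src A.tgt := by
  by_cases h : A.src = A.tgt
  · exact Or.inl h
  · exact Or.inr ⟨hs, ht, SimpleGraph.Adj.reachable
      ⟨fun e => h (congrArg Subtype.val e), A, ⟨hA, hs, ht⟩, Or.inl ⟨rfl, rfl⟩⟩⟩

theorem coreRelated_of_mem_nbrs {v a : V} (hv : v ∈ Γ.core C) (ha : a ∈ Γ.core C)
    (h : a ∈ G.nbrs v) : Γ.CoreRelated C S v a := by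
  rcases h with h | h
  · exact coreRelated_equivalence.symm (coreRelated_of_arc (A := ⟨a, v, Γ.curve a v⟩)
      (Or.inl ⟨h, rfl⟩) ha hv)
  · exact coreRelated_of_arc (A := ⟨v, a, Γ.curve v a⟩) (Or.inl ⟨h, rfl⟩) hv ha

theorem mem_core_of_mem {v : V} (hv : v ∈ C) : v ∈ Γ.core C := Or.inl (Or.inl hv)

theorem mem_of_mem_nbrs (hC : G.IsVertexCover C) {v a : V} (hv : v ∉ C) (h : a ∈ G.nbrs v) :
    a ∈ C :=
  h.elim (fun h => (hC _ _ h).resolve_right hv) fun h => (hC _ _ h).resolve_left hv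

/-- Every ear lies on one of the two sides of its neighbours. -/
theorem exists_mem_sideEars (hΓ : Γ.IsLevelPlanar) {v : V} (hv : G.IsEar C v) :
    ∃ left a b, v ∈ Γ.sideEars C left a b := by
  obtain ⟨a, b, hab, hlevel⟩ : ∃ a b, G.nbrs v = {a, b} ∧ G.level b ≤ G.level a := by
    obtain ⟨p, q, -, hpq⟩ := Set.ncard_eq_two.1 hv.2.1
    rcases le_total (G.level q) (G.level p) with h | h
    exacts [⟨p, q, hpq, h⟩, ⟨q, p, by rw [hpq, Set.pair_comm], h⟩]
  have hear : G.IsEarOf C a b v := ⟨hv, hab, hlevel⟩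
  have key : ∀ {p q c}, G.Adj p q → G.level p < G.level c → G.level c < G.level q →
      PassesLeftOf (Γ.curve p q) (Γ.pos c) ∨ PassesRightOf (Γ.curve p q) (Γ.pos c) := by
    intro p q c hpq h1 h2
    have hl := hΓ.family.passesLeftOf (Γ.edgeArc hpq) (p := Γ.pos c)
    have hr := hΓ.family.passesRightOf (Γ.edgeArc hpq) (p := Γ.pos c)
    rcases lt_trichotomy (hΓ.family.sys.fn (Γ.edgeArc hpq) (G.level c)) (Γ.x c) with h | h | h
    · exact Or.inl (hl.2 ⟨h1.le, h2.le, h⟩)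
    · have hne := ArcSystem.fn_ne_px (M := hΓ.family.sys) (i := Γ.edgeArc hpq) (v := c) h1.le h2.le
        (fun e => h1.ne' (congrArg G.level e)) fun e => h2.ne (congrArg G.level e)
      exact absurd h hne
    · exact Or.inr (hr.2 ⟨h1.le, h2.le, h⟩)
  rcases hear.mem_bottom_or_top with ⟨-, hva, hvb⟩ | ⟨-, hav, hbv⟩
  · rcases hlevel.eq_or_lt with he | hlt
    · exact ⟨false, a, b, hear, Or.inr ⟨he, G.level_lt _ _ hvb⟩⟩
    · rcases key hva (G.level_lt _ _ hvb) hlt with h | h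
      · exact ⟨true, a, b, hear, Or.inl ⟨hlt, Or.inr ⟨G.level_lt _ _ hvb, h⟩⟩⟩
      · exact ⟨false, a, b, hear, Or.inl ⟨hlt, Or.inr ⟨G.level_lt _ _ hvb, h⟩⟩⟩
  · rcases hlevel.eq_or_lt with he | hlt
    · exact ⟨true, a, b, hear, Or.inr ⟨he, G.level_lt _ _ hav⟩⟩
    · rcases key hbv hlt (G.level_lt _ _ hav) with h | h
      · exact ⟨true, a, b, hear, Or.inl ⟨hlt, Or.inl ⟨G.level_lt _ _ hav, h⟩⟩⟩
      · exact ⟨false, a, b, hear, Or.inl ⟨hlt, Or.inl ⟨G.level_lt _ _ hav, h⟩⟩⟩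

/-- The ear is chosen so that one of the two conditions in `IsOutermost` is vacuous for it. It is
thus not needed here that a side has only top or only bottom ears. -/
theorem exists_outermost [Finite V] {left : Bool} {a b v : V} (hv : v ∈ Γ.sideEars C left a b) :
    ∃ w ∈ Γ.sideEars C left a b, Γ.IsOutermost C w := by
  by_cases h : ∃ w ∈ Γ.sideEars C left a b, G.level a < G.level w
  · obtain ⟨t, ht, hat⟩ := h
    obtain ⟨w, hw, hmax⟩ := Set.exists_max_image _ G.level (Set.toFinite (Γ.sideEars C left a b))
      ⟨v, hv⟩
    exact ⟨w, hw, left, a, b, hw, fun _ => hmax, fun h => by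
      linarith [hmax t ht, hw.1.2.2]⟩
  · obtain ⟨w, hw, hmin⟩ := Set.exists_min_image _ G.level (Set.toFinite (Γ.sideEars C left a b))
      ⟨v, hv⟩
    exact ⟨w, hw, left, a, b, hw, fun h' => absurd ⟨w, hw, h'⟩ h, fun _ => hmin⟩

/-- An ear itself may be missing from the core, but an outermost ear of the same pair and side has
the same neighbours and belongs to the core. -/
theorem coreRelated_nbrs [Finite V] (hC : G.IsVertexCover C) (hΓ : Γ.IsLevelPlanar) {v a b : V}
    (hv : G.IsEar C v ∨ v ∈ G.highDegree C) (ha : a ∈ G.nbrs v) (hb : b ∈ G.nbrs v) :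
    Γ.CoreRelated C S a b := by
  have key : ∀ w ∈ Γ.core C, w ∉ C → a ∈ G.nbrs w → b ∈ G.nbrs w → Γ.CoreRelated C S a b :=
    fun w hw hwC ha hb => coreRelated_equivalence.trans
      (coreRelated_equivalence.symm (coreRelated_of_mem_nbrs hw
        (mem_core_of_mem (mem_of_mem_nbrs hC hwC ha)) ha))
      (coreRelated_of_mem_nbrs hw (mem_core_of_mem (mem_of_mem_nbrs hC hwC hb)) hb)
  rcases hv with hv | hv
  · obtain ⟨left, a', b', hmem⟩ := exists_mem_sideEars hΓ hv
    obtain ⟨w, hw, hout⟩ := exists_outermost hmem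
    have hnb : G.nbrs v = G.nbrs w := hmem.1.2.1.trans hw.1.2.1.symm
    exact key w (Or.inr (Or.inl hout)) hw.1.1.1 (hnb ▸ ha) (hnb ▸ hb)
  · exact key v (Or.inl (Or.inr hv)) hv.1 ha hb

/-- The core is connected once the vertices of the cover are connected in it. -/
theorem coreGraph_connected (hG : G.NoIsolated) (hC : G.IsVertexCover C)
    (h : ∀ u ∈ C, ∀ w ∈ C, Γ.CoreRelated C S u w) [Nonempty V] : (Γ.coreGraph C S).Connected := by
  have hrep : ∀ v ∈ Γ.core C, ∃ c ∈ C, Γ.CoreRelated C S v c := by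
    intro v hv
    by_cases hvC : v ∈ C
    · exact ⟨v, hvC, Or.inl rfl⟩
    · obtain ⟨a, ha⟩ := hG v
      have haC := mem_of_mem_nbrs hC hvC ha
      exact ⟨a, haC, coreRelated_of_mem_nbrs hv (mem_core_of_mem haC) ha⟩
  have hne : ∃ c, c ∈ C := by
    obtain ⟨v⟩ := ‹Nonempty V›
    by_cases hvC : v ∈ C
    · exact ⟨v, hvC⟩
    · obtain ⟨a, ha⟩ := hG v
      exact ⟨a, mem_of_mem_nbrs hC hvC ha⟩
  obtain ⟨c, hc⟩ := hne
  have : Nonempty (Γ.core C) := ⟨⟨c, mem_core_of_mem hc⟩⟩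
  refine ⟨fun u w => ?_⟩
  obtain ⟨a, ha, hua⟩ := hrep u u.2
  obtain ⟨b, hb, hwb⟩ := hrep w w.2
  rcases coreRelated_equivalence.trans hua (coreRelated_equivalence.trans (h a ha b hb)
    (coreRelated_equivalence.symm hwb)) with e | ⟨_, _, hr⟩
  · rw [Subtype.ext e]
  · exact hr

theorem coreIsSmallAndConnected [Finite V] (hG : G.NoIsolated) (hC : G.IsVertexCover C)
    (hΓ : Γ.IsLevelPlanar) (hS : Γ.IsVisibilitySet C S)
    (h : ∀ u ∈ C, ∀ w ∈ C, Γ.CoreRelated C S u w) : CoreIsSmallAndConnected Γ C S 388 where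
  connected _ := coreGraph_connected hG hC h
  vertices := (ncard_core_le hC hΓ).trans (Nat.mul_le_mul_right _ (by norm_num))
  edges_finite := (hS.coreArcs_bound hC hΓ).1
  edges := (hS.coreArcs_bound hC hΓ).2
  outermost := (ncard_outermost_le hC hΓ).trans (Nat.mul_le_mul_right _ (by norm_num))
  innermost := (ncard_innermost_le hC hΓ).trans (Nat.mul_le_mul_right _ (by norm_num))
  bounding := (ncard_bounding_le hC hΓ).trans (Nat.mul_le_mul_right _ (by norm_num))

theorem IsVisibilityExtension.coreRelated [Finite V] (hG : G.NoIsolated) (hC : G.IsVertexCover C)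
    (hΓ : Γ.IsLevelPlanar) (hS : Γ.IsVisibilityExtension C S) :
    ∀ u ∈ C, ∀ w ∈ C, Γ.CoreRelated C S u w := fun _ hu _ hw =>
  hS.related hG hC hΓ coreRelated_equivalence
    (fun _ hA h1 h2 => coreRelated_of_arc hA (mem_core_of_mem h1) (mem_core_of_mem h2))
    (fun _ hv _ ha _ hb => coreRelated_nbrs hC hΓ hv ha hb) hu hw

end LevelGraph.Drawing

/-! ### Refined visibility extensions -/

theorem Arc.map_injective {V W : Type*} {f : V → W} (hf : Function.Injective f) :
    Function.Injective (Arc.map f) := fun A B h =>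
  Arc.ext (hf (congrArg Arc.src h)) (hf (congrArg Arc.tgt h))
    (congrArg Arc.pts h : (Arc.map f A).pts = (Arc.map f B).pts)

namespace LevelGraph.IsRefinedVisibilityExtension

variable {V N : Type*} {G : LevelGraph V} {Γ : G.Drawing} {C : Finset V} {S : Set (Arc V)}
  {G' : LevelGraph (V ⊕ N)} {Γ' : G'.Drawing} {K : ℕ}

theorem pos_eq (h : IsRefinedVisibilityExtension Γ C S Γ' K) (v : V) :
    Γ'.pos (Sum.inl v) = Γ.pos v :=
  Prod.ext (h.x_eq v) (h.level_eq v)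

theorem inl_mem {v : V} : Sum.inl v ∈ C.map (Function.Embedding.inl : V ↪ V ⊕ N) ↔ v ∈ C :=
  Finset.mem_map' Function.Embedding.inl

theorem inr_notMem (n : N) : Sum.inr n ∉ C.map (Function.Embedding.inl : V ↪ V ⊕ N) := by
  rw [Finset.mem_map]
  rintro ⟨v, -, hv⟩
  cases hv

theorem map_mem_edgeArcs (h : IsRefinedVisibilityExtension Γ C S Γ' K) {A : Arc V}
    (hA : A ∈ Γ.edgeArcs) : A.map Sum.inl ∈ Γ'.edgeArcs :=
  ⟨(h.adj_iff _ _).2 hA.1, hA.2.trans (h.curve_eq _ _ hA.1).symm⟩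

theorem exists_of_mem_edgeArcs (h : IsRefinedVisibilityExtension Γ C S Γ' K) {A : Arc (V ⊕ N)}
    (hA : A ∈ Γ'.edgeArcs) {u w : V} (hu : A.src = Sum.inl u) (hw : A.tgt = Sum.inl w) :
    ∃ B ∈ Γ.edgeArcs, A = B.map Sum.inl := by
  obtain ⟨hadj, hpts⟩ := hA
  rw [hu, hw] at hadj hpts
  have huw := (h.adj_iff u w).1 hadj
  exact ⟨⟨u, w, Γ.curve u w⟩, ⟨huw, rfl⟩, Arc.ext hu hw (hpts.trans (h.curve_eq u w huw))⟩

theorem encloses_map (h : IsRefinedVisibilityExtension Γ C S Γ' K) {𝒜 : Set (Arc V)} {p : ℝ × ℝ}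
    (hp : Γ.Encloses 𝒜 p) : Γ'.Encloses (Arc.map Sum.inl '' 𝒜) p := by
  refine ⟨?_, ?_⟩
  · rintro _ ⟨A, hA, rfl⟩
    exact hp.1 A hA
  · have : {A ∈ Arc.map Sum.inl '' 𝒜 | G'.level A.src ≤ p.2 ∧ p.2 < G'.level A.tgt ∧
        PassesLeftOf A.pts p} = Arc.map Sum.inl '' {A ∈ 𝒜 | G.level A.src ≤ p.2 ∧
          p.2 < G.level A.tgt ∧ PassesLeftOf A.pts p} := by
      ext A
      constructor
      · rintro ⟨⟨B, hB, rfl⟩, h1, h2, h3⟩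
        exact ⟨B, ⟨hB, (h.level_eq _).symm.trans_le h1, h2.trans_eq (h.level_eq _), h3⟩, rfl⟩
      · rintro ⟨B, ⟨hB, h1, h2, h3⟩, rfl⟩
        exact ⟨⟨B, hB, rfl⟩, (h.level_eq _).trans_le h1, h2.trans_eq (h.level_eq _).symm, h3⟩
    rw [this, Set.ncard_image_of_injective _ (Arc.map_injective Sum.inl_injective)]
    exact hp.2

/-- Maximality is not claimed in the larger drawing. Distinct parallel edges there have old
endpoints, because the graph is simple and so one of them is an old visibility edge; the lens
condition is then inherited. -/
theorem isVisibilitySet (h : IsRefinedVisibilityExtension Γ C S Γ' K) :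
    Γ'.IsVisibilitySet (C.map Function.Embedding.inl) (Arc.map Sum.inl '' S) := by
  have hS := h.extension.1
  refine ⟨?_, ?_, ?_⟩
  · rintro _ ⟨A, hA, rfl⟩
    refine ⟨⟨?_, h.canInsert A hA⟩, inl_mem.2 (hS.1 A hA).2.1, inl_mem.2 (hS.1 A hA).2.2⟩
    change IsYMonotone (Γ'.pos (Sum.inl A.src)) (Γ'.pos (Sum.inl A.tgt)) A.pts ∨
      IsHorizontalSegment (Γ'.pos (Sum.inl A.src)) (Γ'.pos (Sum.inl A.tgt)) A.pts
    rw [h.pos_eq, h.pos_eq]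
    exact (hS.1 A hA).1.1
  · rintro _ ⟨A, hA, rfl⟩ _ ⟨B, hB, rfl⟩ hne p hp
    obtain ⟨v, h1, h2, rfl⟩ := hS.2.1 A hA B hB (fun e => hne (by rw [e])) p hp
    exact ⟨Sum.inl v, h1.imp (congrArg _) (congrArg _), h2.imp (congrArg _) (congrArg _),
      (h.pos_eq v).symm⟩
  · intro A hA B hB hne hs ht
    obtain ⟨u, w, hu, hw⟩ : ∃ u w : V, A.src = Sum.inl u ∧ A.tgt = Sum.inl w := by
      rcases hA with hA | ⟨A, hA, rfl⟩
      · rcases hB with hB | ⟨B, hB, rfl⟩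
        · exact absurd (congrArg Subtype.val
            (Drawing.edgeArcs_ext (A := ⟨A, hA⟩) (B := ⟨B, hB⟩) hs ht)) hne
        · exact ⟨_, _, hs, ht⟩
      · exact ⟨_, _, rfl, rfl⟩
    have key : ∀ X ∈ Γ'.edgeArcs ∪ Arc.map Sum.inl '' S, X.src = Sum.inl u → X.tgt = Sum.inl w →
        ∃ Y ∈ Γ.edgeArcs ∪ S, X = Y.map Sum.inl := by
      rintro X (hX | ⟨Y, hY, rfl⟩) h1 h2
      · obtain ⟨Y, hY, e⟩ := h.exists_of_mem_edgeArcs hX h1 h2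
        exact ⟨Y, Or.inl hY, e⟩
      · exact ⟨Y, Or.inr hY, rfl⟩
    obtain ⟨A, hA', rfl⟩ := key A hA hu hw
    obtain ⟨B, hB', rfl⟩ := key B hB (hs.symm.trans hu) (ht.symm.trans hw)
    obtain ⟨c, hc, he⟩ := hS.2.2 A hA' B hB' (fun e => hne (by rw [e])) (Sum.inl_injective hs)
      (Sum.inl_injective ht)
    refine ⟨Sum.inl c, inl_mem.2 hc, ?_⟩
    have := h.encloses_map he
    rwa [Set.image_pair, ← h.pos_eq] at this

/-- New vertices lie outside the cover, so they are not adjacent to an old vertex outside `C`. Old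
ears and vertices of high degree thereby keep their type. -/
theorem nbrs_inl (h : IsRefinedVisibilityExtension Γ C S Γ' K) {v : V} (hv : v ∉ C) :
    G'.nbrs (Sum.inl v) = Sum.inl '' G.nbrs v := by
  ext (u | n)
  · rw [Sum.inl_injective.mem_set_image]
    exact or_congr (h.adj_iff _ _) (h.adj_iff _ _)
  · constructor
    · intro hn
      exact absurd (Drawing.mem_of_mem_nbrs h.vertexCover (fun hm => hv (inl_mem.1 hm)) hn)
        (inr_notMem n)
    · rintro ⟨u, -, hu⟩
      cases hu

theorem inl_isEar_or_highDegree (h : IsRefinedVisibilityExtension Γ C S Γ' K) {v : V}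
    (hv : G.IsEar C v ∨ v ∈ G.highDegree C) :
    G'.IsEar (C.map Function.Embedding.inl) (Sum.inl v) ∨
      Sum.inl v ∈ G'.highDegree (C.map Function.Embedding.inl) := by
  have hvC : v ∉ C := hv.elim (fun h => h.1) fun h => h.1
  have hvC' : (Sum.inl v : V ⊕ N) ∉ C.map Function.Embedding.inl := fun hm => hvC (inl_mem.1 hm)
  have hcard : (G'.nbrs (Sum.inl v)).ncard = (G.nbrs v).ncard := by
    rw [h.nbrs_inl hvC, Set.ncard_image_of_injective _ Sum.inl_injective]
  refine hv.imp (fun hv => ⟨hvC', hcard.trans hv.2.1, hv.2.2.imp ?_ ?_⟩)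
    fun hv => ⟨hvC', hv.2.trans_eq hcard.symm⟩
  · rintro hn (u | n) hadj
    · exact hn u ((h.adj_iff _ _).1 hadj)
    · exact (h.vertexCover _ _ hadj).elim (inr_notMem n) hvC'
  · rintro hn (u | n) hadj
    · exact hn u ((h.adj_iff _ _).1 hadj)
    · exact (h.vertexCover _ _ hadj).elim hvC' (inr_notMem n)

theorem noIsolated (h : IsRefinedVisibilityExtension Γ C S Γ' K) (hG : G.NoIsolated) :
    G'.NoIsolated := by
  rintro (v | n)
  · obtain ⟨a, ha⟩ := hG v
    exact ⟨Sum.inl a, ha.imp (h.adj_iff _ _).2 (h.adj_iff _ _).2⟩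
  · refine Set.nonempty_of_ncard_ne_zero ?_
    rw [(h.ear n).2.1]
    norm_num

/-- The maximality of `S` in `Γ` is applied to the relation of being connected in the core of `Γ'`.
An old ear need not be crucial in `Γ'`, but `Γ'` has an outermost ear with the same neighbours. -/
theorem coreIsSmallAndConnected [Finite V] [Finite N]
    (h : IsRefinedVisibilityExtension Γ C S Γ' K) (hG : G.NoIsolated) (hC : G.IsVertexCover C)
    (hΓ : Γ.IsLevelPlanar) :
    CoreIsSmallAndConnected Γ' (C.map Function.Embedding.inl) (Arc.map Sum.inl '' S) 388 := by
  refine Drawing.coreIsSmallAndConnected (h.noIsolated hG) h.vertexCover h.levelPlanar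
    h.isVisibilitySet ?_
  have heq := Drawing.coreRelated_equivalence (Γ := Γ') (C := C.map Function.Embedding.inl)
    (S := Arc.map Sum.inl '' S)
  have hrel : ∀ u ∈ C, ∀ w ∈ C, Γ'.CoreRelated (C.map Function.Embedding.inl)
      (Arc.map Sum.inl '' S) (Sum.inl u) (Sum.inl w) := fun u hu w hw =>
    h.extension.related hG hC hΓ
      (r := fun u w => Γ'.CoreRelated (C.map Function.Embedding.inl) (Arc.map Sum.inl '' S)
        (Sum.inl u) (Sum.inl w))
      ⟨fun _ => heq.refl _, heq.symm, heq.trans⟩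
      (fun A hA h1 h2 => Drawing.coreRelated_of_arc (A := A.map Sum.inl)
        (hA.imp h.map_mem_edgeArcs fun hA => ⟨A, hA, rfl⟩)
        (Drawing.mem_core_of_mem (inl_mem.2 h1)) (Drawing.mem_core_of_mem (inl_mem.2 h2)))
      (fun v hv a ha b hb => by
        have hvC : v ∉ C := hv.elim (fun h => h.1) fun h => h.1
        have hn := h.nbrs_inl hvC
        exact Drawing.coreRelated_nbrs h.vertexCover h.levelPlanar (h.inl_isEar_or_highDegree hv)
          (hn ▸ ⟨a, ha, rfl⟩) (hn ▸ ⟨b, hb, rfl⟩)) hu hw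
  rintro (u | n) hu (w | m) hw
  · exact hrel u (inl_mem.1 hu) w (inl_mem.1 hw)
  · exact absurd hw (inr_notMem m)
  · exact absurd hu (inr_notMem n)
  · exact absurd hu (inr_notMem n)

end LevelGraph.IsRefinedVisibilityExtension

theorem mainTheorem6 :
    ∃ c : ℕ, ∀ (V : Type*) [Finite V] (G : LevelGraph V) (C : Finset V) (Γ : G.Drawing)
      (S : Set (Arc V)),
      G.NoIsolated → G.IsVertexCover C → Γ.IsLevelPlanar →
      (Γ.IsVisibilityExtension C S → LevelGraph.CoreIsSmallAndConnected Γ C S c) ∧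
      (∀ (N : Type*) [Finite N] (G' : LevelGraph (V ⊕ N)) (Γ' : G'.Drawing) (K : ℕ),
        LevelGraph.IsRefinedVisibilityExtension Γ C S Γ' K →
        LevelGraph.CoreIsSmallAndConnected Γ' (C.map Function.Embedding.inl)
          (Arc.map Sum.inl '' S) c) := by
  -- The largest of the constants is that of the edge bound, `4 * 97`.
  refine ⟨388, fun V _ G C Γ S hG hC hΓ => ⟨fun hS => ?_, fun N _ G' Γ' K h => ?_⟩⟩
  · exact LevelGraph.Drawing.coreIsSmallAndConnected hG hC hΓ hS.1 (hS.coreRelated hG hC hΓ)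
  · exact h.coreIsSmallAndConnected hG hC hΓ
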